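/- Let $R$ be an integral domain with a distinguished element $\delta$, and define quantum numbers in $R$ by $[0]=0$, $[1]=1$, $[k+1]=\delta[k]-[k-1]$. Suppose $(R,\delta)$ has $(\ell,p)$-torsion: $[\ell]$ is the first of $[1],[2],\dots$ to vanish and $1\in R$ has additive order $p$, where $\ell=\infty$, resp. $p=\infty$, means that this never happens. Put $p^{(0)}=1$ and $p^{(r)}=\ell p^{r-1}$ for $r\ge 1$. A number $a\ge 0$ is *Eve* if $a+1=c\,p^{(r)}$ for some $r\ge 0$ and $c\geq 1$ with $c<\ell$ if $r=0$ and $c<p$ if $r\ge 1$. Let $\mathrm{TL}_n$ be the Temperley–Lieb algebra on $n$ strands over $R$ with loop value $\delta$, spanned by planar diagrams $n\to n$, and let $\iota$ be its involution given by reflecting diagrams. Let $\Lambda=\{0\le m\le n: m\equiv n \bmod 2\}$. For $m\in\Lambda$ let $M(m)$ be the set of monic diagrams $n\to m$ (those in which no two of the $m$ right-hand points are linked), let $\Delta(m)$ be the cell module with basis $M(m)$, on which $\mathrm{TL}_n$ acts by composition modulo non-monic diagrams, and for $S,T\in M(m)$ let $C^m_{S,T}=S\cdot\iota T\in\mathrm{TL}_n$.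 For an idempotent $e=\iota e\in \mathrm{TL}_n$ let $N^\Delta_e(m)=\{S\in M(m): e\cdot S=0 \text{ in }\Delta(m)\}$. The idempotent $e$ is *generous* if for every $m\in\Lambda$ the elements $e\cdot S$, $S\in M(m)\setminus N^\Delta_e(m)$, form an $R$-basis of $e\Delta(m)$; it is *lavish* if for every $m\in\Lambda$ and every $T\in M(m)$ one has $\{S\in M(m): e\,C^m_{S,T}=0\text{ in }\mathrm{TL}_n\}=N^\Delta_e(m)$. Let $\mathrm{JW}_a$ be the Jones–Wenzl idempotent of $\mathrm{TL}_a$ over $\mathbb{Q}(\delta)$ ($\delta$ an indeterminate), and for $a$ Eve let $e^a$ be the Jones–Wenzl idempotent over $R$: the element of $\mathrm{TL}_a$ obtained by specialising the coefficients of $\mathrm{JW}_a$ to $(R,\delta)$. (For $a$ Eve this is the $(\ell,p)$-Jones–Wenzl idempotent.) **Proposition.** Let $\mu=(\mu_1,\dots,\mu_r)$, $\mu_i\ge 0$, be a composition of $n$ all of whose parts are Eve. If $R$ is a field, then each $e^{\mu_i}$ exists and is unique. For a general domain $R$, suppose that the $e^{\mu_i}$ are defined over $R$. Then $e^\mu=e^{\mu_1}\otimes\cdots\otimes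 e^{\mu_r}\in\mathrm{TL}_n$ is an idempotent fixed by $\iota$, and it is both generous and lavish. Moreover, divide the $n$ left-hand points into consecutive buckets of sizes $\mu_1,\dots,\mu_r$. Then for every $m\in\Lambda$ the set $N^\Delta_{e^\mu}(m)$ consists exactly of the diagrams in $M(m)$ with a simple cap inside a bucket (a link between two neighbouring left-hand points of one bucket), and the cell module $\Delta_\mu(m)=e^\mu\Delta(m)$ of $\mathrm{TL}_\mu=e^\mu\,\mathrm{TL}_n\,e^\mu$ has the $R$-basis of all $e^\mu\cdot S$, where $S$ runs over the diagrams in $M(m)$ with no simple cap inside a bucket. The set of cell indices $\Lambda_\mu=\{m\in\Lambda:\Delta_\mu(m)\ne 0\}$ is of the form $\{s_\mu,s_\mu+2,\dots,n\}$ for some $s_\mu\in\Lambda$. -/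

import Mathlib

open Polynomial

namespace TemperleyLieb

/-! ### Planar diagrams -/

/-- Position of a boundary point of an `(n, m)`-diagram, reading the boundary once around:
down the `n` left points, then up the `m` right points. -/
def pos {n m : ℕ} : Fin n ⊕ Fin m → ℕ
  | Sum.inl i => i
  | Sum.inr j => n + (m - 1 - j)

/-- A Temperley-Lieb diagram `n → m` (without closed loops): a planar perfect matching of `n` points
on the left and `m` points on the right, both numbered from top to bottom. -/
@[ext]
structure Diagram (n m : ℕ) where
  /-- The point to which a given point is linked. -/
  partner : Fin n ⊕ Fin m → Fin n ⊕ Fin m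
  partner_partner : ∀ x, partner (partner x) = x
  partner_ne : ∀ x, partner x ≠ x
  noncrossing : ∀ x y, pos x < pos y → pos y < pos (partner x) → pos (partner y) < pos (partner x)

namespace Diagram

instance {n m : ℕ} : DecidableEq (Diagram n m) := fun D E =>
  decidable_of_iff (D.partner = E.partner) Diagram.ext_iff.symm

noncomputable instance {n m : ℕ} : Fintype (Diagram n m) :=
  Fintype.ofInjective Diagram.partner fun _ _ h => Diagram.ext h

/-- The identity diagram. -/
def identity (n : ℕ) : Diagram n n where
  partner := Sum.swap
  partner_partner := Sum.swap_swap
  partner_ne := by rintro (x | x) <;> simp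
  noncrossing := by
    rintro (x | x) (y | y) <;> simp [pos] <;> omega

/-- The diagram `2 → 2` in which both pairs of points on the same side are linked. -/
def cupCap : Diagram 2 2 where
  partner := Sum.map (Equiv.swap 0 1) (Equiv.swap 0 1)
  partner_partner := by decide
  partner_ne := by decide
  noncrossing := by decide

/-- The left-right reflection of a diagram. -/
def flip {n m : ℕ} (D : Diagram n m) : Diagram m n where
  partner x := (D.partner x.swap).swap
  partner_partner x := by simp [D.partner_partner]
  partner_ne x h := D.partner_ne x.swap (by simpa using congrArg Sum.swap h)
  noncrossing x y h1 h2 := by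
    have key : ∀ z : Fin n ⊕ Fin m, pos z.swap + pos z + 1 = n + m := by
      rintro (z | z) <;> simp [pos] <;> omega
    have a1 := key x.swap
    have a2 := key y.swap
    have a3 := key (D.partner x.swap)
    have a4 := key (D.partner y.swap)
    simp only [Sum.swap_swap] at a1 a2
    by_contra hc
    have hne : pos (D.partner x.swap) ≠ pos (D.partner y.swap) := by
      intro he
      have hinj : Function.Injective (pos : Fin n ⊕ Fin m → ℕ) := by
        rintro (u | u) (v | v) <;> simp [pos, Fin.ext_iff] <;> omega
      have h3 := congrArg D.partner (hinj he)
      rw [D.partner_partner, D.partner_partner] at h3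
      rw [h3] at a1
      omega
    have h3 := D.noncrossing (D.partner y.swap) (D.partner x.swap) (by omega)
    rw [D.partner_partner, D.partner_partner] at h3
    have h4 := D.noncrossing (D.partner x.swap) y.swap (by omega)
    rw [D.partner_partner] at h4
    omega

/-- The boundary points of a juxtaposition, sorted by the two diagrams they come from. -/
def tensorEquiv (n m n' m' : ℕ) :
    (Fin n ⊕ Fin m) ⊕ (Fin n' ⊕ Fin m') ≃ Fin (n + n') ⊕ Fin (m + m') :=
  (Equiv.sumSumSumComm _ _ _ _).trans (Equiv.sumCongr finSumFinEquiv finSumFinEquiv)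

/-- Juxtaposition: `D` above `E`. -/
def tensor {n m n' m' : ℕ} (D : Diagram n m) (E : Diagram n' m') :
    Diagram (n + n') (m + m') where
  partner x := tensorEquiv n m n' m'
    (Sum.map D.partner E.partner ((tensorEquiv n m n' m').symm x))
  partner_partner x := by
    obtain ⟨x, rfl⟩ := (tensorEquiv n m n' m').surjective x
    rcases x with x | x <;> simp [D.partner_partner, E.partner_partner]
  partner_ne x := by
    obtain ⟨x, rfl⟩ := (tensorEquiv n m n' m').surjective x
    rcases x with x | x <;> simp [D.partner_ne, E.partner_ne]
  noncrossing x y := by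
    obtain ⟨x, rfl⟩ := (tensorEquiv n m n' m').surjective x
    obtain ⟨y, rfl⟩ := (tensorEquiv n m n' m').surjective y
    have k1 : ∀ z : Fin n ⊕ Fin m,
        (pos (tensorEquiv n m n' m' (Sum.inl z)) = pos z ∧ pos z < n) ∨
        (pos (tensorEquiv n m n' m' (Sum.inl z)) = pos z + n' + m' ∧ n ≤ pos z) := by
      rintro (z | z) <;> simp [pos, tensorEquiv] <;> omega
    have k2 : ∀ z : Fin n' ⊕ Fin m',
        pos (tensorEquiv n m n' m' (Sum.inr z)) = pos z + n ∧ pos z < n' + m' := by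
      rintro (z | z) <;> (simp [pos, tensorEquiv]; omega)
    rcases x with x | x <;> rcases y with y | y <;>
      simp only [Equiv.symm_apply_apply, Sum.map_inl, Sum.map_inr]
    · have h1 := k1 x
      have h2 := k1 y
      have h3 := k1 (D.partner x)
      have h4 := k1 (D.partner y)
      have h5 := D.noncrossing x y
      omega
    · have h1 := k1 x
      have h2 := k2 y
      have h3 := k1 (D.partner x)
      have h4 := k2 (E.partner y)
      omega
    · have h1 := k2 x
      have h2 := k1 y
      have h3 := k2 (E.partner x)
      have h4 := k1 (D.partner y)
      omega
    · have h1 := k2 x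
      have h2 := k2 y
      have h3 := k2 (E.partner x)
      have h4 := k2 (E.partner y)
      have h5 := E.noncrossing x y
      omega

/-- A diagram `n → m` is monic if all its `m` right points lie on through strands. -/
def IsMonic {n m : ℕ} (D : Diagram n m) : Prop := ∀ j, (D.partner (Sum.inr j)).isLeft = true

instance {n m : ℕ} (D : Diagram n m) : Decidable D.IsMonic :=
  inferInstanceAs (Decidable (∀ j, (D.partner (Sum.inr j)).isLeft = true))

/-! Composition: glue the right points of `D` to the left points of `E`. -/

/-- The links of the picture obtained by gluing `D` and `E` along their `m` common points. -/
def glueRel {n m k : ℕ} (D : Diagram n m) (E : Diagram m k) (x y : Fin n ⊕ Fin m ⊕ Fin k) : Prop :=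
  (∃ a, x = Sum.map id Sum.inl a ∧ y = Sum.map id Sum.inl (D.partner a)) ∨
  (∃ b, x = Sum.inr b ∧ y = Sum.inr (E.partner b))

/-- Lying on the same connected component of the glued picture. -/
def glueSetoid {n m k : ℕ} (D : Diagram n m) (E : Diagram m k) : Setoid (Fin n ⊕ Fin m ⊕ Fin k) :=
  Relation.EqvGen.setoid (glueRel D E)

/-- The outer boundary points of the glued picture. -/
def outer {n k : ℕ} (m : ℕ) : Fin n ⊕ Fin k → Fin n ⊕ Fin m ⊕ Fin k := Sum.map id Sum.inr

/-- `F` is the diagram obtained from the glued picture by deleting the closed loops. -/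
def IsComposite {n m k : ℕ} (D : Diagram n m) (E : Diagram m k) (F : Diagram n k) : Prop :=
  ∀ x, glueSetoid D E (outer m x) (outer m (F.partner x))

/-- The number of closed loops: components of the glued picture without outer points. -/
noncomputable def loops {n m k : ℕ} (D : Diagram n m) (E : Diagram m k) : ℕ :=
  Nat.card {c : Quotient (glueSetoid D E) // ∀ x, Quotient.mk _ (outer m x) ≠ c}

end Diagram

/-! ### The Temperley-Lieb category over `R` with loop value `δ` -/

/-- Morphisms `n → m`: formal `R`-linear combinations of diagrams. -/
abbrev Mor (R : Type*) (n m : ℕ) := Diagram n m → R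

/-- The underlying module of the Temperley-Lieb algebra on `n` strands; its product is `comp δ`. -/
abbrev TL (R : Type*) (n : ℕ) := Mor R n n

section
variable {R : Type*} [CommRing R]

/-- A diagram as a morphism. -/
def single {n m : ℕ} (D : Diagram n m) : Mor R n m := Pi.single D 1

open Classical in
/-- Composition: the bilinear extension of gluing, each closed loop being replaced by `δ`. -/
noncomputable def comp (δ : R) {n m k : ℕ} (f : Mor R n m) (g : Mor R m k) : Mor R n k :=
  fun F => ∑ D : Diagram n m, ∑ E : Diagram m k, if D.IsComposite E F then δ ^ D.loops E * (f D * g E) else 0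

/-- The bilinear extension of juxtaposition. -/
noncomputable def tensor {n m n' m' : ℕ} (f : Mor R n m) (g : Mor R n' m') :
    Mor R (n + n') (m + m') :=
  fun F => ∑ D : Diagram n m, ∑ E : Diagram n' m', if D.tensor E = F then f D * g E else 0

/-- The natural involution: the linear extension of reflection. -/
def involution {n m : ℕ} (f : Mor R n m) : Mor R m n := fun D => f D.flip

/-! ### The cellular structure of the Temperley-Lieb algebra -/

/-- The cell indices of `TL_n`. -/
def cellIndices (n : ℕ) : Set ℕ := {m | m ≤ n ∧ m ≡ n [MOD 2]}

/-- The tableaux `M(m)` of `TL_n`: the monic diagrams `n → m`. -/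
abbrev Tableau (n m : ℕ) := {S : Diagram n m // S.IsMonic}

/-- The cellular basis element `C^m_{S,T}`. -/
noncomputable def cellBasis (δ : R) {n m : ℕ} (S T : Tableau n m) : TL R n :=
  comp δ (single S.1) (single T.1.flip)

/-- The action of `a : TL_n` on the cell module `Δ(m)`, the free module on `M(m)`:
compose with `a` and discard the diagrams that are not monic. -/
noncomputable def cellAction (δ : R) {n : ℕ} (m : ℕ) (a : TL R n) :
    (Tableau n m → R) →ₗ[R] (Tableau n m → R) :=
  Matrix.mulVecLin (Matrix.of fun U S => comp δ a (single S.1) U.1)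

/-- The element `e · S` of `Δ(m)`. -/
noncomputable def actOn (δ : R) {n m : ℕ} (e : TL R n) (S : Tableau n m) : Tableau n m → R :=
  cellAction δ m e (Pi.single S 1)

/-- The module `e Δ(m)`, which is the cell module with index `m` of the algebra `e TL_n e`. -/
noncomputable def truncatedCell (δ : R) {n : ℕ} (m : ℕ) (e : TL R n) :
    Submodule R (Tableau n m → R) :=
  LinearMap.range (cellAction δ m e)

/-- The cell indices of `e TL_n e`. -/
def truncatedIndices (δ : R) {n : ℕ} (e : TL R n) : Set ℕ :=
  {m ∈ cellIndices n | truncatedCell δ m e ≠ ⊥}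

/-- The tableaux killed by `e` in the cell module `Δ(m)`. -/
def killedCell (δ : R) {n : ℕ} (m : ℕ) (e : TL R n) : Set (Tableau n m) :=
  {S | actOn δ e S = 0}

/-- The tableaux `S` such that `e · C^m_{S,T} = 0` in the algebra, that is, which are killed by `e`
in the left ideal generated by the `C^m_{S,T}` with `T` fixed. -/
def killedIdeal (δ : R) {n m : ℕ} (e : TL R n) (T : Tableau n m) : Set (Tableau n m) :=
  {S | comp δ e (cellBasis δ S T) = 0}

/-- The family `v` is a basis of the submodule `W`. -/
def IsBasisOf {ι V : Type*} [AddCommGroup V] [Module R V] (v : ι → V) (W : Submodule R V) : Prop :=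
  LinearIndependent R v ∧ Submodule.span R (Set.range v) = W

/-- `e` is generous: for all `m` the elements `e · S`, for the tableaux `S` not killed by `e`,
form a basis of `e Δ(m)`. -/
def IsGenerous (δ : R) {n : ℕ} (e : TL R n) : Prop :=
  ∀ m ∈ cellIndices n,
    IsBasisOf (fun S : {S : Tableau n m // S ∉ killedCell δ m e} => actOn δ e S.1)
      (truncatedCell δ m e)

/-- `e` is lavish: a tableau is killed by `e` in the left ideal as soon as it is killed in the cell
module, and conversely. -/
def IsLavish (δ : R) {n : ℕ} (e : TL R n) : Prop :=
  ∀ m ∈ cellIndices n, ∀ T : Tableau n m, killedIdeal δ e T = killedCell δ m e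

/-! ### Quantum numbers, torsion, Eve numbers -/

/-- The quantum number `[n]` with `[2] = δ`. -/
def qnum (δ : R) : ℕ → R
  | 0 => 0
  | 1 => 1
  | n + 2 => δ * qnum δ (n + 1) - qnum δ n

/-- The pointed ring `(R, δ)` has `(ℓ, p)`-torsion: `[ℓ]` is the first quantum number to vanish
after `[0] = 0`, and `1` has additive order `p`; `⊤` stands for "never". -/
structure HasTorsion (δ : R) (ℓ p : ℕ∞) : Prop where
  ell_pos : 0 < ℓ
  qnum_ne_zero : ∀ k : ℕ, 0 < k → (k : ℕ∞) < ℓ → qnum δ k ≠ 0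
  qnum_eq_zero : ∀ k : ℕ, (k : ℕ∞) = ℓ → qnum δ k = 0
  p_pos : 0 < p
  cast_ne_zero : ∀ k : ℕ, 0 < k → (k : ℕ∞) < p → (k : R) ≠ 0
  cast_eq_zero : ∀ k : ℕ, (k : ℕ∞) = p → (k : R) = 0

end

/-- `p^{(0)} = 1` and `p^{(r)} = ℓ p^{r-1}` for `r > 0`. -/
def mixedPow (ℓ p : ℕ∞) : ℕ → ℕ∞
  | 0 => 1
  | r + 1 => ℓ * p ^ r

/-- `n` is Eve: `n + 1 = a p^{(r)}` has a single non-zero `(ℓ, p)`-digit `a`. -/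
def IsEve (ℓ p : ℕ∞) (n : ℕ) : Prop :=
  ∃ a r : ℕ, 0 < a ∧ (a : ℕ∞) < (if r = 0 then ℓ else p) ∧
    ((n + 1 : ℕ) : ℕ∞) = (a : ℕ∞) * mixedPow ℓ p r

/-! ### Jones-Wenzl idempotents -/

/-- The field `ℚ(δ)` of rational functions in an indeterminate `δ`. -/
abbrev GenField := FractionRing ℤ[X]

/-- The indeterminate `δ` of `ℚ(δ)`. -/
noncomputable def genDelta : GenField := algebraMap ℤ[X] GenField X

/-- The Jones-Wenzl idempotent of `TL_n` over `ℚ(δ)`, by Wenzl's recursion. -/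
noncomputable def jonesWenzl : (n : ℕ) → TL GenField n
  | 0 => single (Diagram.identity 0)
  | 1 => single (Diagram.identity 1)
  | n + 2 =>
    let f : Mor GenField (n + 1 + 1) (n + 1 + 1) :=
      tensor (jonesWenzl (n + 1)) (single (Diagram.identity 1))
    let u : TL GenField (n + 2) := single ((Diagram.identity n).tensor Diagram.cupCap)
    f - (qnum genDelta (n + 1) / qnum genDelta (n + 2)) • comp genDelta (comp genDelta f u) f

/-- `e` is the Jones-Wenzl idempotent of `TL_n` over the pointed domain `(R, δ)`: the specialisation
of the generic one. Each coefficient of the latter is a fraction `a / b` of integral polynomials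
with `b(δ) ≠ 0`, and the corresponding coefficient of `e` is `a(δ) / b(δ)`. -/
def IsJonesWenzl {R : Type*} [CommRing R] (δ : R) {n : ℕ} (e : TL R n) : Prop :=
  ∀ D : Diagram n n, ∃ a b : ℤ[X], aeval δ b ≠ 0 ∧
    jonesWenzl n D * algebraMap ℤ[X] GenField b = algebraMap ℤ[X] GenField a ∧
    e D * aeval δ b = aeval δ a

/-! ### Compositions -/

/-- For a composition `μ` of `n = μ.sum`, the element `e^{μ_1} ⊗ ⋯ ⊗ e^{μ_r}` of `TL_n`. -/
noncomputable def tensorIdem {R : Type*} [CommRing R] (e : (a : ℕ) → TL R a) :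
    (μ : List ℕ) → TL R μ.sum
  | [] => single (Diagram.identity 0)
  | a :: μ => tensor (e a) (tensorIdem e μ)

/-- The diagram has a simple cap inside a bucket: it links two neighbouring left points `i` and
`i + 1` which lie in the same bucket. The bucket with (zero-based) number `j` consists of the left
points `i` with `μ_0 + ⋯ + μ_{j-1} ≤ i < μ_0 + ⋯ + μ_j`. -/
def HasBucketCap (μ : List ℕ) {m : ℕ} (S : Tableau μ.sum m) : Prop :=
  ∃ i i' : Fin μ.sum, (i' : ℕ) = i + 1 ∧ S.1.partner (Sum.inl i) = Sum.inl i' ∧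
    ∃ j < μ.length, (μ.take j).sum ≤ i ∧ (i' : ℕ) < (μ.take (j + 1)).sum

end TemperleyLieb

/-! Everything asserted about e^μ follows from the properties collected in `IsLinkProjector`: e^μ is
the identity plus a combination of diagrams with a simple cap inside a bucket, and it annihilates
every such diagram from the left. A left link of the first factor survives in a product, so left
multiplication by e^μ does not change the coefficients at diagrams without bucket cap
(`IsLinkProjector.comp_apply`). Hence e^μ · S is 0 if S has a bucket cap, and S plus tableaux with
bucket caps otherwise. This gives idempotency, the killed tableaux, the bases and generosity.
Lavishness holds because S · ιT acquires no bucket cap that S lacks, T being monic. The set of cell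
indices contains n, through the identity diagram, and is closed under m ↦ m + 2 below n, since an
outermost left link can be cut into two through strands (`Diagram.exists_cut`).

The support property is planar: a diagram a → a other than the identity has a left link, and a left
link encloses a simple cap. For the annihilation property, the Temperley-Lieb category is
represented by matrices indexed by two-letter words (`rep`): arcs have weights 1 or q, where q + q⁻¹
= δ. This is a functor (`rep_comp`), faithful over every commutative ring by a triangularity
argument (`rep_injective`). Wenzl's recursion shows that the generic Jones-Wenzl idempotent becomes
an explicit matrix `symProj`, of rank one in each weight, with Gaussian binomials in Q = q² as
denominators (`rep_jonesWenzl`). From this matrix one reads off that caps are killed, that the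
identity has coefficient 1 and that ι fixes the idempotent. After q has been adjoined formally
(`Quad`), these facts pass from ℚ(δ) through ℤ[X] to R.

Existence over a field: norms of the Gaussian binomials (n choose k) give a common denominator
(`exists_numerator`), which must not vanish at δ when n is Eve. If n + 1 < ℓ, all quantum numbers
involved are nonzero. If n + 1 = aN with N = p^{(r)} and r ≥ 1, then ∏_{i=1}^{N} (1 - Q^i X) = 1 -
X^N, so ∏_{i=1}^{n} (1 - Q^i X) = (1 + X + ⋯ + X^{N-1}) (1 - X^N)^{a-1}. By the q-binomial theorem
the Gaussian binomials are, up to sign and powers of Q, its coefficients, which are ± binomials of a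
- 1 < p (`gauss_ne_zero_of_isEve`). -/

namespace TemperleyLieb

/-! ### State sums of planar matchings -/

section Contraction

/-- The weight of an arc whose first end has state `x` and whose second end has state `y`. -/
def arcWeight {S : Type*} [CommRing S] (q : Sˣ) : Bool → Bool → S
  | true, false => 1
  | false, true => q
  | _, _ => 0

/-- The weight of a state at which two points are glued. -/
def glueWeight {S : Type*} [CommRing S] (q : Sˣ) : Bool → S
  | true => 1
  | false => ((q⁻¹ : Sˣ) : S)

/-- `f` restricts to a noncrossing perfect matching of the points in `A`, in the order given
by `ord`. -/
structure IsPlanarMatching {V : Type*} (ord : V → ℕ) (A : Finset V) (f : V → V) : Prop where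
  mem : ∀ x ∈ A, f x ∈ A
  invol : ∀ x ∈ A, f (f x) = x
  ne : ∀ x ∈ A, f x ≠ x
  noncrossing : ∀ x ∈ A, ∀ y ∈ A, ord x < ord y → ord y < ord (f x) → ord (f y) < ord (f x)

/-- The product of the weights of all arcs of a matching. -/
def arcProd {V S : Type*} [CommRing S] (q : Sˣ) (ord : V → ℕ) (A : Finset V) (f : V → V)
    (σ : V → Bool) : S :=
  ∏ x ∈ A, if ord x < ord (f x) then arcWeight q (σ x) (σ (f x)) else 1

/-- The equivalence classes met by `A` meet it exactly in the links of `f`. -/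
def Links {V : Type*} (s : Setoid V) (A : Finset V) (f : V → V) : Prop :=
  ∀ x ∈ A, s x (f x) ∧ ∀ y ∈ A, s x y → y = x ∨ y = f x

/-- The equivalence classes without a point in `A`. -/
def deadClasses {V : Type*} (s : Setoid V) (A : Finset V) : Set (Set V) :=
  {c | ∃ x, c = {y | s x y} ∧ ∀ z ∈ A, ¬ s x z}

/-- The equivalence relation obtained by identifying `a` and `b`. -/
def mergeSetoid {V : Type*} (s : Setoid V) (a b : V) : Setoid V where
  r x y := s x y ∨ (s x a ∧ s b y) ∨ (s x b ∧ s a y)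
  iseqv := by
    have hs := fun {x y} => s.symm' (x := x) (y := y)
    have ht := fun {x y z} => s.trans' (x := x) (y := y) (z := z)
    refine ⟨fun x => Or.inl (s.refl' x), ?_, ?_⟩
    · rintro x y (h | ⟨h1, h2⟩ | ⟨h1, h2⟩)
      · exact Or.inl (hs h)
      · exact Or.inr (Or.inr ⟨hs h2, hs h1⟩)
      · exact Or.inr (Or.inl ⟨hs h2, hs h1⟩)
    · rintro x y z (h | ⟨h1, h2⟩ | ⟨h1, h2⟩) (h' | ⟨h1', h2'⟩ | ⟨h1', h2'⟩)
      · exact Or.inl (ht h h')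
      · exact Or.inr (Or.inl ⟨ht h h1', h2'⟩)
      · exact Or.inr (Or.inr ⟨ht h h1', h2'⟩)
      · exact Or.inr (Or.inl ⟨h1, ht h2 h'⟩)
      · exact Or.inr (Or.inl ⟨h1, h2'⟩)
      · exact Or.inl (ht h1 h2')
      · exact Or.inr (Or.inr ⟨h1, ht h2 h'⟩)
      · exact Or.inl (ht h1 h2')
      · exact Or.inr (Or.inr ⟨h1, h2'⟩)

/-- The matching obtained by gluing the points `a` and `b`. -/
def contract {V : Type*} [DecidableEq V] (f : V → V) (a b : V) (x : V) : V :=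
  if x = f a then f b else if x = f b then f a else f x

variable {V : Type*} {ord : V → ℕ} {A : Finset V} {f : V → V} {a b : V}

/-- The noncrossing condition without reference to which end of a link comes first: `v` lies between
the ends of the link of `u` if and only if `f v` does. It combines the condition for all eight
choices of ends. -/
theorem IsPlanarMatching.symm_noncrossing (hord : Function.Injective ord)
    (hf : IsPlanarMatching ord A f) {u v : V} (hu : u ∈ A) (hv : v ∈ A) (huv : v ≠ u)
    (hfuv : v ≠ f u) :
    (ord u < ord v ↔ ord (f u) < ord v) ↔ (ord u < ord (f v) ↔ ord (f u) < ord (f v)) := by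
  have o : ∀ u v, u ≠ v → ord u ≠ ord v := fun u v h h' => h (hord h')
  have hfi : ∀ x ∈ A, ∀ y ∈ A, f x = f y → x = y := fun x hx y hy h => by
    rw [← hf.invol x hx, h, hf.invol y hy]
  have a0 := o _ _ (hf.ne u hu)
  have a1 := o _ _ (hf.ne v hv)
  have a2 := o _ _ huv
  have a3 := o _ _ hfuv
  have a4 := o (f v) (f u) fun h => huv (hfi _ hv _ hu h)
  have a5 := o (f v) u fun h => hfuv (by rw [← h, hf.invol v hv])
  have b1 := hf.noncrossing u hu v hv
  have b2 := hf.noncrossing (f u) (hf.mem u hu) v hv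
  have b3 := hf.noncrossing u hu (f v) (hf.mem v hv)
  have b4 := hf.noncrossing (f u) (hf.mem u hu) (f v) (hf.mem v hv)
  have b5 := hf.noncrossing v hv u hu
  have b6 := hf.noncrossing (f v) (hf.mem v hv) u hu
  have b7 := hf.noncrossing v hv (f u) (hf.mem u hu)
  have b8 := hf.noncrossing (f v) (hf.mem v hv) (f u) (hf.mem u hu)
  simp only [hf.invol u hu, hf.invol v hv] at b1 b2 b3 b4 b5 b6 b7 b8
  omega

variable [DecidableEq V]

/-- Since no point of `A` lies between `a` and `b`, every remaining point sees both on the same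
side. The interval from `f a` to `f b` is therefore, for these points, the symmetric difference of
the intervals from `a` to `f a` and from `b` to `f b`, and inherits noncrossing from them. -/
theorem isPlanarMatching_contract (hord : Function.Injective ord) (hf : IsPlanarMatching ord A f)
    (ha : a ∈ A) (hb : b ∈ A) (hab : ord a < ord b)
    (hadj : ∀ z ∈ A, ¬ (ord a < ord z ∧ ord z < ord b)) :
    IsPlanarMatching ord ((A.erase a).erase b) (contract f a b) := by
  have hfi : ∀ x ∈ A, ∀ y ∈ A, f x = f y → x = y := fun x hx y hy h => by
    rw [← hf.invol x hx, h, hf.invol y hy]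
  have hne : a ≠ b := fun h => by simp [h] at hab
  have hinva := hf.invol a ha
  have hinvb := hf.invol b hb
  have hnea := hf.ne a ha
  have hneb := hf.ne b hb
  have hm : ∀ x ∈ (A.erase a).erase b, contract f a b x ∈ (A.erase a).erase b := fun x hx => by
    simp only [Finset.mem_erase] at hx ⊢
    obtain ⟨hxb, hxa, hx⟩ := hx
    have h1 := hf.invol x hx
    have h2 := hf.mem x hx
    have h3 := hf.mem a ha
    have h4 := hf.mem b hb
    unfold contract
    grind
  have hinv : ∀ x ∈ (A.erase a).erase b, contract f a b (contract f a b x) = x := fun x hx => by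
    simp only [Finset.mem_erase] at hx
    obtain ⟨hxb, hxa, hx⟩ := hx
    have h1 := hf.invol x hx
    unfold contract
    grind
  refine ⟨hm, hinv, fun x hx => ?_, fun x hx y hy => ?_⟩
  · simp only [Finset.mem_erase] at hx
    obtain ⟨hxb, hxa, hx⟩ := hx
    have h1 := hf.ne x hx
    have h2 := hfi a ha b hb
    unfold contract
    grind
  · have o : ∀ u v, u ≠ v → ord u ≠ ord v := fun u v h h' => h (hord h')
    have hside : ∀ z ∈ (A.erase a).erase b, (ord a < ord z ↔ ord b < ord z) := fun z hz => by
      simp only [Finset.mem_erase] at hz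
      have h1 := hadj z hz.2.2
      have h2 := o _ _ hz.1
      omega
    have hfy := hm y hy
    have hinvx := hinv x hx
    have hinvy := hinv y hy
    have hsy := hside y hy
    have hsfy := hside _ hfy
    have hsx := hside x hx
    have hsfx := hside _ (hm x hx)
    simp only [Finset.mem_erase] at hx hy
    obtain ⟨hxb, hxa, hx⟩ := hx
    obtain ⟨hyb, hya, hy⟩ := hy
    intro h1 h2
    have hyx : y ≠ x := fun h => by simp [h] at h1
    have hyx' : y ≠ contract f a b x := fun h => by simp [← h] at h2
    have key : (ord x < ord y ↔ ord (contract f a b x) < ord y) ↔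
        (ord x < ord (contract f a b y) ↔ ord (contract f a b x) < ord (contract f a b y)) := by
      have n1 := fun h h' => hf.symm_noncrossing hord hx hy h h'
      have n2 := fun h h' => hf.symm_noncrossing hord ha hy h h'
      have n3 := fun h h' => hf.symm_noncrossing hord hb hy h h'
      have n4 := fun h h' => hf.symm_noncrossing hord hx ha h h'
      have n5 := fun h h' => hf.symm_noncrossing hord hx hb h h'
      have hix := hf.invol x hx
      by_cases c1 : x = f a
      · have e1 : contract f a b x = f b := if_pos c1
        by_cases c2 : y = f a
        · exact absurd (c2.trans c1.symm) hyx
        by_cases c3 : y = f b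
        · exact absurd (c3.trans e1.symm) hyx'
        have e2 : contract f a b y = f y := by simp [contract, c2, c3]
        rw [e2] at hsfy
        have n2 := n2 hya c2
        have n3 := n3 hyb c3
        rw [e1, e2, c1]
        omega
      by_cases c1' : x = f b
      · have e1 : contract f a b x = f a := by
          unfold contract
          rw [if_neg c1, if_pos c1']
        by_cases c2 : y = f a
        · exact absurd (c2.trans e1.symm) hyx'
        by_cases c3 : y = f b
        · exact absurd (c3.trans c1'.symm) hyx
        have e2 : contract f a b y = f y := by simp [contract, c2, c3]
        rw [e2] at hsfy
        have n2 := n2 hya c2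
        have n3 := n3 hyb c3
        rw [e1, e2, c1']
        omega
      have e1 : contract f a b x = f x := by simp [contract, c1, c1']
      rw [e1] at hyx'
      have n4 := n4 (Ne.symm hxa) (fun h => c1 (by rw [h, hix]))
      have n5 := n5 (Ne.symm hxb) (fun h => c1' (by rw [h, hix]))
      have n1 := n1 hyx hyx'
      have hxab : ord a < ord x ↔ ord b < ord x := hsx
      have o1 := o _ _ hxa
      have o2 := o _ _ hxb
      have o3 := o (f x) a fun h => c1 (by rw [← h, hix])
      have o4 := o (f x) b fun h => c1' (by rw [← h, hix])
      rw [e1] at hsfx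
      by_cases c2 : y = f a
      · have e2 : contract f a b y = f b := if_pos c2
        rw [e1, e2, c2]
        omega
      by_cases c3 : y = f b
      · have e2 : contract f a b y = f a := by
          unfold contract
          rw [if_neg c2, if_pos c3]
        rw [e1, e2, c3]
        omega
      have e2 : contract f a b y = f y := by simp [contract, c2, c3]
      rw [e1, e2]
      exact n1
    have m1 := o (contract f a b y) x fun h => hyx' (by rw [← h, hinvy])
    have m2 := o (contract f a b y) (contract f a b x) fun h => hyx (by rw [← hinvy, h, hinvx])
    omega

theorem links_contract {s : Setoid V} (hf : IsPlanarMatching ord A f) (hs : Links s A f)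
    (ha : a ∈ A) (hb : b ∈ A) :
    Links (mergeSetoid s a b) ((A.erase a).erase b) (contract f a b) := by
  have hs1 := fun {x y} => s.symm' (x := x) (y := y)
  have ht := fun {x y z} => s.trans' (x := x) (y := y) (z := z)
  have hA := hs a ha
  have hB := hs b hb
  intro x hx
  simp only [Finset.mem_erase] at hx
  obtain ⟨hxb, hxa, hx⟩ := hx
  constructor
  · change s x _ ∨ (s x a ∧ s b _) ∨ (s x b ∧ s a _)
    unfold contract
    split_ifs with h1 h2
    · exact Or.inr (Or.inl ⟨h1 ▸ hs1 hA.1, hB.1⟩)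
    · exact Or.inr (Or.inr ⟨h2 ▸ hs1 hB.1, hA.1⟩)
    · exact Or.inl (hs x hx).1
  · intro y hy h
    simp only [Finset.mem_erase] at hy
    obtain ⟨hyb, hya, hy⟩ := hy
    have hfi : ∀ x ∈ A, ∀ y ∈ A, f x = f y → x = y := fun x hx y hy h => by
      rw [← hf.invol x hx, h, hf.invol y hy]
    have hinva := hf.invol a ha
    have hinvb := hf.invol b hb
    unfold contract
    rcases h with h | ⟨h1, h2⟩ | ⟨h1, h2⟩
    · have := (hs x hx).2 y hy h
      grind
    · have h3 := hA.2 x hx (hs1 h1)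
      have h4 := hB.2 y hy h2
      grind
    · have h3 := hB.2 x hx (hs1 h1)
      have h4 := hA.2 y hy h2
      grind

/-- If `a` and `b` are linked to each other, their class has no other point in `A` and closes up.
Otherwise the merged class still contains `f a` and `f b`, and no class dies. -/
theorem ncard_deadClasses_contract [Finite V] {s : Setoid V} (hf : IsPlanarMatching ord A f)
    (hs : Links s A f) (ha : a ∈ A) (hb : b ∈ A) (hne : a ≠ b) :
    (deadClasses (mergeSetoid s a b) ((A.erase a).erase b)).ncard =
      (deadClasses s A).ncard + if f a = b then 1 else 0 := by
  have hs1 := fun {x y} => s.symm' (x := x) (y := y)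
  have ht := fun {x y z} => s.trans' (x := x) (y := y) (z := z)
  have hm : ∀ x y, mergeSetoid s a b x y ↔ s x y ∨ (s x a ∧ s b y) ∨ (s x b ∧ s a y) :=
    fun _ _ => Iff.rfl
  split_ifs with h
  · have hsab : s a b := h ▸ (hs a ha).1
    have hm' : ∀ x y, mergeSetoid s a b x y ↔ s x y := fun x y => by
      rw [hm]
      constructor
      · rintro (h | ⟨h1, h2⟩ | ⟨h1, h2⟩)
        · exact h
        · exact ht h1 (ht hsab h2)
        · exact ht h1 (ht (hs1 hsab) h2)
      · exact Or.inl
    have : deadClasses (mergeSetoid s a b) ((A.erase a).erase b) =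
        insert {y | s a y} (deadClasses s A) := by
      ext c
      simp only [deadClasses, Set.mem_ofPred_eq, hm', Set.mem_insert_iff, Finset.mem_erase]
      constructor
      · rintro ⟨x, rfl, hx⟩
        by_cases hxa : s x a
        · exact Or.inl (Set.ext fun y => ⟨fun h => ht (hs1 hxa) h, fun h => ht hxa h⟩)
        · refine Or.inr ⟨x, rfl, fun z hz hxz => hx z ⟨?_, ?_, hz⟩ hxz⟩
          · rintro rfl
            exact hxa (ht hxz (hs1 hsab))
          · rintro rfl
            exact hxa hxz
      · rintro (rfl | ⟨x, rfl, hx⟩)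
        · refine ⟨a, rfl, fun z hz haz => ?_⟩
          rcases (hs a ha).2 z hz.2.2 haz with h' | h'
          · exact hz.2.1 h'
          · exact hz.1 (h'.trans h)
        · exact ⟨x, rfl, fun z hz => hx z hz.2.2⟩
    rw [this, Set.ncard_insert_of_notMem _ (Set.toFinite _)]
    rintro ⟨x, hx, hx'⟩
    have : a ∈ {y | s x y} := hx ▸ s.refl' a
    exact hx' a ha this
  · rw [add_zero]
    congr 1
    have hfa : f a ∈ (A.erase a).erase b := by
      simp [h, hf.ne a ha, hf.mem a ha]
    have hfb : f b ∈ (A.erase a).erase b := by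
      have : f b ≠ a := fun h' => h (by rw [← h', hf.invol b hb])
      simp [this, hf.ne b hb, hf.mem b hb]
    ext c
    simp only [deadClasses, Set.mem_ofPred_eq]
    constructor
    · rintro ⟨x, rfl, hx⟩
      have hxa : ¬ s x a := fun hxa => hx _ hfa (Or.inl (ht hxa (hs a ha).1))
      have hxb : ¬ s x b := fun hxb => hx _ hfb (Or.inl (ht hxb (hs b hb).1))
      refine ⟨x, Set.ext fun y => ?_, fun z hz hxz => hx z ?_ (Or.inl hxz)⟩
      · simp only [Set.mem_ofPred_eq, hm]
        tauto
      · simp only [Finset.mem_erase]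
        exact ⟨fun h => hxb (h ▸ hxz), fun h => hxa (h ▸ hxz), hz⟩
    · rintro ⟨x, rfl, hx⟩
      have hxa := hx a ha
      have hxb := hx b hb
      refine ⟨x, Set.ext fun y => ?_, fun z hz hxz => ?_⟩
      · simp only [Set.mem_ofPred_eq, hm]
        tauto
      · rw [hm] at hxz
        simp only [Finset.mem_erase] at hz
        have := hx z hz.2.2
        tauto

/-- Local invariance of the state sum. A closed loop contributes q from `t = true` and q⁻¹ from `t =
false`. Otherwise a zigzag is straightened: for fixed outer states at most one `t` contributes, and
the glue weight q⁻¹ compensates for a superfluous factor q. -/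
theorem sum_arcProd_contract {S : Type*} [CommRing S] (q : Sˣ) (hord : Function.Injective ord)
    (hf : IsPlanarMatching ord A f) (ha : a ∈ A) (hb : b ∈ A) (hab : ord a < ord b)
    (hadj : ∀ z ∈ A, ¬ (ord a < ord z ∧ ord z < ord b)) (σ : V → Bool) (τ : Bool → V → Bool)
    (hτa : ∀ t, τ t a = !t) (hτb : ∀ t, τ t b = t)
    (hτ : ∀ t, ∀ x ∈ (A.erase a).erase b, τ t x = σ x) :
    ∑ t : Bool, glueWeight q t * arcProd q ord A f (τ t) =
      (q + ((q⁻¹ : Sˣ) : S)) ^ (if f a = b then 1 else 0) *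
        arcProd q ord ((A.erase a).erase b) (contract f a b) σ := by
  have o : ∀ u v, u ≠ v → ord u ≠ ord v := fun u v h h' => h (hord h')
  have hne : a ≠ b := fun h => by simp [h] at hab
  have hbA : b ∈ A.erase a := by simp [hb, hne.symm]
  have hfi : ∀ x ∈ A, ∀ y ∈ A, f x = f y → x = y := fun x hx y hy h => by
    rw [← hf.invol x hx, h, hf.invol y hy]
  simp only [arcProd, ← Finset.mul_prod_erase A _ ha, ← Finset.mul_prod_erase (A.erase a) _ hbA]
  have hia := hf.invol a ha
  have hib := hf.invol b hb
  have hna := o _ _ (hf.ne a ha)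
  have hnb := o _ _ (hf.ne b hb)
  by_cases h : f a = b
  · have h' : f b = a := by rw [← h, hia]
    have hc : ∀ t, ∏ x ∈ (A.erase a).erase b,
        (if ord x < ord (f x) then arcWeight q (τ t x) (τ t (f x)) else 1) =
        ∏ x ∈ (A.erase a).erase b, (if ord x < ord (contract f a b x) then
          arcWeight q (σ x) (σ (contract f a b x)) else 1) := fun t => by
      refine Finset.prod_congr rfl fun x hx => ?_
      have hx' := hx
      simp only [Finset.mem_erase] at hx'
      have h1 : contract f a b x = f x := by
        simp [contract, h, h', hx'.1, hx'.2.1]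
      have h2 : f x ∈ (A.erase a).erase b := by
        simp only [Finset.mem_erase]
        refine ⟨fun e => hx'.2.1 (hfi x hx'.2.2 a ha (e.trans h.symm)),
          fun e => hx'.1 (hfi x hx'.2.2 b hb (e.trans h'.symm)), hf.mem x hx'.2.2⟩
      rw [h1, hτ t x hx, hτ t _ h2]
    simp only [hc]
    simp only [h, h', hab, not_lt_of_gt hab, if_true, if_false, hτa, hτb, Fintype.sum_bool,
      glueWeight, arcWeight]
    simp
    ring
  · have h' : f b ≠ a := fun e => h (by rw [← e, hib])
    have hfab : f b ≠ f a := fun e => hne (hfi _ ha _ hb e.symm)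
    have hfa : f a ∈ (A.erase a).erase b := by
      simp [h, hf.ne a ha, hf.mem a ha]
    have hfb : f b ∈ ((A.erase a).erase b).erase (f a) := by
      simp [h', hf.ne b hb, hf.mem b hb, hfab]
    have hfb' := Finset.mem_of_mem_erase hfb
    simp only [← Finset.mul_prod_erase _ _ hfa, ← Finset.mul_prod_erase _ _ hfb]
    have hc : ∀ t, ∏ x ∈ (((A.erase a).erase b).erase (f a)).erase (f b),
        (if ord x < ord (f x) then arcWeight q (τ t x) (τ t (f x)) else 1) =
        ∏ x ∈ (((A.erase a).erase b).erase (f a)).erase (f b),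
          (if ord x < ord (contract f a b x) then
          arcWeight q (σ x) (σ (contract f a b x)) else 1) := fun t => by
      refine Finset.prod_congr rfl fun x hx => ?_
      have hx' := hx
      simp only [Finset.mem_erase] at hx'
      obtain ⟨x1, x2, x3, x4, x5⟩ := hx'
      have h1 : contract f a b x = f x := by
        simp [contract, x1, x2]
      have h2 : f x ∈ (A.erase a).erase b := by
        simp only [Finset.mem_erase]
        refine ⟨fun e => x1 (by rw [← e, hf.invol x x5]), fun e => x2 (by rw [← e, hf.invol x x5]),
          hf.mem x x5⟩
      rw [h1, hτ t x (Finset.mem_of_mem_erase (Finset.mem_of_mem_erase hx)), hτ t _ h2]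
    obtain ⟨Z, hZ⟩ : ∃ Z : S, ∏ x ∈ (((A.erase a).erase b).erase (f a)).erase (f b),
          (if ord x < ord (contract f a b x) then
          arcWeight q (σ x) (σ (contract f a b x)) else 1) = Z := ⟨_, rfl⟩
    simp only [hc, hZ]
    have e1 : contract f a b (f a) = f b := by simp [contract]
    have e2 : contract f a b (f b) = f a := by simp [contract, hfab]
    simp only [e1, e2, hia, hib, hτa, hτb, hτ _ _ hfa, hτ _ _ hfb', if_neg h, pow_zero, one_mul,
      Fintype.sum_bool]
    have k1 := hadj _ (hf.mem a ha)
    have k2 := hadj _ (hf.mem b hb)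
    have k3 := o _ _ h
    have k4 := o _ _ h'
    have k5 := o _ _ hfab
    have nc := hf.symm_noncrossing hord ha hb hne.symm (Ne.symm h)
    -- Adjacency of `a`, `b` and noncrossing leave three positions for the partners: one on each
    -- side, both to the left, or both to the right.
    have cases : (ord (f a) < ord a ∧ ord b < ord (f b) ∧ ord (f a) < ord (f b)) ∨
      (ord (f b) < ord (f a) ∧ ord (f a) < ord a ∧ ord (f b) < ord b) ∨
      (ord b < ord (f b) ∧ ord a < ord (f a) ∧ ord (f b) < ord (f a)) := by omega
    rcases cases with ⟨c1, c2, c3⟩ | ⟨c1, c2, c3⟩ | ⟨c1, c2, c3⟩ <;>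
    simp only [c1, c2, c3, not_lt_of_gt c1, not_lt_of_gt c2, not_lt_of_gt c3, if_true, if_false] <;>
    cases σ (f a) <;> cases σ (f b) <;>
    simp [glueWeight, arcWeight]

end Contraction

section Contraction

/-- Nested pairs are glued one at a time, the innermost pair (index 0) first, so that the two points
are adjacent when their turn comes. `L` counts the loops that close up, and `s'` is the least
relation above `s` that identifies the pairs. -/
theorem exists_contract_all {V : Type*} [DecidableEq V] [Finite V] {ord : V → ℕ}
    (hord : Function.Injective ord) {S : Type*} [CommRing S] (q : Sˣ) :
    ∀ (m : ℕ) (a b : Fin m → V) (A : Finset V) (f : V → V) (s : Setoid V),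
      IsPlanarMatching ord A f → Links s A f → (∀ j, a j ∈ A) → (∀ j, b j ∈ A) →
      Function.Injective a → Function.Injective b → (∀ i j, a i ≠ b j) →
      (∀ j, ord (a j) < ord (b j)) →
      (∀ j, ∀ z ∈ A, ord (a j) < ord z → ord z < ord (b j) → ∃ i < j, z = a i ∨ z = b i) →
      ∃ (f' : V → V) (s' : Setoid V) (L : ℕ),
        IsPlanarMatching ord {x ∈ A | ∀ j, x ≠ a j ∧ x ≠ b j} f' ∧
        Links s' {x ∈ A | ∀ j, x ≠ a j ∧ x ≠ b j} f' ∧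
        s ≤ s' ∧ (∀ j, s' (a j) (b j)) ∧
        (∀ s'' : Setoid V, s ≤ s'' → (∀ j, s'' (a j) (b j)) → s' ≤ s'') ∧
        (deadClasses s' {x ∈ A | ∀ j, x ≠ a j ∧ x ≠ b j}).ncard = (deadClasses s A).ncard + L ∧
        ∀ (σ : V → Bool) (τ : (Fin m → Bool) → V → Bool), (∀ t j, τ t (a j) = !t j) →
          (∀ t j, τ t (b j) = t j) →
          (∀ t, ∀ x ∈ A, (∀ j, x ≠ a j ∧ x ≠ b j) → τ t x = σ x) →
          ∑ t, (∏ j, glueWeight q (t j)) * arcProd q ord A f (τ t) =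
            (q + ((q⁻¹ : Sˣ) : S)) ^ L *
              arcProd q ord {x ∈ A | ∀ j, x ≠ a j ∧ x ≠ b j} f' σ := by
  intro m
  induction m with
  | zero =>
    intro a b A f s hf hs _ _ _ _ _ _ _
    have hA : {x ∈ A | ∀ j : Fin 0, x ≠ a j ∧ x ≠ b j} = A := by simp
    rw [hA]
    refine ⟨f, s, 0, hf, hs, le_rfl, fun j => j.elim0, fun s'' h _ => h, rfl, ?_⟩
    intro σ τ _ _ h
    simp only [Fintype.sum_unique, Finset.univ_eq_empty, Finset.prod_empty, one_mul, pow_zero]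
    unfold arcProd
    refine Finset.prod_congr rfl fun x hx => ?_
    rw [h _ x hx (fun j => j.elim0), h _ (f x) (hf.mem x hx) (fun j => j.elim0)]
  | succ m ih =>
    intro a b A f s hf hs ha hb hia hib hab hlt hadj
    have hne := hab 0 0
    have hadj0 : ∀ z ∈ A, ¬ (ord (a 0) < ord z ∧ ord z < ord (b 0)) := fun z hz h => by
      obtain ⟨i, hi, -⟩ := hadj 0 z hz h.1 h.2
      exact absurd hi (by simp)
    have hA : {x ∈ (A.erase (a 0)).erase (b 0) | ∀ j : Fin m, x ≠ a j.succ ∧ x ≠ b j.succ} =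
        {x ∈ A | ∀ j : Fin (m + 1), x ≠ a j ∧ x ≠ b j} := by
      ext x
      simp only [Finset.mem_filter, Finset.mem_erase, Fin.forall_fin_succ]
      tauto
    obtain ⟨f', s', L, h1, h2, h3, h4, h5, h6, h7⟩ := ih (fun j => a j.succ) (fun j => b j.succ)
      ((A.erase (a 0)).erase (b 0)) (contract f (a 0) (b 0)) (mergeSetoid s (a 0) (b 0))
      (isPlanarMatching_contract hord hf (ha 0) (hb 0) (hlt 0) hadj0)
      (links_contract hf hs (ha 0) (hb 0))
      (fun j => by simp [ha, hab, hia.eq_iff]) (fun j => by simp [hb, (hab _ _).symm, hib.eq_iff])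
      (hia.comp (Fin.succ_injective m)) (hib.comp (Fin.succ_injective m))
      (fun i j => hab _ _) (fun j => hlt _)
      (fun j z hz h1 h2 => by
        simp only [Finset.mem_erase] at hz
        obtain ⟨i, hi, hi'⟩ := hadj j.succ z hz.2.2 h1 h2
        induction i using Fin.cases with
        | zero => tauto
        | succ i => exact ⟨i, Fin.succ_lt_succ_iff.1 hi, hi'⟩)
    rw [hA] at h1 h2 h6 h7
    refine ⟨f', s', L + if f (a 0) = b 0 then 1 else 0, h1, h2, ?_, ?_, ?_, ?_, ?_⟩
    · exact fun x y h => h3 (Or.inl h)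
    · intro j
      induction j using Fin.cases with
      | zero => exact h3 (Or.inr (Or.inl ⟨s.refl' _, s.refl' _⟩))
      | succ j => exact h4 j
    · intro s'' hs'' hj
      refine h5 s'' ?_ fun j => hj j.succ
      rintro x y (h | ⟨h, h'⟩ | ⟨h, h'⟩)
      · exact hs'' h
      · exact s''.trans' (hs'' h) (s''.trans' (hj 0) (hs'' h'))
      · exact s''.trans' (hs'' h) (s''.trans' (s''.symm' (hj 0)) (hs'' h'))
    · rw [h6, ncard_deadClasses_contract hf hs (ha 0) (hb 0) hne]
      ring
    · intro σ τ hτa hτb hτ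
      rw [← (Fin.consEquiv fun _ : Fin (m + 1) => Bool).sum_comp, Fintype.sum_prod_type,
        Finset.sum_comm]
      simp only [Fin.consEquiv, Equiv.coe_fn_mk, Fin.prod_univ_succ, Fin.cons_zero, Fin.cons_succ]
      -- The entry `true` is arbitrary: `a 0` and `b 0` have been erased, so their states no longer
      -- enter on the right.
      have hstep : ∀ t : Fin m → Bool, ∑ t0 : Bool, glueWeight q t0 *
          arcProd q ord A f (τ (Fin.cons t0 t)) = (q + ((q⁻¹ : Sˣ) : S)) ^
            (if f (a 0) = b 0 then 1 else 0) * arcProd q ord ((A.erase (a 0)).erase (b 0))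
              (contract f (a 0) (b 0)) (τ (Fin.cons true t)) := fun t => by
        refine sum_arcProd_contract q hord hf (ha 0) (hb 0) (hlt 0) hadj0 _
          (fun t0 => τ (Fin.cons t0 t)) (fun t0 => by simp [hτa]) (fun t0 => by simp [hτb]) ?_
        intro t0 x hx
        simp only [Finset.mem_erase] at hx
        by_cases hx1 : ∃ j : Fin m, x = a j.succ
        · obtain ⟨j, rfl⟩ := hx1
          simp [hτa]
        by_cases hx2 : ∃ j : Fin m, x = b j.succ
        · obtain ⟨j, rfl⟩ := hx2
          simp [hτb]
        push Not at hx1 hx2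
        have : ∀ j : Fin (m + 1), x ≠ a j ∧ x ≠ b j :=
          Fin.cases ⟨hx.2.1, hx.1⟩ fun j => ⟨hx1 j, hx2 j⟩
        rw [hτ _ x hx.2.2 this, hτ _ x hx.2.2 this]
      have := h7 σ (fun t => τ (Fin.cons true t)) (fun t j => by simp [hτa])
        (fun t j => by simp [hτb]) (fun t x hx hj => by
          simp only [Finset.mem_erase] at hx
          exact hτ _ x hx.2.2 (Fin.cases ⟨hx.2.1, hx.1⟩ hj))
      rw [pow_add, mul_assoc, mul_left_comm, ← this, Finset.mul_sum]
      refine Finset.sum_congr rfl fun t _ => ?_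
      rw [mul_left_comm, ← hstep, Finset.mul_sum]
      refine Finset.sum_congr rfl fun t0 _ => ?_
      ring

end Contraction

/-! ### Composition of diagrams and its state sum -/

section StateSum
variable {S : Type*} [CommRing S] (q : Sˣ)

theorem pos_injective {n m : ℕ} : Function.Injective (pos : Fin n ⊕ Fin m → ℕ) := by
  rintro (u | u) (v | v) <;> simp [pos, Fin.ext_iff] <;> omega

theorem pos_lt {n m : ℕ} (x : Fin n ⊕ Fin m) : pos x < n + m := by
  rcases x with x | x <;> simp [pos] <;> omega

/-- The weight of a diagram in a state of its boundary points. -/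
def stateWeight {n m : ℕ} (D : Diagram n m) (σ : Fin n ⊕ Fin m → Bool) : S :=
  ∏ x, if pos x < pos (D.partner x) then arcWeight q (σ x) (σ (D.partner x)) else 1

namespace Diagram

/-- The boundary points of two diagrams to be glued. -/
abbrev Unglued (n m k : ℕ) := (Fin n ⊕ Fin m) ⊕ (Fin m ⊕ Fin k)

/-- The gluing points and the outer points of a glued picture, the former still separated. -/
def unglue {n m k : ℕ} : (Fin n ⊕ Fin m) ⊕ (Fin m ⊕ Fin k) → Fin n ⊕ Fin m ⊕ Fin k :=
  Sum.elim (Sum.map id Sum.inl) Sum.inr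

/-- Position of a boundary point in the juxtaposition of two diagrams to be glued. -/
def gluePos {n m k : ℕ} : (Fin n ⊕ Fin m) ⊕ (Fin m ⊕ Fin k) → ℕ :=
  Sum.elim pos fun y => n + m + pos y

theorem gluePos_injective {n m k : ℕ} :
    Function.Injective (gluePos : (Fin n ⊕ Fin m) ⊕ (Fin m ⊕ Fin k) → ℕ) := by
  rintro (x | x) (y | y) h <;> simp only [gluePos, Sum.elim_inl, Sum.elim_inr] at h
  · rw [pos_injective h]
  · have := pos_lt x
    omega
  · have := pos_lt y
    omega
  · rw [pos_injective (Nat.add_left_cancel h)]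

/-- The outer boundary points, as points of the juxtaposition. -/
def outer' {n k : ℕ} (m : ℕ) : Fin n ⊕ Fin k → (Fin n ⊕ Fin m) ⊕ (Fin m ⊕ Fin k) :=
  Sum.map Sum.inl Sum.inr

theorem unglue_outer' {n m k : ℕ} (x : Fin n ⊕ Fin k) : unglue (outer' m x) = outer m x := by
  rcases x with x | x <;> rfl

theorem gluePos_outer'_lt {n m k : ℕ} (x y : Fin n ⊕ Fin k) :
    gluePos (outer' m x) < gluePos (outer' m y) ↔ pos x < pos y := by
  rcases x with x | x <;> rcases y with y | y <;> simp [gluePos, outer', pos] <;> omega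

/-- Two diagrams have a composite, and the state sum of the glued picture is that of the composite,
up to the contribution of the closed loops. -/
theorem exists_composite {n m k : ℕ} (D : Diagram n m) (E : Diagram m k) :
    ∃ F : Diagram n k,
      (∀ x y, glueSetoid D E (outer m x) (outer m y) ↔ y = x ∨ y = F.partner x) ∧
      ∀ σ : Fin n → Bool, ∀ τ : Fin k → Bool,
        ∑ t : Fin m → Bool, (∏ j, glueWeight q (t j)) *
          (stateWeight q D (Sum.elim σ fun j => !t j) * stateWeight q E (Sum.elim t τ)) =
        (q + ((q⁻¹ : Sˣ) : S)) ^ loops D E * stateWeight q F (Sum.elim σ τ) := by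
  classical
  let f : Unglued n m k → Unglued n m k := Sum.map D.partner E.partner
  have hff : ∀ x, f (f x) = x := by
    rintro (x | x) <;> simp [f, D.partner_partner, E.partner_partner]
  have hf : IsPlanarMatching gluePos (Finset.univ : Finset (Unglued n m k)) f := by
    refine ⟨fun _ _ => Finset.mem_univ _, fun x _ => hff x, ?_, ?_⟩
    · rintro (x | x) _ <;> simp [f, D.partner_ne, E.partner_ne]
    · rintro (x | x) _ (y | y) _ <;> simp only [gluePos, f, Sum.elim_inl, Sum.elim_inr, Sum.map_inl,
        Sum.map_inr]
      · exact D.noncrossing x y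
      · have := pos_lt (D.partner x)
        omega
      · have := pos_lt y
        omega
      · have := E.noncrossing x y
        omega
  let s : Setoid (Unglued n m k) :=
    { r := fun x y => y = x ∨ y = f x
      iseqv := ⟨fun x => Or.inl rfl, fun {x y} h => by
        rcases h with rfl | rfl
        · exact Or.inl rfl
        · exact Or.inr (hff x).symm, fun {x y z} h h' => by
        rcases h with rfl | rfl
        · exact h'
        · rcases h' with rfl | rfl
          · exact Or.inr rfl
          · exact Or.inl (hff x)⟩ }
  have hs : Links s Finset.univ f := fun x _ => ⟨Or.inr rfl, fun y _ h => h⟩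
  -- Right point `j` of `D` sits at n + m - 1 - j and left point `j` of `E` at n + m + j: the pairs
  -- are nested around the seam, with `j = 0` innermost.
  obtain ⟨f', s', L, h1, h2, h3, h4, h5, h6, h7⟩ :=
    exists_contract_all gluePos_injective q m (fun j => (Sum.inl (Sum.inr j) : Unglued n m k))
      (fun j => Sum.inr (Sum.inl j)) Finset.univ f s hf hs (fun _ => Finset.mem_univ _)
      (fun _ => Finset.mem_univ _) (fun i j h => by simpa using h) (fun i j h => by simpa using h)
      (fun i j h => by simp at h)
      (fun j => by simp [gluePos, pos]; omega)
      (by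
        rintro j ((z | z) | (z | z)) - h h' <;> simp [gluePos, pos] at h h' ⊢ <;> omega)
  have hA : ∀ x : Unglued n m k, x ∈ ({x ∈ Finset.univ | ∀ j : Fin m, x ≠ (Sum.inl (Sum.inr j) : Unglued n m k) ∧
      x ≠ Sum.inr (Sum.inl j)} : Finset (Unglued n m k)) ↔ ∃ y, x = outer' m y := by
    rintro ((x | x) | (x | x)) <;> simp [outer']
  have hA' : ({x ∈ Finset.univ | ∀ j : Fin m, x ≠ (Sum.inl (Sum.inr j) : Unglued n m k) ∧
      x ≠ Sum.inr (Sum.inl j)} : Finset (Unglued n m k)) = Finset.univ.image (outer' m) := by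
    ext x
    rw [hA]
    simp [eq_comm]
  have hinj : Function.Injective (outer' m : Fin n ⊕ Fin k → Unglued n m k) :=
    Sum.map_injective.2 ⟨Sum.inl_injective, Sum.inr_injective⟩
  -- `s'` is the pullback of the gluing relation along `unglue`. One inclusion is the minimality of
  -- `s'`; for the other, `s'` contains the generating links and identifies points with the same
  -- image.
  have hsg : ∀ x y, s' x y ↔ glueSetoid D E (unglue x) (unglue y) := by
    intro x y
    constructor
    · have : s' ≤ (glueSetoid D E).comap unglue := by
        refine h5 _ ?_ fun j => (glueSetoid D E).refl' _
        rintro x y (rfl | rfl)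
        · exact (glueSetoid D E).refl' _
        · refine Relation.EqvGen.rel _ _ ?_
          rcases x with x | x
          · exact Or.inl ⟨x, rfl, rfl⟩
          · exact Or.inr ⟨x, rfl, rfl⟩
      exact fun h => this h
    · have hlift : ∀ x y : Unglued n m k, unglue x = unglue y → s' x y := by
        rintro ((x | x) | (x | x)) ((y | y) | (y | y)) h <;>
          simp [unglue] at h <;> subst h
        · exact s'.refl' _
        · exact s'.refl' _
        · exact h4 _
        · exact s'.symm' (h4 _)
        · exact s'.refl' _
        · exact s'.refl' _
      intro h
      have : ∀ u v, Relation.EqvGen (glueRel D E) u v → ∀ x y : Unglued n m k, unglue x = u → unglue y = v →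
          s' x y := by
        intro u v huv
        induction huv with
        | rel u v h =>
          rintro x y rfl rfl
          rcases h with ⟨a, ha, hb⟩ | ⟨b, ha, hb⟩
          · exact s'.trans' (hlift x (Sum.inl a) ha) (s'.trans' (h3 (Or.inr rfl))
              (s'.symm' (hlift y (Sum.inl (D.partner a)) hb)))
          · exact s'.trans' (hlift x (Sum.inr b) ha) (s'.trans' (h3 (Or.inr rfl))
              (s'.symm' (hlift y (Sum.inr (E.partner b)) hb)))
        | refl u => exact fun x y hx hy => hlift x y (hx.trans hy.symm)
        | symm u v _ ih => exact fun x y hx hy => s'.symm' (ih y x hy hx)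
        | trans u v w _ _ ih1 ih2 =>
          intro x y hx hy
          obtain ⟨z, hz⟩ : ∃ z : Unglued n m k, unglue z = v := by
            rcases v with v | v
            · exact ⟨Sum.inl (Sum.inl v), rfl⟩
            · exact ⟨Sum.inr v, rfl⟩
          exact s'.trans' (ih1 x z hx hz) (ih2 z y hz hy)
      exact this _ _ h x y rfl rfl
  have hp : ∀ x : Fin n ⊕ Fin k, ∃ y, f' (outer' m x) = outer' m y := fun x =>
    (hA _).1 (h1.mem _ ((hA _).2 ⟨x, rfl⟩))
  choose g hg using hp
  let F : Diagram n k :=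
    { partner := g
      partner_partner := fun x => hinj (by
        rw [← hg, ← hg, h1.invol _ ((hA _).2 ⟨x, rfl⟩)])
      partner_ne := fun x h => h1.ne _ ((hA _).2 ⟨x, rfl⟩) (by rw [hg, h])
      noncrossing := fun x y hxy hyx => by
        have := h1.noncrossing _ ((hA _).2 ⟨x, rfl⟩) _ ((hA _).2 ⟨y, rfl⟩)
        rw [hg, hg] at this
        simp only [gluePos_outer'_lt] at this
        exact this hxy hyx }
  refine ⟨F, ?_, ?_⟩
  · intro x y
    rw [← unglue_outer', ← unglue_outer', ← hsg]
    constructor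
    · intro h
      rcases (h2 _ ((hA _).2 ⟨x, rfl⟩)).2 _ ((hA _).2 ⟨y, rfl⟩) h with h | h
      · exact Or.inl (hinj h)
      · exact Or.inr (hinj (h.trans (hg x)))
    · rintro (rfl | rfl)
      · exact s'.refl' _
      · have := (h2 _ ((hA _).2 ⟨x, rfl⟩)).1
        rwa [hg] at this
  -- No class is dead before gluing, because every point is in `A`. So `L` counts the dead classes
  -- after gluing, which are the components without outer points.
  · have hL : loops D E = L := by
      have h0 : (deadClasses s (Finset.univ : Finset (Unglued n m k))).ncard = 0 := by
        rw [Set.ncard_eq_zero]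
        ext c
        simp only [deadClasses, Set.mem_ofPred_eq, Set.mem_empty_iff_false, iff_false]
        rintro ⟨x, -, hx⟩
        exact hx x (Finset.mem_univ x) (s.refl' x)
      rw [h0, zero_add] at h6
      rw [← h6, loops, ← Nat.card_coe_set_eq]
      have hsurj : ∀ u : Fin n ⊕ Fin m ⊕ Fin k, ∃ x : Unglued n m k, unglue x = u := by
        rintro (u | u)
        · exact ⟨Sum.inl (Sum.inl u), rfl⟩
        · exact ⟨Sum.inr u, rfl⟩
      have hmem : ∀ c : {c : Quotient (glueSetoid D E) // ∀ x, Quotient.mk _ (outer m x) ≠ c},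
          {x : Unglued n m k | Quotient.mk (glueSetoid D E) (unglue x) = c.1} ∈
            deadClasses s' ({x ∈ Finset.univ | ∀ j : Fin m, x ≠ (Sum.inl (Sum.inr j)) ∧
              x ≠ Sum.inr (Sum.inl j)} : Finset (Unglued n m k)) := by
        rintro ⟨c, hc⟩
        induction c using Quotient.inductionOn with | _ u =>
        obtain ⟨x, rfl⟩ := hsurj u
        refine ⟨x, Set.ext fun y => ?_, fun z hz h => ?_⟩
        · simp only [Set.mem_ofPred_eq, hsg]
          refine Quotient.eq.trans ?_
          exact ⟨fun h => (glueSetoid D E).symm' h, fun h => (glueSetoid D E).symm' h⟩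
        · obtain ⟨w, rfl⟩ := (hA z).1 hz
          rw [hsg, unglue_outer'] at h
          exact hc w (Quotient.sound ((glueSetoid D E).symm' h))
      refine Nat.card_congr (Equiv.ofBijective (fun c => ⟨_, hmem c⟩) ⟨?_, ?_⟩)
      · rintro ⟨c, hc⟩ ⟨d, hd⟩ h
        rw [Subtype.mk.injEq] at h ⊢
        induction c using Quotient.inductionOn with | _ u =>
        obtain ⟨x, rfl⟩ := hsurj u
        have : x ∈ {x : Unglued n m k | Quotient.mk (glueSetoid D E) (unglue x) = d} := by
          rw [← h]
          simp
        exact this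
      · rintro ⟨c, x, rfl, hx⟩
        refine ⟨⟨Quotient.mk _ (unglue x), fun w h => ?_⟩, ?_⟩
        · refine hx (outer' m w) ((hA _).2 ⟨w, rfl⟩) ?_
          rw [hsg, unglue_outer']
          exact (glueSetoid D E).symm' (Quotient.exact h)
        · apply Subtype.ext
          ext y
          simp only [Set.mem_ofPred_eq, hsg]
          refine Quotient.eq.trans ?_
          exact ⟨fun h => (glueSetoid D E).symm' h, fun h => (glueSetoid D E).symm' h⟩
    intro σ τ
    have := h7 (Sum.elim (Sum.elim σ fun _ => true) (Sum.elim (fun _ => true) τ))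
      (fun t => Sum.elim (Sum.elim σ fun j => !t j) (Sum.elim t τ))
      (fun t j => rfl) (fun t j => rfl) (by
        rintro t ((x | x) | (x | x)) - h
        · rfl
        · exact absurd rfl (h x).1
        · exact absurd rfl (h x).2
        · rfl)
    rw [hA', arcProd, Finset.prod_image hinj.injOn] at this
    rw [hL]
    convert this using 2
    · congr 1
      rw [arcProd, Fintype.prod_sum_type, stateWeight, stateWeight]
      congr 1
      simp [f, gluePos]
    · refine Finset.prod_congr rfl fun x _ => ?_
      simp only [hg, gluePos_outer'_lt]
      have hst : ∀ y : Fin n ⊕ Fin k, Sum.elim (Sum.elim σ fun _ : Fin m => true)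
        (Sum.elim (fun _ : Fin m => true) τ) (outer' m y) = Sum.elim σ τ y := by
        rintro (y | y) <;> rfl
      simp only [hst, F]

end Diagram
end StateSum

/-! ### First ends of links -/

namespace Diagram

/-- `x` is the first end of its link. -/
def IsOpener {n m : ℕ} (D : Diagram n m) (x : Fin n ⊕ Fin m) : Prop :=
  pos x < pos (D.partner x)

instance {n m : ℕ} (D : Diagram n m) (x : Fin n ⊕ Fin m) : Decidable (D.IsOpener x) :=
  inferInstanceAs (Decidable (_ < _))

theorem isOpener_partner {n m : ℕ} (D : Diagram n m) (x : Fin n ⊕ Fin m) :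
    D.IsOpener (D.partner x) ↔ ¬ D.IsOpener x := by
  have : pos (D.partner x) ≠ pos x := fun h => D.partner_ne x (pos_injective h)
  simp only [IsOpener, D.partner_partner]
  omega

theorem partner_injective {n m : ℕ} (D : Diagram n m) : Function.Injective D.partner :=
  fun x y h => by rw [← D.partner_partner x, h, D.partner_partner]

/-- A noncrossing matching is determined by the first ends of its links. -/
theorem eq_of_isOpener_iff {n m : ℕ} {D E : Diagram n m}
    (h : ∀ x, D.IsOpener x ↔ E.IsOpener x) : D = E := by
  -- Suppose that `D` and `E` agree on all openers after `x`, but `D.partner x` comes before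
  -- `E.partner x`. In `E` the point `D.partner x` is then closed by an opener strictly after `x`;
  -- by agreement `D` links it to that opener too, and not to `x`.
  have key : ∀ (D E : Diagram n m), (∀ x, D.IsOpener x ↔ E.IsOpener x) → ∀ x, D.IsOpener x →
      (∀ z, pos x < pos z → D.IsOpener z → D.partner z = E.partner z) →
      pos (D.partner x) < pos (E.partner x) → False := by
    intro D E h x hx hz hlt
    have ho : ¬ E.IsOpener (D.partner x) := by
      rw [← h, isOpener_partner]
      exact not_not.2 hx
    have hEz : E.IsOpener (E.partner (D.partner x)) := by
      rwa [isOpener_partner]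
    have h1 := E.noncrossing x (D.partner x) hx hlt
    have h2 : pos x < pos (E.partner (D.partner x)) := by
      by_contra hc
      have h3 : pos (E.partner (D.partner x)) ≠ pos x := fun h3 => by
        have e : E.partner x = D.partner x := by
          rw [← E.partner_partner (D.partner x), pos_injective h3]
        rw [e] at hlt
        exact lt_irrefl _ hlt
      have h4 := E.noncrossing (E.partner (D.partner x)) x (by omega)
      rw [E.partner_partner] at h4
      have := h4 hx
      omega
    have h5 := hz _ h2 ((h _).2 hEz)
    rw [E.partner_partner] at h5
    have h6 := D.partner_injective h5
    rw [h6] at h2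
    exact lt_irrefl _ h2
  have main : ∀ N x, n + m - pos x ≤ N → D.IsOpener x → D.partner x = E.partner x := by
    intro N
    induction N with
    | zero => intro x hx; have := pos_lt x; omega
    | succ N ih =>
      intro x hx ho
      have hz : ∀ z, pos x < pos z → D.IsOpener z → D.partner z = E.partner z :=
        fun z hz => ih z (by omega)
      rcases lt_trichotomy (pos (D.partner x)) (pos (E.partner x)) with h1 | h1 | h1
      · exact (key D E h x ho hz h1).elim
      · exact pos_injective h1
      · exact (key E D (fun x => (h x).symm) x ((h x).1 ho)
          (fun z h1 h2 => (hz z h1 ((h z).2 h2)).symm) h1).elim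
  ext1
  funext x
  by_cases hx : D.IsOpener x
  · exact main _ x le_rfl hx
  · have := main _ (D.partner x) le_rfl ((D.isOpener_partner x).2 hx)
    rw [D.partner_partner] at this
    rw [← E.partner_partner (D.partner x), ← this]

/-- The sum of the positions of the first ends of the links. -/
def openerSum {n m : ℕ} (D : Diagram n m) : ℕ := ∑ x, if D.IsOpener x then pos x else 0

/-- The state in which exactly the first ends of the links of `D` are `true`. -/
def openerState {n m : ℕ} (D : Diagram n m) (x : Fin n ⊕ Fin m) : Bool := decide (D.IsOpener x)

end Diagram

/-! ### The state representation: faithfulness and functoriality -/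

section StateSum
variable {S : Type*} [CommRing S] (q : Sˣ)

theorem stateWeight_eq_zero {n m : ℕ} {D : Diagram n m} {σ : Fin n ⊕ Fin m → Bool}
    {x : Fin n ⊕ Fin m} (h : σ (D.partner x) = σ x) : stateWeight q D σ = 0 := by
  by_cases hx : D.IsOpener x
  · refine Finset.prod_eq_zero (Finset.mem_univ x) ?_
    rw [if_pos (show pos x < _ from hx), h]
    cases σ x <;> rfl
  · refine Finset.prod_eq_zero (Finset.mem_univ (D.partner x)) ?_
    have := (D.isOpener_partner x).2 hx
    rw [if_pos (show pos (D.partner x) < _ from this), D.partner_partner, h]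
    cases σ x <;> rfl

theorem stateWeight_openerState {n m : ℕ} (D : Diagram n m) :
    stateWeight q D D.openerState = 1 := by
  refine Finset.prod_eq_one fun x _ => ?_
  split_ifs with h
  · have h1 : D.openerState x = true := decide_eq_true h
    have h2 : D.openerState (D.partner x) = false := by
      simp only [Diagram.openerState, decide_eq_false_iff_not, Diagram.isOpener_partner, not_not]
      exact h
    rw [h1, h2]
    rfl
  · rfl

/-- The hypothesis says that each link of `E` has exactly one end that is an opener of `D`. Summed
over the links of `E`, the positions of these ends are at least those of the first ends, with
equality only if the openers agree, that is, if `E = D`. Summing over all points counts every link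
twice. -/
theorem openerSum_lt {n m : ℕ} {D E : Diagram n m} (hne : E ≠ D)
    (h : ∀ x, D.openerState (E.partner x) ≠ D.openerState x) : E.openerSum < D.openerSum := by
  have h2 : ∀ g : Fin n ⊕ Fin m → ℕ, ∑ x, (g x + g (E.partner x)) = ∑ x, g x + ∑ x, g x := by
    intro g
    rw [Finset.sum_add_distrib]
    congr 1
    exact Equiv.sum_comp (Function.Involutive.toPerm E.partner E.partner_partner) g
  have hx : ∀ x, ¬ (D.IsOpener (E.partner x) ↔ D.IsOpener x) := fun x => by
    simpa [Diagram.openerState] using h x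
  have key : ∑ x, ((if E.IsOpener x then pos x else 0) +
      (if E.IsOpener (E.partner x) then pos (E.partner x) else 0)) <
      ∑ x, ((if D.IsOpener x then pos x else 0) +
      (if D.IsOpener (E.partner x) then pos (E.partner x) else 0)) := by
    refine Finset.sum_lt_sum (fun x _ => ?_) ?_
    · have h1 := hx x
      have h3 := E.isOpener_partner x
      by_cases a : E.IsOpener x
      · rw [if_pos a, if_neg (h3.not.2 (not_not.2 a))]
        have a2 : pos x < pos (E.partner x) := a
        split_ifs <;> first | tauto | omega
      · rw [if_pos (h3.2 a), if_neg a]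
        have a2 : ¬ pos x < pos (E.partner x) := a
        split_ifs <;> first | tauto | omega
    · by_contra hc
      push Not at hc
      apply hne
      refine Diagram.eq_of_isOpener_iff fun x => ?_
      have h0 := hc x (Finset.mem_univ x)
      have h1 := hx x
      have h3 := E.isOpener_partner x
      have h5 : pos (E.partner x) ≠ pos x := fun h => E.partner_ne x (pos_injective h)
      by_cases a : E.IsOpener x
      · have a' := h3.not.2 (not_not.2 a)
        rw [if_pos a, if_neg a'] at h0
        have a2 : pos x < pos (E.partner x) := a
        split_ifs at h0 <;> first | tauto | omega
      · have a' := h3.2 a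
        rw [if_pos a', if_neg a] at h0
        have a2 : ¬ pos x < pos (E.partner x) := a
        split_ifs at h0 <;> first | tauto | omega
  rw [h2 fun x => if E.IsOpener x then pos x else 0,
    h2 fun x => if D.IsOpener x then pos x else 0] at key
  unfold Diagram.openerSum
  omega

/-- The action of a morphism on states. -/
noncomputable def rep {n m : ℕ} (f : Mor S n m) : Matrix (Fin n → Bool) (Fin m → Bool) S :=
  fun s t => (∏ j, glueWeight q (t j)) * ∑ D, f D * stateWeight q D (Sum.elim s fun j => !t j)

/-- The coefficients of a morphism lie in any group which is stable under multiplication by `q` and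
`q⁻¹` and contains all entries of its action on states. -/
theorem mem_of_rep_mem (A : AddSubgroup S) (hq : ∀ x ∈ A, x * q ∈ A)
    {n m : ℕ} (f : Mor S n m) (h : ∀ s t, rep q f s t ∈ A) (D : Diagram n m) : f D ∈ A := by
  let M : Submonoid S :=
    { carrier := {c | ∀ x ∈ A, x * c ∈ A}
      one_mem' := fun x hx => by simpa using hx
      mul_mem' := fun {a b} ha hb x hx => by
        rw [← mul_assoc]
        exact hb _ (ha _ hx) }
  have hw : ∀ (D : Diagram n m) σ, stateWeight q D σ ∈ M := fun D σ => by
    refine Submonoid.prod_mem _ fun x _ => ?_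
    split_ifs
    · cases σ x <;> cases σ (D.partner x) <;> intro y hy <;> simp [arcWeight, hy, hq, A.zero_mem]
    · exact M.one_mem
  -- A factor `q` for each right point in state `true` cancels the glue weights, so the bare state
  -- sums also lie in `A`.
  have hsum : ∀ σ, ∑ D, f D * stateWeight q D σ ∈ A := fun σ => by
    have h1 := h (fun i => σ (Sum.inl i)) (fun j => !σ (Sum.inr j))
    have h2 : (Sum.elim (fun i => σ (Sum.inl i)) fun j => !!σ (Sum.inr j)) = σ := by
      ext x
      rcases x with x | x <;> simp
    rw [rep, h2] at h1
    have h3 : ∏ j, (if σ (Sum.inr j) then (q : S) else 1) ∈ M :=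
      Submonoid.prod_mem _ fun j _ => by
        split_ifs
        · exact hq
        · exact M.one_mem
    have h4 := h3 _ h1
    rw [mul_right_comm, ← Finset.prod_mul_distrib, Finset.prod_eq_one, one_mul] at h4
    · exact h4
    · intro j _
      cases σ (Sum.inr j) <;> simp [glueWeight]
  -- Triangularity: in the opener state of `D`, the diagram `D` has weight 1, and any other diagram
  -- of nonzero weight has smaller opener sum.
  have main : ∀ N (D : Diagram n m), D.openerSum = N → f D ∈ A := by
    intro N
    induction N using Nat.strong_induction_on with
    | _ N ih =>
      rintro D rfl
      have h1 := hsum D.openerState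
      classical
      rw [← Finset.add_sum_erase _ _ (Finset.mem_univ D), stateWeight_openerState, mul_one] at h1
      refine (AddSubgroup.add_mem_cancel_right A (A.sum_mem fun E hE => ?_)).1 h1
      by_cases hE' : ∃ x, D.openerState (E.partner x) = D.openerState x
      · obtain ⟨x, hx⟩ := hE'
        rw [stateWeight_eq_zero q hx, mul_zero]
        exact A.zero_mem
      · push Not at hE'
        exact hw _ _ _ (ih _ (openerSum_lt (Finset.ne_of_mem_erase hE) hE') E rfl)
  exact main _ D rfl

theorem rep_sub {n m : ℕ} (f g : Mor S n m) : rep q (f - g) = rep q f - rep q g := by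
  ext s t
  simp [rep, sub_mul, mul_sub]

theorem rep_smul {n m : ℕ} (c : S) (f : Mor S n m) : rep q (c • f) = c • rep q f := by
  ext s t
  simp only [rep, Pi.smul_apply, Matrix.smul_apply, smul_eq_mul, mul_assoc, ← Finset.mul_sum]
  ring

/-- The integrality statement for the trivial group, applied to the difference. -/
theorem rep_injective {n m : ℕ} : Function.Injective (rep q : Mor S n m → _) := by
  intro f g h
  have h0 : ∀ s t, rep q (f - g) s t = 0 := fun s t => by simp [rep_sub, h]
  funext D
  have := mem_of_rep_mem q ⊥ (by simp) (f - g) (by simpa using h0) D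
  simpa [sub_eq_zero] using this

theorem isComposite_iff {n m k : ℕ} {D : Diagram n m} {E : Diagram m k} {F : Diagram n k}
    (hF : ∀ x y, Diagram.glueSetoid D E (Diagram.outer m x) (Diagram.outer m y) ↔
      y = x ∨ y = F.partner x) (G : Diagram n k) : D.IsComposite E G ↔ G = F := by
  constructor
  · intro h
    ext1
    funext x
    exact ((hF _ _).1 (h x)).resolve_left (G.partner_ne x)
  · rintro rfl x
    exact (hF _ _).2 (Or.inr rfl)

/-- The complemented right states and the glue weights in `rep` are chosen so that the sum over the
middle index is the state sum of the glued picture; each closed loop contributes q + q⁻¹. -/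
theorem rep_comp {δ : S} (hδ : δ = q + ((q⁻¹ : Sˣ) : S)) {n m k : ℕ} (f : Mor S n m)
    (g : Mor S m k) : rep q (comp δ f g) = rep q f * rep q g := by
  classical
  choose F hF hw using fun (D : Diagram n m) (E : Diagram m k) => Diagram.exists_composite q D E
  ext s u
  simp only [Matrix.mul_apply, rep, comp, isComposite_iff (hF _ _)]
  have h1 : ∑ G : Diagram n k, (∑ D : Diagram n m, ∑ E : Diagram m k,
      if G = F D E then δ ^ D.loops E * (f D * g E) else 0) *
        stateWeight q G (Sum.elim s fun j => !u j) =
      ∑ D, ∑ E, f D * g E * (δ ^ D.loops E * stateWeight q (F D E) (Sum.elim s fun j => !u j)) := by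
    simp only [Finset.sum_mul]
    rw [Finset.sum_comm]
    refine Finset.sum_congr rfl fun D _ => ?_
    rw [Finset.sum_comm]
    refine Finset.sum_congr rfl fun E _ => ?_
    simp only [ite_mul, zero_mul, Finset.sum_ite_eq', Finset.mem_univ, if_true]
    ring
  rw [h1]
  simp only [hδ, ← hw, Finset.mul_sum, Finset.sum_mul]
  rw [Finset.sum_congr rfl fun D _ => Finset.sum_comm, Finset.sum_comm]
  refine Finset.sum_congr rfl fun t _ => ?_
  rw [Finset.sum_comm]
  refine Finset.sum_congr rfl fun E _ => Finset.sum_congr rfl fun D _ => ?_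
  ring

theorem rep_single {n m : ℕ} (D : Diagram n m) (s : Fin n → Bool) (t : Fin m → Bool) :
    rep q (single D) s t =
      (∏ j, glueWeight q (t j)) * stateWeight q D (Sum.elim s fun j => !t j) := by
  simp [rep, single, Pi.single_apply]

theorem rep_single_identity (n : ℕ) : rep q (single (Diagram.identity n)) = 1 := by
  ext s t
  rw [rep_single, Matrix.one_apply]
  split_ifs with h
  · subst h
    rw [stateWeight, Fintype.prod_sum_type, ← mul_assoc, ← Finset.prod_mul_distrib]
    have h2 : ∀ i : Fin n, ¬ pos (Sum.inr i : Fin n ⊕ Fin n) <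
        pos ((Diagram.identity n).partner (Sum.inr i)) := fun i => by
      simp [pos, Diagram.identity]; omega
    have h1 : ∀ i : Fin n, pos (Sum.inl i : Fin n ⊕ Fin n) <
        pos ((Diagram.identity n).partner (Sum.inl i)) := fun i => by
      simp [pos, Diagram.identity]; omega
    simp only [h1, h2, if_true, if_false, Finset.prod_const_one, mul_one]
    refine Finset.prod_eq_one fun i _ => ?_
    simp only [Diagram.identity, Sum.swap_inl, Sum.elim_inl, Sum.elim_inr]
    cases s i <;> simp [glueWeight, arcWeight]
  · obtain ⟨i, hi⟩ := Function.ne_iff.1 h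
    rw [stateWeight_eq_zero q (x := Sum.inl i), mul_zero]
    simp only [Diagram.identity, Sum.swap_inl, Sum.elim_inl, Sum.elim_inr]
    revert hi
    cases s i <;> cases t i <;> simp

theorem rep_map {T : Type*} [CommRing T] (φ : S →+* T) {n m : ℕ} (f : Mor S n m) (s t) :
    φ (rep q f s t) = rep (Units.map φ q) (fun D => φ (f D)) s t := by
  have h1 : ∀ b, φ (glueWeight q b) = glueWeight (Units.map (φ : S →* T) q) b := by
    rintro (_ | _) <;> simp [glueWeight]
  have h2 : ∀ a b, φ (arcWeight q a b) = arcWeight (Units.map (φ : S →* T) q) a b := by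
    rintro (_ | _) (_ | _) <;> simp [arcWeight]
  simp only [rep, map_mul, map_prod, map_sum, h1, stateWeight, apply_ite φ, h2, map_one]

theorem rep_tensor {n m n' m' : ℕ} (f : Mor S n m) (g : Mor S n' m') (s : Fin (n + n') → Bool)
    (t : Fin (m + m') → Bool) :
    rep q (tensor f g) s t =
      rep q f (fun i => s (Fin.castAdd n' i)) (fun j => t (Fin.castAdd m' j)) *
        rep q g (fun i => s (Fin.natAdd n i)) (fun j => t (Fin.natAdd m j)) := by
  have hw : ∀ (D : Diagram n m) (E : Diagram n' m'),
      stateWeight q (D.tensor E) (Sum.elim s fun j => !t j) =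
      stateWeight q D (Sum.elim (fun i => s (Fin.castAdd n' i)) fun j => !t (Fin.castAdd m' j)) *
      stateWeight q E (Sum.elim (fun i => s (Fin.natAdd n i)) fun j => !t (Fin.natAdd m j)) := by
    intro D E
    have hl : ∀ x : Fin n ⊕ Fin m, Sum.elim s (fun j => !t j)
        (Diagram.tensorEquiv n m n' m' (Sum.inl x)) =
        Sum.elim (fun i => s (Fin.castAdd n' i)) (fun j => !t (Fin.castAdd m' j)) x := by
      rintro (x | x) <;> simp [Diagram.tensorEquiv]
    have hr : ∀ x : Fin n' ⊕ Fin m', Sum.elim s (fun j => !t j)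
        (Diagram.tensorEquiv n m n' m' (Sum.inr x)) =
        Sum.elim (fun i => s (Fin.natAdd n i)) (fun j => !t (Fin.natAdd m j)) x := by
      rintro (x | x) <;> simp [Diagram.tensorEquiv]
    have hpl : ∀ x y : Fin n ⊕ Fin m, pos (Diagram.tensorEquiv n m n' m' (Sum.inl x)) <
        pos (Diagram.tensorEquiv n m n' m' (Sum.inl y)) ↔ pos x < pos y := by
      rintro (x | x) (y | y) <;> simp [pos, Diagram.tensorEquiv] <;> omega
    have hpr : ∀ x y : Fin n' ⊕ Fin m', pos (Diagram.tensorEquiv n m n' m' (Sum.inr x)) <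
        pos (Diagram.tensorEquiv n m n' m' (Sum.inr y)) ↔ pos x < pos y := by
      rintro (x | x) (y | y) <;> simp [pos, Diagram.tensorEquiv] <;> omega
    rw [stateWeight, ← Equiv.prod_comp (Diagram.tensorEquiv n m n' m'), Fintype.prod_sum_type]
    simp only [Diagram.tensor, Equiv.symm_apply_apply, Sum.map_inl, Sum.map_inr, hl, hr, hpl, hpr]
    rfl
  classical
  simp only [rep, tensor, Fin.prod_univ_add]
  rw [mul_mul_mul_comm]
  congr 1
  rw [Finset.sum_mul_sum]
  simp only [Finset.sum_mul, ite_mul, zero_mul]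
  rw [Finset.sum_comm]
  refine Finset.sum_congr rfl fun D _ => ?_
  rw [Finset.sum_comm]
  refine Finset.sum_congr rfl fun E _ => ?_
  rw [Finset.sum_ite_eq, if_pos (Finset.mem_univ _), hw]
  ring

end StateSum

/-! ### Gaussian binomial coefficients -/

section Gauss
variable {S : Type*} [CommRing S]

/-- The `Q`-integer `1 + Q + ⋯ + Q ^ (k - 1)`. -/
def qint (Q : S) (k : ℕ) : S := ∑ i ∈ Finset.range k, Q ^ i

/-- Gaussian binomial coefficients. -/
def gauss (Q : S) : ℕ → ℕ → S
  | _, 0 => 1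
  | 0, _ + 1 => 0
  | n + 1, k + 1 => Q ^ (k + 1) * gauss Q n (k + 1) + gauss Q n k

variable (Q : S)

@[simp] theorem gauss_zero_right (n : ℕ) : gauss Q n 0 = 1 := by cases n <;> rfl

theorem gauss_succ_succ (n k : ℕ) :
    gauss Q (n + 1) (k + 1) = Q ^ (k + 1) * gauss Q n (k + 1) + gauss Q n k := rfl

theorem gauss_eq_zero {n k : ℕ} (h : n < k) : gauss Q n k = 0 := by
  induction n generalizing k with
  | zero => obtain ⟨k, rfl⟩ := Nat.exists_eq_succ_of_ne_zero h.ne'; rfl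
  | succ n ih =>
    obtain ⟨k, rfl⟩ := Nat.exists_eq_succ_of_ne_zero (Nat.ne_zero_of_lt h)
    rw [Nat.succ_eq_add_one, gauss_succ_succ, ih (by omega), ih (by omega), mul_zero, add_zero]

theorem gauss_self (n : ℕ) : gauss Q n n = 1 := by
  induction n with
  | zero => rfl
  | succ n ih => rw [gauss_succ_succ, ih, gauss_eq_zero Q (Nat.lt_succ_self n), mul_zero, zero_add]

@[simp] theorem qint_zero : qint Q 0 = 0 := rfl

theorem qint_add (a b : ℕ) : qint Q (a + b) = qint Q a + Q ^ a * qint Q b := by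
  simp [qint, Finset.sum_range_add, pow_add, Finset.mul_sum]

theorem qint_one : qint Q 1 = 1 := by simp [qint]

theorem qint_mul_gauss (n k : ℕ) :
    qint Q (k + 1) * gauss Q n (k + 1) = qint Q (n - k) * gauss Q n k := by
  induction n generalizing k with
  | zero => simp [gauss]
  | succ n ih =>
    rcases k with _ | k
    · have h1 := ih 0
      rw [gauss_succ_succ]
      simp only [zero_add, gauss_zero_right, mul_one, pow_one, Nat.sub_zero, qint_one, one_mul]
        at h1 ⊢
      rw [h1, Nat.add_comm, qint_add, qint_one, pow_one]
      ring
    · rw [gauss_succ_succ, gauss_succ_succ]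
      have h1 := ih (k + 1)
      have h2 := ih k
      rw [Nat.add_sub_add_right]
      -- Below the diagonal the subtraction is truncated and both sides vanish; on and above it,
      -- `Q`-integers add up to [n + 1] in two ways.
      rcases Nat.lt_or_ge n (k + 1) with hk | hk
      · rw [gauss_eq_zero Q hk, gauss_eq_zero Q (hk.trans (Nat.lt_succ_self _)),
          show n - k = 0 by omega]
        simp
      · have h3 : qint Q (k + 1 + 1) + Q ^ (k + 1 + 1) * qint Q (n - (k + 1)) = qint Q (n + 1) := by
          rw [← qint_add]; congr 1; omega
        have h4 : qint Q (k + 1) + Q ^ (k + 1) * qint Q (n - k) = qint Q (n + 1) := by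
          rw [← qint_add]; congr 1; omega
        linear_combination Q ^ (k + 1 + 1) * h1 + gauss Q n (k + 1) * h3 -
          gauss Q n (k + 1) * h4 + h2

theorem qint_mul_gauss_succ (n k : ℕ) :
    qint Q (k + 1) * gauss Q (n + 1) (k + 1) = qint Q (n + 1) * gauss Q n k := by
  rcases Nat.lt_or_ge n k with h | h
  · rw [gauss_eq_zero Q h, gauss_eq_zero Q (Nat.succ_lt_succ h), mul_zero, mul_zero]
  have h1 := qint_mul_gauss Q n k
  have h2 : qint Q (k + 1) + Q ^ (k + 1) * qint Q (n - k) = qint Q (n + 1) := by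
    rw [← qint_add]; congr 1; omega
  rw [gauss_succ_succ]
  linear_combination Q ^ (k + 1) * h1 + gauss Q n k * h2

theorem qint_sub_mul_gauss_succ (n k : ℕ) :
    qint Q (n + 1 - k) * gauss Q (n + 1) k = qint Q (n + 1) * gauss Q n k := by
  rw [← qint_mul_gauss, qint_mul_gauss_succ]

theorem isUnit_gauss (hQ : ∀ m, IsUnit (qint Q (m + 1))) {n k : ℕ} (h : k ≤ n) :
    IsUnit (gauss Q n k) := by
  induction k with
  | zero => simp
  | succ k ih =>
    have h1 := qint_mul_gauss Q n k
    have h2 : IsUnit (qint Q (n - k) * gauss Q n k) := by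
      have := hQ (n - k - 1)
      rw [Nat.sub_add_cancel (by omega)] at this
      exact this.mul (ih (by omega))
    rw [← h1] at h2
    exact isUnit_of_mul_isUnit_right h2

theorem gauss_map {T : Type*} [CommRing T] (φ : S →+* T) (n k : ℕ) :
    φ (gauss Q n k) = gauss (φ Q) n k := by
  induction n generalizing k with
  | zero => cases k <;> simp [gauss]
  | succ n ih =>
    cases k with
    | zero => simp
    | succ k => simp [gauss_succ_succ, ih]

/-- With Q = q² the two kinds of quantum integers differ by a unit; this carries the torsion
hypothesis over to Gaussian binomials. -/
theorem qint_eq_qnum (q : Sˣ) (k : ℕ) :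
    qint ((q : S) ^ 2) (k + 1) = (q : S) ^ k * qnum ((q : S) + ((q⁻¹ : Sˣ) : S)) (k + 1) := by
  induction k using Nat.twoStepInduction with
  | zero => simp [qint, qnum]
  | one =>
    simp [qint, qnum, Finset.sum_range_succ]
    rw [mul_add, Units.mul_inv]
    ring
  | more k h1 h2 =>
    rw [qnum]
    have e : (q : S) * ((q⁻¹ : Sˣ) : S) = 1 := Units.mul_inv q
    have e1 : qint ((q : S) ^ 2) (k + 2 + 1) = qint ((q : S) ^ 2) (k + 1 + 1) +
      ((q : S) ^ 2) ^ (k + 2) := by simp [qint, Finset.sum_range_succ]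
    have e2 : qint ((q : S) ^ 2) (k + 1 + 1) = qint ((q : S) ^ 2) (k + 1) +
      ((q : S) ^ 2) ^ (k + 1) := by simp [qint, Finset.sum_range_succ]
    rw [e1]
    linear_combination (- ((q : S) ^ (k + 1) * qnum ((q : S) + ((q⁻¹ : Sˣ) : S)) (k + 1 + 1))) * e +
      ((q : S) ^ 2 + 1) * h2 - (q : S) ^ 2 * h1 - (q : S) ^ 2 * e2

end Gauss

/-! ### The vectors killed by all caps -/

section Symmetric
variable {S : Type*} [CommRing S]

/-- The number of `true` entries of a state. -/
def ones {n : ℕ} (s : Fin n → Bool) : ℕ := ∑ i, if s i then 1 else 0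

/-- The vector spanning the kernel of all caps in a given weight. -/
def symVec (q : S) : {n : ℕ} → (Fin n → Bool) → S
  | 0, _ => 1
  | n + 1, s => symVec q (fun i : Fin n => s i.castSucc) *
      if s (Fin.last n) then 1 else (-q) ^ ones fun i : Fin n => s i.castSucc

theorem ones_succ {n : ℕ} (s : Fin (n + 1) → Bool) :
    ones s = ones (fun i : Fin n => s i.castSucc) + if s (Fin.last n) then 1 else 0 := by
  rw [ones, Fin.sum_univ_castSucc]
  rfl

theorem ones_le {n : ℕ} (s : Fin n → Bool) : ones s ≤ n := by
  refine (Finset.sum_le_card_nsmul _ _ 1 fun i _ => ?_).trans (by simp)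
  split_ifs <;> simp

/-- The state obtained by appending a letter. -/
abbrev snoc {n : ℕ} (s : Fin n → Bool) (a : Bool) : Fin (n + 1) → Bool :=
  Fin.snoc (α := fun _ => Bool) s a

theorem ones_snoc {n : ℕ} (s : Fin n → Bool) (a : Bool) :
    ones (snoc s a) = ones s + if a then 1 else 0 := by
  simp [ones_succ, snoc]

theorem symVec_snoc (q : S) {n : ℕ} (s : Fin n → Bool) (a : Bool) :
    symVec q (snoc s a) = symVec q s * if a then 1 else (-q) ^ ones s := by
  simp [symVec, snoc]

theorem eq_snoc {n : ℕ} (s : Fin (n + 1) → Bool) : ∃ r a, s = snoc r a :=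
  ⟨_, _, (Fin.snoc_init_self s).symm⟩

theorem sum_snoc {M : Type*} [AddCommMonoid M] {n : ℕ} (F : (Fin (n + 1) → Bool) → M) :
    ∑ s, F s = ∑ r : Fin n → Bool, ∑ a, F (snoc r a) := by
  rw [← (Fin.snocEquiv fun _ : Fin (n + 1) => Bool).sum_comp, Fintype.sum_prod_type,
    Finset.sum_comm]
  rfl

/-- The square length of `symVec` in weight `k`, hence the normalising denominator of `symProj`.
Splitting off the last letter reproduces the Pascal recursion of `gauss`. -/
theorem sum_symVec_sq (q : S) (n k : ℕ) :
    ∑ s : Fin n → Bool, (if ones s = k then symVec q s * symVec q s else 0) =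
      gauss (q ^ 2) n k := by
  induction n generalizing k with
  | zero => cases k <;> simp [ones, symVec, gauss]
  | succ n ih =>
    rw [sum_snoc]
    simp only [ones_snoc, symVec_snoc, Fintype.sum_bool, if_true, mul_one]
    rw [Finset.sum_add_distrib]
    have h2 : ∀ s : Fin n → Bool, (if ones s = k then symVec q s * (-q) ^ ones s *
        (symVec q s * (-q) ^ ones s) else 0) =
        (q ^ 2) ^ k * (if ones s = k then symVec q s * symVec q s else 0) := fun s => by
      split_ifs with h
      · have h3 : (-q) ^ k * (-q) ^ k = (q ^ 2) ^ k := by rw [← mul_pow, neg_mul_neg, ← sq]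
        rw [h]
        linear_combination symVec q s * symVec q s * h3
      · rw [mul_zero]
    simp only [Bool.false_eq_true, if_false, add_zero, h2]
    rw [← Finset.mul_sum, ih]
    cases k with
    | zero => simp
    | succ k =>
      simp only [add_left_inj, ih]
      rw [gauss_succ_succ, add_comm]

/-- Exchange of the values of a state at `i` and `j`. -/
theorem symVec_swap (q : S) {n : ℕ} (s t : Fin n → Bool) (i j : Fin n) (hij : (j : ℕ) = i + 1)
    (hst : ∀ k, k ≠ i → k ≠ j → s k = t k) (hsi : s i = true) (hsj : s j = false)
    (hti : t i = false) (htj : t j = true) :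
    ones s = ones t ∧ symVec q s = -q * symVec q t := by
  induction n with
  | zero => exact i.elim0
  | succ n ih =>
    have hi : (i : ℕ) < n := by omega
    by_cases hj : (j : ℕ) < n
    · have hlast : s (Fin.last n) = t (Fin.last n) := hst _
        (fun h => by rw [← h] at hi; simp at hi) (fun h => by rw [← h] at hj; simp at hj)
      obtain ⟨h1, h2⟩ := ih (fun k => s k.castSucc) (fun k => t k.castSucc) ⟨i, hi⟩ ⟨j, hj⟩ hij
        (fun k hki hkj => hst _ (fun h => hki (by ext; simp [← h])) (fun h => hkj (by ext; simp [← h])))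
        hsi hsj hti htj
      rw [ones_succ, ones_succ t, symVec, symVec, h1, h2, hlast]
      exact ⟨rfl, by ring⟩
    · obtain rfl : j = Fin.last n := by ext; simp; omega
      obtain ⟨n, rfl⟩ : ∃ k, n = k + 1 := ⟨n - 1, by omega⟩
      obtain rfl : i = (Fin.last n).castSucc := by ext; simp at hij ⊢; omega
      have hr : (fun k : Fin n => s k.castSucc.castSucc) = fun k => t k.castSucc.castSucc :=
        funext fun k => hst _ (fun h => by simp [Fin.ext_iff] at h; omega)
          (fun h => by simp [Fin.ext_iff] at h; omega)
      simp only [ones_succ, symVec, hr, hsi, hsj, hti, htj]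
      simp
      ring

/-- The projection onto the common kernel of all caps. -/
noncomputable def symProj (q : S) (n : ℕ) : Matrix (Fin n → Bool) (Fin n → Bool) S := fun s t =>
  if ones s = ones t then symVec q s * symVec q t * Ring.inverse (gauss (q ^ 2) n (ones s)) else 0

end Symmetric

/-! ### Base change and elementary diagrams -/

section Maps
variable {S T : Type*} [CommRing S] [CommRing T] (φ : S →+* T)

theorem comp_map (δ : S) {n m k : ℕ} (f : Mor S n m) (g : Mor S m k) :
    (fun F => φ (comp δ f g F)) = comp (φ δ) (fun D => φ (f D)) fun E => φ (g E) := by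
  classical
  funext F
  simp [comp, apply_ite φ]

theorem tensor_map {n m n' m' : ℕ} (f : Mor S n m) (g : Mor S n' m') :
    (fun F => φ (tensor f g F)) = tensor (fun D => φ (f D)) fun E => φ (g E) := by
  funext F
  simp [tensor, apply_ite φ]

theorem single_map {n m : ℕ} (D : Diagram n m) :
    (fun F => φ (single D F)) = single D := by
  funext F
  simp [single, Pi.single_apply, apply_ite φ]

theorem tensor_single {n m n' m' : ℕ} (D : Diagram n m) (E : Diagram n' m') :
    tensor (single D : Mor S n m) (single E) = single (D.tensor E) := by
  funext F
  simp only [tensor, single, Pi.single_apply, mul_ite, mul_one, mul_zero]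
  rw [Finset.sum_eq_single D, Finset.sum_eq_single E] <;> simp +contextual [eq_comm]

theorem rep_cupCap (q : Sˣ) (a b c d : Bool) :
    rep q (single Diagram.cupCap) (snoc (snoc Fin.elim0 a) b) (snoc (snoc Fin.elim0 c) d) =
      if a = !b ∧ c = !d then (if b then (q : S) else 1) * (if d then 1 else ((q⁻¹ : Sˣ) : S))
      else 0 := by
  have h0 : ∀ x : Fin 2, Equiv.swap (0 : Fin 2) 1 x = if x = 0 then 1 else 0 := by decide
  rw [rep_single, stateWeight, Fintype.prod_sum_type]
  simp [Fin.prod_univ_two, Diagram.cupCap, pos, Fin.snoc, snoc]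
  cases a <;> cases b <;> cases c <;> cases d <;> simp [glueWeight, arcWeight]

end Maps

/-! ### Wenzl's recursion on states -/

section Wenzl
variable {S : Type*} [CommRing S] (q : Sˣ)

theorem rep_tensor_identity_one {n m : ℕ} (f : Mor S n m) (s : Fin n → Bool) (t : Fin m → Bool)
    (a b : Bool) : rep q (tensor f (single (Diagram.identity 1))) (snoc s a) (snoc t b) =
      if a = b then rep q f s t else 0 := by
  rw [rep_tensor, rep_single_identity, Matrix.one_apply]
  have h : ((fun i : Fin 1 => (snoc s a) (Fin.natAdd n i)) =
      fun i : Fin 1 => (snoc t b) (Fin.natAdd m i)) ↔ a = b := by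
    have h1 : ∀ (k : ℕ) (r : Fin k → Bool) (c : Bool) (i : Fin 1),
        (snoc r c) (Fin.natAdd k i) = c := fun k r c i => by
      rw [Subsingleton.elim i 0]
      exact Fin.snoc_last (α := fun _ => Bool) _ _
    simp only [h1]
    exact ⟨fun h => congrFun h 0, fun h => by rw [h]⟩
  have h2 : ∀ (k : ℕ) (r : Fin k → Bool) (c : Bool),
      (fun i => (snoc r c) (Fin.castAdd 1 i)) = r := fun k r c => by
    funext i
    exact Fin.snoc_castSucc (α := fun _ => Bool) _ _ _
  simp only [h, h2, mul_ite, mul_one, mul_zero]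

theorem rep_identity_tensor_cupCap {n : ℕ} (s t : Fin n → Bool) (a b c d : Bool) :
    rep q (single ((Diagram.identity n).tensor Diagram.cupCap)) (snoc (snoc s a) b)
      (snoc (snoc t c) d) =
      if s = t ∧ a = !b ∧ c = !d then
        (if b then (q : S) else 1) * (if d then 1 else ((q⁻¹ : Sˣ) : S)) else 0 := by
  rw [← tensor_single, rep_tensor, rep_single_identity, Matrix.one_apply]
  have h1 : ∀ (r : Fin n → Bool) (c d : Bool),
      (fun i => (snoc (snoc r c) d) (Fin.castAdd 2 i)) = r := fun r c d => by
    funext i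
    exact (Fin.snoc_castSucc (α := fun _ => Bool) d (snoc r c) i.castSucc).trans
      (Fin.snoc_castSucc (α := fun _ => Bool) _ _ _)
  have h2 : ∀ (r : Fin n → Bool) (c d : Bool),
      (fun i => (snoc (snoc r c) d) (Fin.natAdd n i)) = snoc (snoc Fin.elim0 c) d :=
    fun r c d => by
    funext i
    fin_cases i
    · exact (Fin.snoc_castSucc (α := fun _ => Bool) d (snoc r c) (Fin.last n)).trans
        (Fin.snoc_last (α := fun _ => Bool) _ _)
    · exact Fin.snoc_last (α := fun _ => Bool) _ _
  rw [h1, h1, h2, h2, rep_cupCap]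
  split_ifs <;> simp_all

/-- The matrix coefficients of `f u f` in Wenzl's recursion. -/
theorem wenzl_mul_apply {n : ℕ} (P : Matrix (Fin (n + 1) → Bool) (Fin (n + 1) → Bool) S)
    (A U : Matrix (Fin (n + 2) → Bool) (Fin (n + 2) → Bool) S)
    (hA : ∀ s t a b, A (snoc s a) (snoc t b) = if a = b then P s t else 0)
    (hU : ∀ (s t : Fin n → Bool) a b c d, U (snoc (snoc s a) b) (snoc (snoc t c) d) =
      if s = t ∧ a = !b ∧ c = !d then
        (if b then (q : S) else 1) * (if d then 1 else ((q⁻¹ : Sˣ) : S)) else 0)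
    (s t : Fin (n + 1) → Bool) (a b : Bool) :
    (A * U * A) (snoc s a) (snoc t b) =
      (if a then (q : S) else 1) * (if b then 1 else ((q⁻¹ : Sˣ) : S)) *
        ∑ r : Fin n → Bool, P s (snoc r !a) * P (snoc r !b) t := by
  have h1 : ∀ (r : Fin n → Bool) c d, (A * U) (snoc s a) (snoc (snoc r c) d) =
      if c = !d then P s (snoc r !a) * ((if a then (q : S) else 1) *
        (if d then 1 else ((q⁻¹ : Sˣ) : S))) else 0 := by
    intro r c d
    rw [Matrix.mul_apply, sum_snoc, sum_snoc]
    simp only [hA, hU]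
    rw [Finset.sum_eq_single r]
    · cases a <;> cases c <;> cases d <;> simp
    · intro x _ hx
      simp [hx]
    · simp
  rw [Matrix.mul_apply, sum_snoc, sum_snoc]
  simp only [hA, h1]
  rw [Finset.mul_sum]
  refine Finset.sum_congr rfl fun r _ => ?_
  cases a <;> cases b <;> simp <;> ring

/-- Only words `r` of weight `j` contribute, and the sum of the squares of their `symVec` entries is
the Gaussian binomial on the right. -/
theorem sum_symProj_mul {n : ℕ} (q : S) (s t : Fin (n + 1) → Bool) (a b : Bool) (j : ℕ)
    (hs : ones s = j + if a then 1 else 0) (ht : ones t = j + if b then 1 else 0) :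
    ∑ r : Fin n → Bool, symProj q (n + 1) s (snoc r a) * symProj q (n + 1) (snoc r b) t =
      symVec q s * symVec q t * (if a then 1 else (-q) ^ j) * (if b then 1 else (-q) ^ j) *
        Ring.inverse (gauss (q ^ 2) (n + 1) (ones s)) *
        Ring.inverse (gauss (q ^ 2) (n + 1) (ones t)) * gauss (q ^ 2) n j := by
  rw [← sum_symVec_sq q n j, Finset.mul_sum]
  refine Finset.sum_congr rfl fun r _ => ?_
  simp only [symProj, ones_snoc, symVec_snoc]
  by_cases h : ones r = j
  · rw [if_pos (c := ones s = ones r + _) (by rw [h, hs]),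
      if_pos (c := ones r + _ = ones t) (by rw [h, ht]), if_pos h, h, ← ht]
    ring
  · rw [if_neg (by rw [hs]; omega), if_neg h]
    ring

theorem sum_symProj_mul_eq_zero {n : ℕ} (q : S) (s t : Fin (n + 1) → Bool) (a b : Bool)
    (h : ¬ ∃ j, (ones s = j + if a then 1 else 0) ∧ (ones t = j + if b then 1 else 0)) :
    ∑ r : Fin n → Bool, symProj q (n + 1) s (snoc r a) * symProj q (n + 1) (snoc r b) t = 0 := by
  refine Finset.sum_eq_zero fun r _ => ?_
  simp only [symProj, ones_snoc]
  by_cases h1 : ones s = ones r + if a then 1 else 0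
  · rw [if_neg (c := ones r + _ = ones t) fun h2 => h ⟨_, h1, h2.symm⟩, mul_zero]
  · rw [if_neg h1, zero_mul]

/-- The matrices `symProj` satisfy Wenzl's recursion. The constant `c` is the quotient [n + 1]/[n +
2] of balanced quantum numbers, which explains the factor q in `hc`. If the correction term is
nonzero, the identity reduces to absorption rules for Gaussian binomials and to [j + 1] + Q^{j+1} [n
+ 1 - j] = [n + 2]. -/
theorem symProj_recursion (hQ : ∀ m, IsUnit (qint ((q : S) ^ 2) (m + 1))) {n : ℕ} {c : S}
    (hc : qint ((q : S) ^ 2) (n + 2) * c = q * qint ((q : S) ^ 2) (n + 1))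
    (s t : Fin (n + 1) → Bool) (a b : Bool) :
    (if a = b then symProj (q : S) (n + 1) s t else 0) -
      c * ((if a then (q : S) else 1) * (if b then 1 else ((q⁻¹ : Sˣ) : S)) *
        ∑ r : Fin n → Bool, symProj (q : S) (n + 1) s (snoc r !a) *
          symProj (q : S) (n + 1) (snoc r !b) t) =
      symProj (q : S) (n + 2) (snoc s a) (snoc t b) := by
  have hqi : (q : S) * ((q⁻¹ : Sˣ) : S) = 1 := Units.mul_inv q
  have hN := hQ (n + 1)
  by_cases h : ∃ j, (ones s = j + if !a then 1 else 0) ∧ (ones t = j + if !b then 1 else 0)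
  · obtain ⟨j, hs, ht⟩ := h
    rw [sum_symProj_mul (q : S) s t _ _ j hs ht]
    have hks := ones_le s
    have hkt := ones_le t
    simp only [symProj, ones_snoc, symVec_snoc]
    generalize ((q⁻¹ : Sˣ) : S) = qi at *
    obtain ⟨u, hu⟩ : ∃ u : S, (q : S) = u := ⟨_, rfl⟩
    simp only [hu] at hQ hc hqi hN ⊢
    have hjn : j ≤ n + 1 := by omega
    have hy : ∀ k ≤ n + 1, gauss (u ^ 2) (n + 1) k *
        Ring.inverse (gauss (u ^ 2) (n + 1) k) = 1 :=
      fun k hk => Ring.mul_inverse_cancel _ (isUnit_gauss _ hQ hk)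
    have hz := Ring.mul_inverse_cancel _ (isUnit_gauss (u ^ 2) hQ (show j + 1 ≤ n + 2 by omega))
    have hsplit : qint (u ^ 2) (j + 1) + (u ^ 2) ^ (j + 1) * qint (u ^ 2) (n + 1 - j) =
        qint (u ^ 2) (n + 2) := by
      rw [← qint_add]; congr 1; omega
    have hqQ : ∀ j, (-u) ^ j * (-u) ^ j = (u ^ 2) ^ j := fun j => by
      rw [← mul_pow, neg_mul_neg, ← sq]
    have r1 := qint_mul_gauss_succ (u ^ 2) n j
    have r2 := qint_sub_mul_gauss_succ (u ^ 2) n j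
    have r3 := qint_mul_gauss_succ (u ^ 2) (n + 1) j
    have r4 := qint_sub_mul_gauss_succ (u ^ 2) (n + 1) (j + 1)
    rw [Nat.add_sub_add_right] at r4
    -- Multiplication by the unit [n + 2] clears `c`. In each case `c1` rewrites the correction term
    -- and `c2` the new denominator in terms of the old ones.
    apply hN.mul_left_cancel
    have e : n + 1 + 1 = n + 2 := rfl
    rw [e] at *
    cases a <;> cases b <;>
      simp only [Bool.not_true, Bool.not_false, Bool.false_eq_true, if_true, if_false, add_zero,
        reduceCtorEq] at hs ht ⊢ <;> rw [hs, ht] <;>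
      simp only [if_true, mul_one, one_mul]
    · have hy1 := hy (j + 1) (by omega)
      generalize Ring.inverse (gauss (u ^ 2) (n + 1) (j + 1)) = Y at *
      generalize Ring.inverse (gauss (u ^ 2) (n + 2) (j + 1)) = W at *
      generalize gauss (u ^ 2) (n + 1) (j + 1) = y at *
      generalize gauss (u ^ 2) (n + 2) (j + 1) = z at *
      generalize gauss (u ^ 2) n j = x at *
      have hp := hqQ (j + 1)
      generalize (u ^ 2) ^ (j + 1) = p at *
      generalize (-u) ^ (j + 1) = e at *
      generalize qint (u ^ 2) (n + 2) = N at *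
      generalize qint (u ^ 2) (n + 1) = M at *
      generalize qint (u ^ 2) (j + 1) = J at *
      generalize qint (u ^ 2) (n + 1 - j) = D at *
      have c1 : N * c * qi * Y * Y * x = J * Y := by
        linear_combination qi * Y * Y * x * hc + M * x * Y * Y * hqi - Y * Y * r1 + J * Y * hy1
      have c2 : N * W = D * Y := by
        linear_combination -(N * W) * hy1 - W * Y * r4 + D * Y * hz
      linear_combination symVec u s * symVec u t * (-c1 - p * c2 - N * W * hp - Y * hsplit)
    · have hy1 := hy (j + 1) (by omega)
      have hy0 := hy j (by omega)
      rw [pow_succ (-u) j]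
      generalize Ring.inverse (gauss (u ^ 2) (n + 1) (j + 1)) = Y at *
      generalize Ring.inverse (gauss (u ^ 2) (n + 1) j) = Y0 at *
      generalize Ring.inverse (gauss (u ^ 2) (n + 2) (j + 1)) = W at *
      generalize gauss (u ^ 2) (n + 1) (j + 1) = y at *
      generalize gauss (u ^ 2) (n + 1) j = y0 at *
      generalize gauss (u ^ 2) (n + 2) (j + 1) = z at *
      generalize gauss (u ^ 2) n j = x at *
      generalize (-u) ^ j = e at *
      generalize qint (u ^ 2) (n + 2) = N at *
      generalize qint (u ^ 2) (n + 1) = M at *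
      generalize qint (u ^ 2) (j + 1) = J at *
      have c1 : N * c * Y * Y0 * x = u * J * Y0 := by
        linear_combination Y * Y0 * x * hc - u * Y * Y0 * r1 + u * J * Y0 * hy1
      have c2 : N * W = J * Y0 := by
        linear_combination -(N * W) * hy0 - W * Y0 * r3 + J * Y0 * hz
      linear_combination symVec u s * symVec u t * e * (-c1 + u * c2)
    · have hy1 := hy (j + 1) (by omega)
      have hy0 := hy j (by omega)
      rw [pow_succ (-u) j]
      generalize Ring.inverse (gauss (u ^ 2) (n + 1) (j + 1)) = Y at *
      generalize Ring.inverse (gauss (u ^ 2) (n + 1) j) = Y0 at *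
      generalize Ring.inverse (gauss (u ^ 2) (n + 2) (j + 1)) = W at *
      generalize gauss (u ^ 2) (n + 1) (j + 1) = y at *
      generalize gauss (u ^ 2) (n + 1) j = y0 at *
      generalize gauss (u ^ 2) (n + 2) (j + 1) = z at *
      generalize gauss (u ^ 2) n j = x at *
      generalize (-u) ^ j = e at *
      generalize qint (u ^ 2) (n + 2) = N at *
      generalize qint (u ^ 2) (n + 1) = M at *
      generalize qint (u ^ 2) (j + 1) = J at *
      have c1 : N * c * Y * Y0 * x = u * J * Y0 := by
        linear_combination Y * Y0 * x * hc - u * Y * Y0 * r1 + u * J * Y0 * hy1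
      have c2 : N * W = J * Y0 := by
        linear_combination -(N * W) * hy0 - W * Y0 * r3 + J * Y0 * hz
      linear_combination symVec u s * symVec u t * e * (-c1 + u * c2) -
        N * c * symVec u s * symVec u t * e * Y * Y0 * x * hqi
    · have hy0 := hy j (by omega)
      have hp := hqQ j
      rw [pow_succ (u ^ 2) j] at hsplit
      generalize Ring.inverse (gauss (u ^ 2) (n + 1) j) = Y at *
      generalize Ring.inverse (gauss (u ^ 2) (n + 2) (j + 1)) = W at *
      generalize gauss (u ^ 2) (n + 1) j = y at *
      generalize gauss (u ^ 2) (n + 2) (j + 1) = z at *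
      generalize gauss (u ^ 2) n j = x at *
      generalize (u ^ 2) ^ j = p at *
      generalize (-u) ^ j = e at *
      generalize qint (u ^ 2) (n + 2) = N at *
      generalize qint (u ^ 2) (n + 1) = M at *
      generalize qint (u ^ 2) (j + 1) = J at *
      generalize qint (u ^ 2) (n + 1 - j) = D at *
      have c1 : N * c * u * p * Y * Y * x = p * u ^ 2 * D * Y := by
        linear_combination u * p * Y * Y * x * hc - p * u ^ 2 * Y * Y * r2 +
          p * u ^ 2 * D * Y * hy0
      have c2 : N * W = J * Y := by
        linear_combination -(N * W) * hy0 - W * Y * r3 + J * Y * hz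
      linear_combination symVec u s * symVec u t *
        (-c1 - c2 - N * c * u * Y * Y * x * hp - Y * hsplit)
  -- Without a common weight `j` the correction vanishes. For `a = b` either the weights of `s` and
  -- `t` differ, or both are 0 with `a` false and all denominators are 1; for `a ≠ b` the extended
  -- words have different weights.
  · rw [sum_symProj_mul_eq_zero _ _ _ _ _ h, mul_zero, mul_zero, sub_zero]
    simp only [symProj, ones_snoc, symVec_snoc]
    push Not at h
    by_cases hab : a = b
    · subst hab
      by_cases hst : ones s = ones t
      · cases a
        · have h0 : ones s = 0 := by
            by_contra h0
            exact h (ones s - 1) (by simp; omega) (by simp; omega)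
          rw [h0] at hst
          simp [← hst, h0]
        · exact absurd hst.symm (h (ones s) (by simp))
      · simp [hst]
    · rw [if_neg hab, if_neg]
      intro h1
      cases a <;> cases b <;> simp at hab h1
      · exact h (ones t) (by simpa using h1) (by simp)
      · exact h (ones s) (by simp) (by simpa using h1.symm)

theorem qnum_map {T : Type*} [CommRing T] (φ : S →+* T) (δ : S) (k : ℕ) :
    φ (qnum δ k) = qnum (φ δ) k := by
  induction k using Nat.twoStepInduction with
  | zero => simp [qnum]
  | one => simp [qnum]
  | more k h1 h2 => simp [qnum, h1, h2]

theorem qnum_two (k : ℕ) : qnum (2 : ℤ) k = k := by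
  induction k using Nat.twoStepInduction with
  | zero => simp [qnum]
  | one => simp [qnum]
  | more k h1 h2 =>
    rw [qnum, h1, h2]
    push_cast
    ring

/-- At δ = 2 the quantum number [k + 1] takes the value k + 1. -/
theorem qnum_genDelta_ne_zero (k : ℕ) : qnum genDelta (k + 1) ≠ 0 := by
  rw [genDelta, ← qnum_map, Ne, FaithfulSMul.algebraMap_eq_zero_iff]
  intro h
  have h1 := congrArg (Polynomial.evalRingHom (2 : ℤ)) h
  rw [qnum_map] at h1
  simp only [coe_evalRingHom, eval_X, map_zero, qnum_two] at h1
  omega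

/-- The action of the generic Jones-Wenzl idempotents on states. -/
theorem rep_jonesWenzl (φ : GenField →+* S) (hδ : φ genDelta = q + ((q⁻¹ : Sˣ) : S)) (n : ℕ) :
    rep q (fun D => φ (jonesWenzl n D)) = symProj (q : S) n := by
  have hu : ∀ m, IsUnit (φ (qnum genDelta (m + 1))) := fun m =>
    (Ne.isUnit (qnum_genDelta_ne_zero m)).map φ
  have hQm : ∀ m, qint ((q : S) ^ 2) (m + 1) = (q : S) ^ m * φ (qnum genDelta (m + 1)) :=
    fun m => by rw [qint_eq_qnum, ← hδ, qnum_map]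
  have hQ : ∀ m, IsUnit (qint ((q : S) ^ 2) (m + 1)) := fun m => by
    rw [hQm]
    exact (q.isUnit.pow m).mul (hu m)
  induction n using Nat.twoStepInduction with
  | zero =>
    rw [jonesWenzl, single_map, rep_single_identity]
    ext s t
    obtain rfl : s = t := Subsingleton.elim _ _
    simp [symProj, symVec, ones]
  | one =>
    rw [jonesWenzl, single_map, rep_single_identity]
    ext s t
    obtain ⟨r, a, rfl⟩ := eq_snoc s
    obtain ⟨r', b, rfl⟩ := eq_snoc t
    rw [Subsingleton.elim r' r, Matrix.one_apply]
    have h1 : snoc r a = snoc r b ↔ a = b := by simp [snoc]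
    simp only [symProj, h1, ones_snoc, symVec_snoc]
    cases a <;> cases b <;> simp [ones, symVec, gauss]
  | more n _ ih =>
    obtain ⟨f, hf⟩ : ∃ f : Mor S (n + 1 + 1) (n + 1 + 1), f =
      tensor (fun D => φ (jonesWenzl (n + 1) D)) (single (Diagram.identity 1)) := ⟨_, rfl⟩
    have hrec : (fun D => φ (jonesWenzl (n + 2) D)) =
        f - φ (qnum genDelta (n + 1) / qnum genDelta (n + 2)) •
        comp (φ genDelta) (comp (φ genDelta) f
          (single ((Diagram.identity n).tensor Diagram.cupCap))) f := by
      rw [hf, ← single_map φ (Diagram.identity 1), ← tensor_map,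
        ← single_map φ ((Diagram.identity n).tensor Diagram.cupCap), ← comp_map, ← comp_map]
      funext D
      rw [jonesWenzl]
      simp only [Pi.sub_apply, Pi.smul_apply, smul_eq_mul, map_sub, map_mul]
    rw [hrec, rep_sub, rep_smul, rep_comp q hδ, rep_comp q hδ]
    ext s t
    obtain ⟨s, a, rfl⟩ := eq_snoc s
    obtain ⟨t, b, rfl⟩ := eq_snoc t
    rw [Matrix.sub_apply, Matrix.smul_apply, smul_eq_mul,
      wenzl_mul_apply q (symProj (q : S) (n + 1)) _ _
        (fun s t a b => by rw [← ih, hf]; exact rep_tensor_identity_one q _ s t a b)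
        (fun s t a b c d => rep_identity_tensor_cupCap q s t a b c d),
      ← symProj_recursion q hQ _ s t a b, ← ih]
    · congr 1
      rw [hf]
      exact rep_tensor_identity_one q _ s t a b
    · have h : φ (qnum genDelta (n + 1 + 1)) *
          φ (qnum genDelta (n + 1) / qnum genDelta (n + 1 + 1)) = φ (qnum genDelta (n + 1)) := by
        rw [← map_mul, mul_div_cancel₀ _ (qnum_genDelta_ne_zero _)]
      rw [hQm, hQm]
      linear_combination (q : S) ^ (n + 1) * h

end Wenzl

/-! ### Killing caps on states -/

section Caps
variable {S : Type*} [CommRing S] (q : Sˣ)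

/-- The rows of `M` are killed by a cap linking `i` and `j`. -/
def KillsCap {ι : Type*} {n : ℕ} (M : Matrix ι (Fin n → Bool) S) (i j : Fin n) : Prop :=
  ∀ r s t, (∀ k, k ≠ i → k ≠ j → s k = t k) → s i = true → s j = false → t i = false →
    t j = true → M r s + q * M r t = 0

theorem symProj_killsCap {n : ℕ} (i j : Fin n) (hij : (j : ℕ) = i + 1) :
    KillsCap q (symProj (q : S) n) i j := by
  intro r s t hst hsi hsj hti htj
  obtain ⟨h1, h2⟩ := symVec_swap (q : S) s t i j hij hst hsi hsj hti htj
  simp only [symProj, h1, h2]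
  split_ifs <;> ring

/-- Only the arc from `i` to `j` sees the exchange; its weight changes from 1 to q. -/
theorem stateWeight_swap {n m : ℕ} (D : Diagram n m) (i j : Fin n) (hij : i < j)
    (hD : D.partner (Sum.inl i) = Sum.inl j) (s t : Fin n → Bool) (u : Fin m → Bool)
    (hst : ∀ k, k ≠ i → k ≠ j → s k = t k) (hsi : s i = true) (hsj : s j = false)
    (hti : t i = false) (htj : t j = true) :
    stateWeight q D (Sum.elim t u) = q * stateWeight q D (Sum.elim s u) := by
  have hD' : D.partner (Sum.inl j) = Sum.inl i := by rw [← hD, D.partner_partner]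
  have hlt : pos (Sum.inl i : Fin n ⊕ Fin m) < pos (Sum.inl j : Fin n ⊕ Fin m) := hij
  rw [stateWeight, stateWeight, ← Finset.mul_prod_erase _ _ (Finset.mem_univ (Sum.inl i)),
    ← Finset.mul_prod_erase _ _ (Finset.mem_univ (Sum.inl i)), hD, if_pos hlt, if_pos hlt]
  simp only [Sum.elim_inl, hsi, hsj, hti, htj, arcWeight, one_mul]
  congr 1
  refine Finset.prod_congr rfl fun x hx => ?_
  by_cases hxj : x = Sum.inl j
  · subst hxj
    rw [hD', if_neg (not_lt_of_gt hlt), if_neg (not_lt_of_gt hlt)]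
  have hne : ∀ y : Fin n ⊕ Fin m, y ≠ Sum.inl i → y ≠ Sum.inl j →
      Sum.elim t u y = Sum.elim s u y := by
    rintro (y | y) h1 h2
    · exact (hst y (fun h => h1 (by rw [h])) (fun h => h2 (by rw [h]))).symm
    · rfl
  have hxi := Finset.ne_of_mem_erase hx
  rw [hne x hxi hxj, hne (D.partner x)
    (fun h => hxj (by rw [← D.partner_partner x, h, hD]))
    (fun h => hxi (by rw [← D.partner_partner x, h, hD']))]

/-- Words are paired by exchanging their letters at `i` and `j`. A pair contributes M r s + q · M r
t = 0 times a common factor, and a word with equal letters there has weight zero. -/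
theorem KillsCap.mul_rep_single {ι : Type*} {n m : ℕ} {M : Matrix ι (Fin n → Bool) S}
    {i j : Fin n} (hM : KillsCap q M i j) (hij : i < j) {D : Diagram n m}
    (hD : D.partner (Sum.inl i) = Sum.inl j) : M * rep q (single D) = 0 := by
  ext r u
  rw [Matrix.mul_apply, Matrix.zero_apply]
  have hij' := hij.ne
  have hf : ∀ s t : Fin n → Bool, (∀ k, k ≠ i → k ≠ j → s k = t k) → s i = true → s j = false →
      t i = false → t j = true →
      M r s * rep q (single D) s u + M r t * rep q (single D) t u = 0 := by
    intro s t hst hsi hsj hti htj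
    rw [rep_single, rep_single, stateWeight_swap q D i j hij hD s t _ hst hsi hsj hti htj]
    linear_combination (∏ j, glueWeight q (u j)) *
      stateWeight q D (Sum.elim s fun j => !u j) * hM r s t hst hsi hsj hti htj
  refine Finset.sum_involution (fun s _ => s ∘ Equiv.swap i j) ?_ ?_ (fun _ _ => Finset.mem_univ _)
    ?_
  · intro s _
    have h1 : ∀ k, k ≠ i → k ≠ j → (s ∘ Equiv.swap i j) k = s k := fun k h1 h2 => by
      simp [Equiv.swap_apply_of_ne_of_ne h1 h2]
    have h2 : (s ∘ Equiv.swap i j) i = s j := by simp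
    have h3 : (s ∘ Equiv.swap i j) j = s i := by simp
    cases hi : s i <;> cases hj : s j
    · rw [rep_single, rep_single, stateWeight_eq_zero q (x := Sum.inl i) (by rw [hD]; simp [hi, hj]),
        stateWeight_eq_zero q (x := Sum.inl i) (by rw [hD]; simp [hi, hj])]
      ring
    · rw [add_comm]
      exact hf _ _ h1 (h2.trans hj) (h3.trans hi) hi hj
    · exact hf _ _ (fun k a b => (h1 k a b).symm) hi hj (h2.trans hj) (h3.trans hi)
    · rw [rep_single, rep_single, stateWeight_eq_zero q (x := Sum.inl i) (by rw [hD]; simp [hi, hj]),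
        stateWeight_eq_zero q (x := Sum.inl i) (by rw [hD]; simp [hi, hj])]
      ring
  · intro s _ hs h
    apply hs
    have h2 : s j = s i := by
      have := congrFun h i
      simpa using this
    rw [rep_single, stateWeight_eq_zero q (x := Sum.inl i) (by rw [hD]; simp [h2])]
    ring
  · intro s _
    funext k
    simp

end Caps

/-! ### Left links, the identity coefficient and reflection -/

namespace Diagram

/-- Without left links, all left points are joined to the equally many right points. The openers are
then exactly the left points, and openers determine the diagram. -/
theorem eq_identity {n : ℕ} {D : Diagram n n}
    (h : ∀ i i', D.partner (Sum.inl i) ≠ Sum.inl i') : D = identity n := by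
  have h1 : ∀ i, ∃ j, D.partner (Sum.inl i) = Sum.inr j := fun i => by
    rcases hx : D.partner (Sum.inl i) with x | x
    · exact (h _ _ hx).elim
    · exact ⟨x, rfl⟩
  choose g hg using h1
  have hgi : Function.Injective g := fun i j hij => by
    have : D.partner (Sum.inl i) = D.partner (Sum.inl j) := by rw [hg, hg, hij]
    exact Sum.inl_injective (D.partner_injective this)
  refine eq_of_isOpener_iff ?_
  rintro (x | x)
  · have h1 : D.IsOpener (Sum.inl x) := by
      rw [IsOpener, hg]
      simp [pos]; omega
    have h2 : (identity n).IsOpener (Sum.inl x) := by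
      simp [IsOpener, identity, pos]; omega
    exact iff_of_true h1 h2
  · obtain ⟨i, rfl⟩ := (Finite.injective_iff_surjective.1 hgi) x
    have h1 : ¬ D.IsOpener (Sum.inr (g i)) := by
      rw [IsOpener, ← hg, D.partner_partner, hg]
      simp [pos]; omega
    have h2 : ¬ (identity n).IsOpener (Sum.inr (g i)) := by
      simp [IsOpener, identity, pos]; omega
    exact iff_of_false h1 h2

/-- A link between left points encloses a link between neighbouring left points. -/
theorem exists_simple_cap {n m : ℕ} (D : Diagram n m) {i i' : Fin n}
    (h : D.partner (Sum.inl i) = Sum.inl i') :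
    ∃ k k' : Fin n, (k' : ℕ) = k + 1 ∧ D.partner (Sum.inl k) = Sum.inl k' := by
  have main : ∀ N, ∀ i i' : Fin n, i < i' → (i' : ℕ) - i ≤ N →
      D.partner (Sum.inl i) = Sum.inl i' →
      ∃ k k' : Fin n, (k' : ℕ) = k + 1 ∧ D.partner (Sum.inl k) = Sum.inl k' := by
    intro N
    induction N with
    | zero => intro i i' h1 h2; omega
    | succ N ih =>
      intro i i' h1 h2 h
      by_cases hk : (i' : ℕ) = i + 1
      · exact ⟨i, i', hk, h⟩
      have hlt : (i : ℕ) < i' := h1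
      let k : Fin n := ⟨i + 1, by omega⟩
      have h3 := D.noncrossing (Sum.inl i) (Sum.inl k) (by simp [pos, k])
        (by rw [h]; simp [pos, k]; omega)
      have hki : D.partner (Sum.inl k) ≠ Sum.inl i := fun h' => by
        have := D.partner_partner (Sum.inl k)
        rw [h', h] at this
        simp [k, Fin.ext_iff] at this
        omega
      have hkk := D.partner_ne (Sum.inl k)
      have h4 := D.noncrossing (D.partner (Sum.inl k)) (Sum.inl i)
      rw [D.partner_partner, h] at h4
      rw [h] at h3
      rcases hx : D.partner (Sum.inl k) with x | x
      · rw [hx] at h3 h4 hki hkk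
        simp only [pos, k, ne_eq, Sum.inl.injEq, Fin.ext_iff] at h3 h4 hki hkk
        have h5 : (k : ℕ) < x := by simp only [k]; omega
        exact ih k x h5 (by simp only [k]; omega) hx
      · rw [hx] at h3
        simp only [pos] at h3
        omega
  rcases lt_trichotomy i i' with h1 | h1 | h1
  · exact main _ i i' h1 le_rfl h
  · exact (D.partner_ne _ (h1 ▸ h)).elim
  · refine main _ i' i h1 le_rfl ?_
    rw [← h, D.partner_partner]

end Diagram

section Identity
variable {S : Type*} [CommRing S] (q : Sˣ)

/-- In this state all left points are `true` and all right points `false`, so any diagram with a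
left link has weight zero. Only the identity remains. -/
theorem rep_true_true {n : ℕ} (f : Mor S n n) :
    rep q f (fun _ => true) (fun _ => true) = f (Diagram.identity n) := by
  classical
  rw [rep, Finset.sum_eq_single (Diagram.identity n)]
  · have := congrFun (congrFun (rep_single_identity q n) fun _ => true) fun _ => true
    rw [rep_single, Matrix.one_apply_eq] at this
    rw [mul_left_comm, this, mul_one]
  · intro D _ hD
    by_contra hc
    refine hD (Diagram.eq_identity fun i i' h => hc ?_)
    rw [stateWeight_eq_zero q (x := Sum.inl i) (by rw [h]; rfl), mul_zero]
  · simp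

theorem symVec_true (q : S) (n : ℕ) : symVec q (fun _ : Fin n => true) = 1 := by
  induction n with
  | zero => rfl
  | succ n ih => simp [symVec, ih]

theorem symProj_true_true (q : S) (n : ℕ) :
    symProj q n (fun _ => true) (fun _ => true) = 1 := by
  have : ones (fun _ : Fin n => true) = n := by simp [ones]
  simp [symProj, symVec_true, this, gauss_self]

/-- The product of the glue weights depends only on the number of letters `true`. -/
theorem prod_glueWeight {n : ℕ} (s : Fin n → Bool) :
    (∏ j, glueWeight q (s j)) * (q : S) ^ n = (q : S) ^ ones s := by
  induction n with
  | zero => simp [ones]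
  | succ n ih =>
    rw [ones_succ, Fin.prod_univ_castSucc, pow_succ, pow_add, ← ih fun i => s i.castSucc]
    cases s (Fin.last n) <;> simp [glueWeight]
    · rw [mul_mul_mul_comm, Units.inv_mul, mul_one]
    · ring

theorem flip_flip {n m : ℕ} (D : Diagram n m) : D.flip.flip = D := by
  ext1
  funext x
  simp [Diagram.flip]

/-- Reflection as a bijection. -/
def flipEquiv (n m : ℕ) : Diagram n m ≃ Diagram m n :=
  ⟨Diagram.flip, Diagram.flip, flip_flip, flip_flip⟩

/-- Reflection reverses the order of the boundary points; complementing the states as well leaves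
every arc weight unchanged. -/
theorem stateWeight_flip {n m : ℕ} (D : Diagram n m) (s : Fin n → Bool) (t : Fin m → Bool) :
    stateWeight q D.flip (Sum.elim t fun i => !s i) =
      stateWeight q D (Sum.elim s fun j => !t j) := by
  have key : ∀ z : Fin n ⊕ Fin m, pos z.swap + pos z + 1 = n + m := by
    rintro (z | z) <;> simp [pos] <;> omega
  have hlt : ∀ x y : Fin n ⊕ Fin m, pos x.swap < pos y.swap ↔ pos y < pos x := fun x y => by
    have := key x
    have := key y
    omega
  have hst : ∀ x : Fin n ⊕ Fin m, Sum.elim t (fun i => !s i) x.swap =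
      !(Sum.elim s (fun j => !t j) x) := by
    rintro (x | x) <;> simp
  rw [stateWeight, ← Equiv.prod_comp (Equiv.sumComm (Fin n) (Fin m)), stateWeight,
    ← Equiv.prod_comp (Function.Involutive.toPerm D.partner D.partner_partner)]
  refine Finset.prod_congr rfl fun x _ => ?_
  have hx : Function.Involutive.toPerm D.partner D.partner_partner x = D.partner x := rfl
  simp only [hx, Equiv.sumComm_apply, Diagram.flip, Sum.swap_swap, D.partner_partner, hlt, hst]
  congr 1
  cases Sum.elim s (fun j => !t j) x <;> cases Sum.elim s (fun j => !t j) (D.partner x) <;> rfl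

theorem rep_involution {n m : ℕ} (f : Mor S n m) (s : Fin n → Bool) (t : Fin m → Bool) :
    (∏ j, glueWeight q (t j)) * rep q (involution f) t s =
      (∏ j, glueWeight q (s j)) * rep q f s t := by
  rw [rep, rep, mul_left_comm]
  congr 2
  rw [← Equiv.sum_comp (flipEquiv n m)]
  refine Finset.sum_congr rfl fun D _ => ?_
  have : (flipEquiv n m) D = D.flip := rfl
  rw [this, stateWeight_flip, involution, flip_flip]

/-- The generic Jones-Wenzl idempotents are fixed by the involution. -/
theorem involution_eq_of_rep_eq_symProj {n : ℕ} {f : TL S n} (hf : rep q f = symProj (q : S) n) :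
    involution f = f := by
  apply rep_injective q
  ext t s
  have h1 := rep_involution q f s t
  rw [hf] at h1 ⊢
  have h2 := prod_glueWeight q s
  have h3 := prod_glueWeight q t
  have hu : IsUnit (∏ j, glueWeight q (t j)) :=
    isUnit_of_mul_isUnit_left (h3 ▸ q.isUnit.pow _)
  apply hu.mul_left_cancel
  rw [h1]
  -- `symProj` is symmetric and preserves weight, while the two glue products agree in equal
  -- weights; so the twist in `rep_involution` has no effect.
  have hsymm : symProj (q : S) n s t = symProj (q : S) n t s := by
    simp only [symProj, eq_comm (a := ones s)]
    split_ifs with h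
    · rw [h]
      ring
    · rfl
  rw [hsymm]
  by_cases h : ones t = ones s
  · congr 1
    apply (q.isUnit.pow n).mul_right_cancel
    rw [h2, h3, h]
  · simp [symProj, h]

end Identity

/-! ### Adjoining q to the ground ring -/

section Quadratic
variable {R T : Type*} [CommRing R] [CommRing T]

/-- The extension of `R` by a unit `q` with `q + q⁻¹ = δ`. -/
abbrev Quad (δ : R) := QuadraticAlgebra R (-1) δ

/-- The unit `q` with `q + q⁻¹ = δ`. -/
def quadUnit (δ : R) : (Quad δ)ˣ where
  val := ⟨0, 1⟩
  inv := ⟨δ, -1⟩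
  val_inv := by ext <;> simp [QuadraticAlgebra.re_one, QuadraticAlgebra.im_one]
  inv_val := by ext <;> simp [QuadraticAlgebra.re_one, QuadraticAlgebra.im_one]

theorem algebraMap_eq_quadUnit_add_inv (δ : R) :
    algebraMap R (Quad δ) δ = (quadUnit δ : Quad δ) + ((quadUnit δ)⁻¹ : (Quad δ)ˣ) := by
  change _ = (⟨0, 1⟩ : Quad δ) + ⟨δ, -1⟩
  ext <;> simp

/-- Functoriality of `Quad`. -/
def quadMap (φ : R →+* T) {δ : R} {δ' : T} (h : φ δ = δ') : Quad δ →+* Quad δ' where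
  toFun z := ⟨φ z.re, φ z.im⟩
  map_one' := by ext <;> simp [QuadraticAlgebra.re_one, QuadraticAlgebra.im_one]
  map_zero' := by ext <;> simp
  map_add' x y := by ext <;> simp
  map_mul' x y := by ext <;> simp [← h]

theorem quadMap_injective {φ : R →+* T} (hφ : Function.Injective φ) {δ : R} {δ' : T}
    (h : φ δ = δ') : Function.Injective (quadMap φ h) := by
  intro x y hxy
  have h1 := congrArg QuadraticAlgebra.re hxy
  have h2 := congrArg QuadraticAlgebra.im hxy
  ext
  · exact hφ h1
  · exact hφ h2

theorem quadMap_algebraMap (φ : R →+* T) {δ : R} {δ' : T} (h : φ δ = δ') (x : R) :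
    quadMap φ h (algebraMap R (Quad δ) x) = algebraMap T (Quad δ') (φ x) := by
  ext <;> simp [quadMap]

theorem map_quadUnit (φ : R →+* T) {δ : R} {δ' : T} (h : φ δ = δ') :
    Units.map (quadMap φ h : Quad δ →* Quad δ') (quadUnit δ) = quadUnit δ' := by
  ext <;> simp [quadMap, quadUnit]

/-- The action of a morphism on states over the quadratic extension. -/
noncomputable def quadRep (δ : R) {n m : ℕ} (f : Mor R n m) :
    Matrix (Fin n → Bool) (Fin m → Bool) (Quad δ) :=
  rep (quadUnit δ) fun D => algebraMap R (Quad δ) (f D)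

theorem quadRep_injective (δ : R) {n m : ℕ} : Function.Injective (quadRep δ : Mor R n m → _) := by
  intro f g h
  have := rep_injective _ h
  funext D
  exact QuadraticAlgebra.algebraMap_injective (congrFun this D)

theorem quadRep_comp (δ : R) {n m k : ℕ} (f : Mor R n m) (g : Mor R m k) :
    quadRep δ (comp δ f g) = quadRep δ f * quadRep δ g := by
  rw [quadRep, comp_map, rep_comp _ (algebraMap_eq_quadUnit_add_inv δ)]
  rfl

theorem quadRep_single (δ : R) {n m : ℕ} (D : Diagram n m) :
    quadRep δ (single D) = rep (quadUnit δ) (single D) := by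
  rw [quadRep, single_map]

theorem quadRep_tensor (δ : R) {n m n' m' : ℕ} (f : Mor R n m) (g : Mor R n' m')
    (s : Fin (n + n') → Bool) (t : Fin (m + m') → Bool) :
    quadRep δ (tensor f g) s t =
      quadRep δ f (fun i => s (Fin.castAdd n' i)) (fun j => t (Fin.castAdd m' j)) *
        quadRep δ g (fun i => s (Fin.natAdd n i)) (fun j => t (Fin.natAdd m j)) := by
  rw [quadRep, tensor_map, rep_tensor]
  rfl

theorem quadMap_quadRep (φ : R →+* T) {δ : R} {δ' : T} (h : φ δ = δ') {n m : ℕ} (f : Mor R n m)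
    (s : Fin n → Bool) (t : Fin m → Bool) :
    quadMap φ h (quadRep δ f s t) = quadRep δ' (fun D => φ (f D)) s t := by
  rw [quadRep, rep_map, map_quadUnit]
  simp only [quadMap_algebraMap]
  rfl

theorem quadRep_smul (δ : R) {n m : ℕ} (c : R) (f : Mor R n m) :
    quadRep δ (fun D => f D * c) = algebraMap R (Quad δ) c • quadRep δ f := by
  rw [quadRep, quadRep, ← rep_smul]
  congr 1
  funext D
  simp [mul_comm]

/-- The category axioms are pulled back from matrix multiplication along the faithful functor
`quadRep`. -/
theorem comp_identity (δ : R) {n m : ℕ} (f : Mor R n m) :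
    comp δ f (single (Diagram.identity m)) = f := by
  apply quadRep_injective δ
  rw [quadRep_comp, quadRep_single, rep_single_identity, Matrix.mul_one]

theorem identity_comp (δ : R) {n m : ℕ} (f : Mor R n m) :
    comp δ (single (Diagram.identity n)) f = f := by
  apply quadRep_injective δ
  rw [quadRep_comp, quadRep_single, rep_single_identity, Matrix.one_mul]

theorem comp_assoc (δ : R) {n m k l : ℕ} (f : Mor R n m) (g : Mor R m k) (h : Mor R k l) :
    comp δ (comp δ f g) h = comp δ f (comp δ g h) := by
  apply quadRep_injective δ
  simp only [quadRep_comp, Matrix.mul_assoc]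

theorem comp_eq_sum (δ : R) {n m k : ℕ} (f : Mor R n m) (g : Mor R m k) :
    comp δ f g = ∑ E, g E • comp δ f (single E) := by
  classical
  funext F
  rw [Finset.sum_apply]
  simp only [comp, Pi.smul_apply, smul_eq_mul, single, Pi.single_apply]
  rw [Finset.sum_comm]
  refine Finset.sum_congr rfl fun E _ => ?_
  rw [Finset.mul_sum]
  refine Finset.sum_congr rfl fun D _ => ?_
  rw [Finset.sum_eq_single E]
  · by_cases hc : D.IsComposite E F <;> simp [hc]
    ring
  · intro E' _ h
    simp [h]
  · simp

end Quadratic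

/-! ### Specialisation of the Jones-Wenzl idempotent -/

section Specialization
variable {R : Type*} [CommRing R] [IsDomain R] {δ : R} {n : ℕ}

theorem IsJonesWenzl.exists_common_denominator {e : TL R n} (he : IsJonesWenzl δ e) :
    ∃ (b : ℤ[X]) (h : TL ℤ[X] n), aeval δ b ≠ 0 ∧
      (∀ D, jonesWenzl n D * algebraMap ℤ[X] GenField b = algebraMap ℤ[X] GenField (h D)) ∧
      ∀ D, e D * aeval δ b = aeval δ (h D) := by
  classical
  choose a b hb h1 h2 using he
  refine ⟨∏ D, b D, fun D => a D * ∏ D' ∈ Finset.univ.erase D, b D', ?_, ?_, ?_⟩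
  · rw [map_prod, Finset.prod_ne_zero_iff]
    exact fun D _ => hb D
  · intro D
    rw [← Finset.mul_prod_erase _ _ (Finset.mem_univ D), map_mul, ← mul_assoc, h1, map_mul]
  · intro D
    rw [← Finset.mul_prod_erase _ _ (Finset.mem_univ D), map_mul, ← mul_assoc, h2, map_mul]

theorem quadRep_jonesWenzl (n : ℕ) :
    quadRep genDelta (jonesWenzl n) = symProj (quadUnit genDelta : Quad genDelta) n :=
  rep_jonesWenzl _ _ (algebraMap_eq_quadUnit_add_inv _) n

theorem jonesWenzl_identity (n : ℕ) : jonesWenzl n (Diagram.identity n) = 1 := by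
  apply QuadraticAlgebra.algebraMap_injective (a := (-1 : GenField)) (b := genDelta)
  rw [← rep_true_true (quadUnit genDelta) fun D => algebraMap GenField (Quad genDelta)
    (jonesWenzl n D), map_one]
  exact (congrFun (congrFun (quadRep_jonesWenzl n) _) _).trans (symProj_true_true _ n)

theorem jonesWenzl_flip (D : Diagram n n) : jonesWenzl n D.flip = jonesWenzl n D := by
  apply QuadraticAlgebra.algebraMap_injective (a := (-1 : GenField)) (b := genDelta)
  exact congrFun (involution_eq_of_rep_eq_symProj _ (quadRep_jonesWenzl n)) D

/-- Equal fractions give a b' = a' b in ℤ[X], because ℤ[X] embeds in ℚ(δ); this relation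
specialises, and the denominators cancel in the domain `R`. The lemma yields both uniqueness and
invariance under ι. -/
theorem IsJonesWenzl.eq_of_eq {e : TL R n} (he : IsJonesWenzl δ e) {e' : TL R n}
    (he' : IsJonesWenzl δ e') {D D' : Diagram n n} (h : jonesWenzl n D = jonesWenzl n D') :
    e D = e' D' := by
  obtain ⟨a, b, hb, h1, h2⟩ := he D
  obtain ⟨a', b', hb', h1', h2'⟩ := he' D'
  have h3 : a * b' = a' * b := by
    apply IsFractionRing.injective ℤ[X] GenField
    rw [map_mul, map_mul, ← h1, ← h1', h]
    ring
  have h4 := congrArg (aeval δ) h3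
  rw [map_mul, map_mul, ← h2, ← h2'] at h4
  apply mul_right_cancel₀ (mul_ne_zero hb hb')
  linear_combination h4

theorem IsJonesWenzl.identity {e : TL R n} (he : IsJonesWenzl δ e) :
    e (Diagram.identity n) = 1 := by
  obtain ⟨a, b, hb, h1, h2⟩ := he (Diagram.identity n)
  rw [jonesWenzl_identity, one_mul] at h1
  rw [← IsFractionRing.injective ℤ[X] GenField h1] at h2
  exact mul_right_cancel₀ hb (h2.trans (one_mul _).symm)

theorem IsJonesWenzl.involution {e : TL R n} (he : IsJonesWenzl δ e) : involution e = e :=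
  funext fun D => he.eq_of_eq he (jonesWenzl_flip D)

/-- The cap relation holds for `symProj` over ℚ(δ). Multiplied by a common denominator it descends
to ℤ[X] with q adjoined, from where it specialises to `R`. -/
theorem IsJonesWenzl.killsCap {e : TL R n} (he : IsJonesWenzl δ e) (i j : Fin n)
    (hij : (j : ℕ) = i + 1) : KillsCap (quadUnit δ) (quadRep δ e) i j := by
  obtain ⟨b, h, hb, h1, h2⟩ := he.exists_common_denominator
  intro r s t hst hsi hsj hti htj
  have h3 : quadRep (X : ℤ[X]) h r s + (quadUnit (X : ℤ[X]) : Quad (X : ℤ[X])) * quadRep X h r t = 0 := by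
    have hg : algebraMap ℤ[X] GenField X = genDelta := rfl
    apply quadMap_injective (IsFractionRing.injective ℤ[X] GenField) hg
    have hu := congrArg Units.val (map_quadUnit (algebraMap ℤ[X] GenField) hg)
    simp only [Units.coe_map, MonoidHom.coe_coe] at hu
    rw [map_add, map_mul, map_zero, quadMap_quadRep, quadMap_quadRep, hu]
    simp only [← h1]
    rw [quadRep_smul, quadRep_jonesWenzl, Matrix.smul_apply, Matrix.smul_apply, smul_eq_mul,
      smul_eq_mul, mul_left_comm, ← mul_add,
      symProj_killsCap _ i j hij r s t hst hsi hsj hti htj, mul_zero]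
  have hδ : (aeval δ : ℤ[X] →ₐ[ℤ] R).toRingHom X = δ := aeval_X δ
  have hu := congrArg Units.val (map_quadUnit (aeval δ : ℤ[X] →ₐ[ℤ] R).toRingHom hδ)
  simp only [Units.coe_map, MonoidHom.coe_coe] at hu
  have h4 := congrArg (quadMap (aeval δ : ℤ[X] →ₐ[ℤ] R).toRingHom hδ) h3
  have h5 : (fun D => (aeval δ : ℤ[X] →ₐ[ℤ] R).toRingHom (h D)) = fun D => e D * aeval δ b :=
    funext fun D => (h2 D).symm
  rw [map_add, map_mul, map_zero, quadMap_quadRep, quadMap_quadRep, hu, h5, quadRep_smul,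
    Matrix.smul_apply, Matrix.smul_apply, smul_eq_mul, smul_eq_mul, mul_left_comm, ← mul_add,
    ← QuadraticAlgebra.C_eq_algebraMap, QuadraticAlgebra.C_mul_eq_smul] at h4
  -- `Quad δ` need not be a domain, so b(δ) is cancelled in each coordinate over `R`.
  have h6 := congrArg QuadraticAlgebra.re h4
  have h7 := congrArg QuadraticAlgebra.im h4
  rw [QuadraticAlgebra.re_smul, smul_eq_mul, QuadraticAlgebra.re_zero] at h6
  rw [QuadraticAlgebra.im_smul, smul_eq_mul, QuadraticAlgebra.im_zero] at h7
  ext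
  · exact (mul_eq_zero.1 h6).resolve_left hb
  · exact (mul_eq_zero.1 h7).resolve_left hb

end Specialization

/-! ### Cutting a left link -/

namespace Diagram

/-- Cutting an outermost link between left points into two through strands. -/
theorem exists_cut {n m : ℕ} (S : Diagram n m) (hS : S.IsMonic) (hmn : m < n) :
    ∃ S' : Diagram n (m + 2), S'.IsMonic ∧
      ∀ k l, S'.partner (Sum.inl k) = Sum.inl l → S.partner (Sum.inl k) = Sum.inl l := by
  classical
  have hr : ∀ j, ∃ k, S.partner (Sum.inr j) = Sum.inl k := fun j => by
    have := hS j
    rcases h : S.partner (Sum.inr j) with x | x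
    · exact ⟨x, rfl⟩
    · rw [h] at this
      simp at this
  choose g hg using hr
  have hg' : ∀ k j, S.partner (Sum.inl k) = Sum.inr j → k = g j := fun k j h => by
    have := S.partner_partner (Sum.inl k)
    rw [h, hg] at this
    exact (Sum.inl_injective this).symm
  -- Through strands do not cross, so their left ends come in the same order as their right ends.
  have hgmono : ∀ j j', j < j' → (g j : ℕ) < g j' := fun j j' h => by
    have h1 := S.noncrossing (Sum.inl (g j')) (Sum.inr j')
    have h2 : S.partner (Sum.inl (g j)) = Sum.inr j := by rw [← hg, S.partner_partner]
    have h3 : S.partner (Sum.inl (g j')) = Sum.inr j' := by rw [← hg, S.partner_partner]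
    have h4 := S.noncrossing (Sum.inl (g j')) (Sum.inl (g j))
    have h5 : g j ≠ g j' := fun h5 => by
      rw [h5, h3] at h2
      exact h.ne' (Sum.inr_injective h2)
    rw [h2, h3] at h4
    simp only [pos] at h4
    have h6 : (g j : ℕ) ≠ g j' := fun h => h5 (Fin.ext h)
    have h7 : (j : ℕ) < j' := h
    omega
  obtain ⟨k0, hk0⟩ : ∃ k, (S.partner (Sum.inl k)).isLeft = true := by
    by_contra hc
    push Not at hc
    have h1 : ∀ k, ∃ j, S.partner (Sum.inl k) = Sum.inr j := fun k => by
      rcases h : S.partner (Sum.inl k) with x | x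
      · exact absurd (by rw [h]; rfl) (hc k)
      · exact ⟨x, rfl⟩
    choose c hc' using h1
    have : Function.Injective c := fun k l h =>
      Sum.inl_injective (S.partner_injective (by rw [hc', hc', h]))
    have := Fintype.card_le_of_injective c this
    simp at this
    omega
  -- The lowest left point on a left link is the lower end of an outermost link. Choosing this link
  -- puts all other left links above `i'`.
  obtain ⟨i', hi', hmax⟩ := Finset.exists_max_image
    (Finset.univ.filter fun k : Fin n => (S.partner (Sum.inl k)).isLeft = true) id
    ⟨k0, by simpa using hk0⟩
  simp only [Finset.mem_filter, Finset.mem_univ, true_and, id_eq] at hi' hmax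
  obtain ⟨i, hi⟩ : ∃ i, S.partner (Sum.inl i') = Sum.inl i := by
    rcases h : S.partner (Sum.inl i') with x | x
    · exact ⟨x, rfl⟩
    · rw [h] at hi'
      simp at hi'
  have hii : S.partner (Sum.inl i) = Sum.inl i' := by rw [← hi, S.partner_partner]
  have hmax' : ∀ k l, S.partner (Sum.inl k) = Sum.inl l → (k : ℕ) ≤ i' ∧ (l : ℕ) ≤ i' :=
    fun k l h => by
      have h' : S.partner (Sum.inl l) = Sum.inl k := by rw [← h, S.partner_partner]
      exact ⟨hmax k (by rw [h]; rfl), hmax l (by rw [h']; rfl)⟩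
  have hlt : (i : ℕ) < i' := by
    have h1 := (hmax' _ _ hi).2
    have h2 : i ≠ i' := fun h => S.partner_ne _ (h ▸ hi)
    have h3 : (i : ℕ) ≠ i' := fun h => h2 (Fin.ext h)
    omega
  -- `a` is the number of through strands starting above `i`. No through strand starts between `i`
  -- and `i'`, so the new strands end at the neighbouring right points `a` and `a + 1`.
  obtain ⟨a, ham, ha⟩ : ∃ a ≤ m, ∀ j : Fin m, (g j : ℕ) < i ↔ (j : ℕ) < a := by
    have hex : ∃ a : ℕ, ∀ j : Fin m, a ≤ j → (i : ℕ) ≤ g j := ⟨m, fun j hj => by omega⟩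
    refine ⟨Nat.find hex, Nat.find_min' hex fun j hj => by omega, fun j => ⟨fun h => ?_, fun h => ?_⟩⟩
    · by_contra hc
      have := Nat.find_spec hex j (by omega)
      omega
    · have h1 := Nat.find_min hex (m := Nat.find hex - 1) (by omega)
      push Not at h1
      obtain ⟨j0, h2, h3⟩ := h1
      rcases lt_trichotomy j j0 with h4 | h4 | h4
      · have := hgmono _ _ h4
        omega
      · rwa [h4]
      · have h5 : (j0 : ℕ) < j := h4
        omega
  let f : (Fin n ⊕ Fin m) ⊕ Bool → (Fin n ⊕ Fin m) ⊕ Bool := Sum.elim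
    (fun x => if x = Sum.inl i then Sum.inr false else if x = Sum.inl i' then Sum.inr true else
      Sum.inl (S.partner x))
    (fun b => if b then Sum.inl (Sum.inl i') else Sum.inl (Sum.inl i))
  have hne : i ≠ i' := fun h => by simp [h] at hlt
  have hpi : ∀ x, S.partner x = Sum.inl i ↔ x = Sum.inl i' := fun x =>
    ⟨fun h => S.partner_injective (h.trans hi.symm), fun h => by rw [h, hi]⟩
  have hpi' : ∀ x, S.partner x = Sum.inl i' ↔ x = Sum.inl i := fun x =>
    ⟨fun h => S.partner_injective (h.trans hii.symm), fun h => by rw [h, hii]⟩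
  have hff : ∀ x, f (f x) = x := by
    rintro (x | x)
    · by_cases h1 : x = Sum.inl i
      · simp [f, h1]
      by_cases h2 : x = Sum.inl i'
      · simp [f, h2, hne.symm]
      simp [f, h1, h2, hpi, hpi', S.partner_partner]
    · cases x <;> simp [f, hne.symm]
  have hfne : ∀ x, f x ≠ x := by
    rintro (x | x)
    · by_cases h1 : x = Sum.inl i
      · simp [f, h1]
      by_cases h2 : x = Sum.inl i'
      · simp [f, h2, hne.symm]
      simp [f, h1, h2, S.partner_ne]
    · cases x <;> simp [f]
  -- The new right points `false` and `true`, partners of `i` and `i'`, are inserted at `a` and `a +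
  -- 1`; old right points from `a` on move down by two.
  let θ : (Fin n ⊕ Fin m) ⊕ Bool → Fin n ⊕ Fin (m + 2) := Sum.elim
    (Sum.map id fun j => if (j : ℕ) < a then ⟨j, by omega⟩ else ⟨j + 2, by omega⟩)
    (fun b => Sum.inr (if b then ⟨a + 1, by omega⟩ else ⟨a, by omega⟩))
  have p1 : ∀ k, pos (θ (Sum.inl (Sum.inl k))) = k := fun k => rfl
  have p2 : ∀ j : Fin m, (pos (θ (Sum.inl (Sum.inr j))) = n + (m + 1 - j) ∧ (j : ℕ) < a) ∨
      (pos (θ (Sum.inl (Sum.inr j))) = n + (m - 1 - j) ∧ a ≤ j) := fun j => by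
    by_cases h : (j : ℕ) < a
    · left
      simp [θ, h, pos]
    · right
      have h1 : θ (Sum.inl (Sum.inr j)) = Sum.inr ⟨j + 2, by omega⟩ := by simp [θ, h]
      refine ⟨?_, by omega⟩
      rw [h1]
      change n + (m + 2 - 1 - ((j : ℕ) + 2)) = _
      omega
  have p3 : pos (θ (Sum.inr false)) = n + (m + 1 - a) := rfl
  have p4 : pos (θ (Sum.inr true)) = n + (m - a) := by
    change n + (m + 2 - 1 - (a + 1)) = n + (m - a)
    omega
  have hθ : Function.Injective θ := by
    have hpinj : ∀ x y, pos (θ x) = pos (θ y) → x = y := by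
      have hf : ∀ {k : ℕ} {u v : Fin k}, (u : ℕ) = v → u = v := fun h => Fin.ext h
      rintro ((x | x) | (_ | _)) ((y | y) | (_ | _)) h <;> first
        | rfl
        | (try simp only [p1, p3, p4] at h
           first
           | (congr 2; apply hf; omega)
           | (have q1 := p2 x
              have q2 := p2 y
              congr 2; apply hf; omega)
           | (exfalso
              first
              | omega
              | (have q1 := p2 x
                 omega)
              | (have q1 := p2 y
                 omega)))
    exact fun x y h => hpinj x y (by rw [h])
  have hbij : Function.Bijective θ := by
    rw [Fintype.bijective_iff_injective_and_card]
    exact ⟨hθ, by simp; omega⟩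
  let Θ := Equiv.ofBijective θ hbij
  have hnc : ∀ x y, pos (θ x) < pos (θ y) → pos (θ y) < pos (θ (f x)) →
      pos (θ (f y)) < pos (θ (f x)) := by
    -- Every point is an end of one of the two new strands, of an untouched left link or of an old
    -- through strand. Recording both positions reduces noncrossing to linear arithmetic.
    have hcl : ∀ y, (pos (θ y) = i ∧ pos (θ (f y)) = n + (m + 1 - a)) ∨
        (pos (θ y) = i' ∧ pos (θ (f y)) = n + (m - a)) ∨
        (∃ k l, k ≠ i ∧ k ≠ i' ∧ S.partner (Sum.inl k) = Sum.inl l ∧ pos (θ y) = k ∧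
          pos (θ (f y)) = l) ∨
        (∃ j, pos (θ y) = g j ∧ pos (θ (f y)) = pos (θ (Sum.inl (Sum.inr j)))) ∨
        (∃ j, pos (θ y) = pos (θ (Sum.inl (Sum.inr j))) ∧ pos (θ (f y)) = g j) ∨
        (pos (θ y) = n + (m + 1 - a) ∧ pos (θ (f y)) = i) ∨
        (pos (θ y) = n + (m - a) ∧ pos (θ (f y)) = i') := by
      rintro ((k | j) | (_ | _))
      · by_cases h1 : k = i
        · subst h1
          exact Or.inl ⟨rfl, by simp only [f, Sum.elim_inl, if_true]; exact p3⟩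
        by_cases h2 : k = i'
        · subst h2
          have h4 : f (Sum.inl (Sum.inl k)) = Sum.inr true := by simp [f, h1]
          exact Or.inr (Or.inl ⟨rfl, by rw [h4]; exact p4⟩)
        have h4 : f (Sum.inl (Sum.inl k)) = Sum.inl (S.partner (Sum.inl k)) := by
          simp [f, h1, h2]
        rw [h4]
        rcases hx : S.partner (Sum.inl k) with l | j
        · exact Or.inr (Or.inr (Or.inl ⟨k, l, h1, h2, hx, rfl, rfl⟩))
        · exact Or.inr (Or.inr (Or.inr (Or.inl ⟨j, by rw [← hg' k j hx, p1], rfl⟩)))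
      · refine Or.inr (Or.inr (Or.inr (Or.inr (Or.inl ⟨j, rfl, ?_⟩))))
        simp only [f, Sum.elim_inl, reduceCtorEq, if_false, hg, p1]
      · exact Or.inr (Or.inr (Or.inr (Or.inr (Or.inr (Or.inl ⟨p3, rfl⟩)))))
      · exact Or.inr (Or.inr (Or.inr (Or.inr (Or.inr (Or.inr ⟨p4, rfl⟩)))))
    have hS2 : ∀ j, S.partner (Sum.inl (g j)) = Sum.inr j := fun j => by
      rw [← hg, S.partner_partner]
    have hin := i.isLt
    have hin' := i'.isLt
    have hgi : ∀ j, ¬ ((i : ℕ) < g j ∧ (g j : ℕ) < i') ∧ (g j : ℕ) ≠ i ∧ (g j : ℕ) ≠ i' := by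
      intro j
      refine ⟨fun h => ?_, fun h => ?_, fun h => ?_⟩
      · have := S.noncrossing (Sum.inl i) (Sum.inl (g j))
        rw [hii, hS2] at this
        simp only [pos] at this
        omega
      · have := hS2 j
        rw [Fin.ext h, hii] at this
        simp at this
      · have := hS2 j
        rw [Fin.ext h, hi] at this
        simp at this
    have hll : ∀ k l k' l', S.partner (Sum.inl k) = Sum.inl l →
        S.partner (Sum.inl k') = Sum.inl l' → (k : ℕ) < k' → (k' : ℕ) < l → (l' : ℕ) < l := by
      intro k l k' l' h h'
      have := S.noncrossing (Sum.inl k) (Sum.inl k')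
      rwa [h, h'] at this
    have hlg : ∀ k l j, S.partner (Sum.inl k) = Sum.inl l → (k : ℕ) < g j → ¬ (g j : ℕ) < l := by
      intro k l j h h1 h2
      have := S.noncrossing (Sum.inl k) (Sum.inl (g j))
      rw [h, hS2] at this
      simp only [pos] at this
      omega
    have hgg : ∀ j j', (g j : ℕ) < g j' → (j : ℕ) < j' := fun j j' h => by
      rcases lt_trichotomy j j' with h1 | h1 | h1
      · exact h1
      · rw [h1] at h
        omega
      · have := hgmono _ _ h1
        omega
    intro x y
    have hcx := hcl x
    have hcy := hcl y
    generalize pos (θ (f x)) = fx at *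
    generalize pos (θ (f y)) = fy at *
    generalize pos (θ x) = x at *
    generalize pos (θ y) = y at *
    intro h1 h2
    rcases hcx with ⟨x1, x2⟩ | ⟨x1, x2⟩ | ⟨k, l, k1, k2, hk, x1, x2⟩ | ⟨j, x1, x2⟩ | ⟨j, x1, x2⟩ |
      ⟨x1, x2⟩ | ⟨x1, x2⟩
    · rcases hcy with ⟨y1, y2⟩ | ⟨y1, y2⟩ | ⟨k, l, k1, k2, hk, y1, y2⟩ | ⟨j, y1, y2⟩ | ⟨j, y1, y2⟩ |
        ⟨y1, y2⟩ | ⟨y1, y2⟩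
      · omega
      · omega
      · omega
      · have := ha j; have := p2 j; omega
      · omega
      · omega
      · omega
    · rcases hcy with ⟨y1, y2⟩ | ⟨y1, y2⟩ | ⟨k, l, k1, k2, hk, y1, y2⟩ | ⟨j, y1, y2⟩ | ⟨j, y1, y2⟩ |
        ⟨y1, y2⟩ | ⟨y1, y2⟩
      · omega
      · omega
      · omega
      · have := ha j; have := p2 j; omega
      · omega
      · omega
      · omega
    · have hkm := hmax' _ _ hk
      have hki := hll k l i i' hk hii
      rcases hcy with ⟨y1, y2⟩ | ⟨y1, y2⟩ | ⟨k', l', k1', k2', hk', y1, y2⟩ | ⟨j, y1, y2⟩ |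
        ⟨j, y1, y2⟩ | ⟨y1, y2⟩ | ⟨y1, y2⟩
      · omega
      · omega
      · have := hll k l k' l' hk hk'; omega
      · have := hlg k l j hk; omega
      · have := p2 j; omega
      · omega
      · omega
    · have hj := p2 j
      have haj := ha j
      have hgj := hgi j
      rcases hcy with ⟨y1, y2⟩ | ⟨y1, y2⟩ | ⟨k', l', k1', k2', hk', y1, y2⟩ | ⟨j', y1, y2⟩ |
        ⟨j', y1, y2⟩ | ⟨y1, y2⟩ | ⟨y1, y2⟩
      · omega
      · omega
      · omega
      · have := hgg j j'; have := p2 j'; have := ha j'; omega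
      · have := p2 j'; omega
      · omega
      · omega
    · have := p2 j; omega
    · omega
    · omega
  let S' : Diagram n (m + 2) :=
    { partner := fun x => Θ (f (Θ.symm x))
      partner_partner := fun x => by simp [hff]
      partner_ne := fun x h => hfne (Θ.symm x) (by rw [Equiv.eq_symm_apply]; exact h)
      noncrossing := fun x y => by
        obtain ⟨x, rfl⟩ := Θ.surjective x
        obtain ⟨y, rfl⟩ := Θ.surjective y
        simp only [Equiv.symm_apply_apply]
        exact hnc x y }
  have hS'f : ∀ x, S'.partner (θ x) = θ (f x) := fun x => by
    change Θ (f (Θ.symm (Θ x))) = _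
    rw [Equiv.symm_apply_apply]
    rfl
  refine ⟨S', fun j => ?_, fun k l h => ?_⟩
  · obtain ⟨x, hx⟩ := hbij.2 (Sum.inr j)
    rw [← hx, hS'f]
    rcases x with (x | x) | (_ | _)
    · simp [θ] at hx
    · simp [f, θ, hg]
    · simp [f, θ]
    · simp [f, θ]
  · have h1 : θ (Sum.inl (Sum.inl k)) = Sum.inl k := rfl
    rw [← h1, hS'f] at h
    by_cases h2 : k = i
    · simp [f, h2, θ] at h
    by_cases h3 : k = i'
    · simp [f, h3, hne.symm, θ] at h
    have h4 : f (Sum.inl (Sum.inl k)) = Sum.inl (S.partner (Sum.inl k)) := by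
      simp [f, h2, h3]
    rw [h4] at h
    rcases hx : S.partner (Sum.inl k) with x | x
    · rw [hx] at h
      rw [Sum.inl_injective (show (Sum.inl x : Fin n ⊕ Fin (m + 2)) = Sum.inl l from h)]
    · rw [hx] at h
      simp [θ] at h

end Diagram

/-! ### Juxtaposition -/

namespace Diagram

theorem tensor_partner_inl {n m n' m' : ℕ} (D : Diagram n m) (E : Diagram n' m')
    (x : Fin n ⊕ Fin m) : (D.tensor E).partner (tensorEquiv n m n' m' (Sum.inl x)) =
      tensorEquiv n m n' m' (Sum.inl (D.partner x)) := by
  simp [tensor]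

theorem tensor_partner_inr {n m n' m' : ℕ} (D : Diagram n m) (E : Diagram n' m')
    (x : Fin n' ⊕ Fin m') : (D.tensor E).partner (tensorEquiv n m n' m' (Sum.inr x)) =
      tensorEquiv n m n' m' (Sum.inr (E.partner x)) := by
  simp [tensor]

theorem tensor_injective {n m n' m' : ℕ} {D D' : Diagram n m} {E E' : Diagram n' m'}
    (h : D.tensor E = D'.tensor E') : D = D' ∧ E = E' := by
  constructor
  · ext1
    funext x
    have := D.tensor_partner_inl E x
    rw [h, tensor_partner_inl] at this
    exact (Sum.inl_injective ((tensorEquiv n m n' m').injective this)).symm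
  · ext1
    funext x
    have := D.tensor_partner_inr E x
    rw [h, tensor_partner_inr] at this
    exact (Sum.inr_injective ((tensorEquiv n m n' m').injective this)).symm

theorem swap_tensorEquiv {n m n' m' : ℕ} (z : (Fin n ⊕ Fin m) ⊕ (Fin n' ⊕ Fin m')) :
    (tensorEquiv n m n' m' z).swap = tensorEquiv m n m' n' (Sum.map Sum.swap Sum.swap z) := by
  rcases z with (z | z) | (z | z) <;> rfl

theorem identity_tensor_identity (n n' : ℕ) :
    (identity n).tensor (identity n') = identity (n + n') := by
  ext1
  funext x
  obtain ⟨x, rfl⟩ := (tensorEquiv n n n' n').surjective x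
  change _ = Sum.swap _
  rw [swap_tensorEquiv]
  rcases x with x | x
  · exact tensor_partner_inl _ _ x
  · exact tensor_partner_inr _ _ x

theorem flip_tensor {n m n' m' : ℕ} (D : Diagram n m) (E : Diagram n' m') :
    (D.tensor E).flip = D.flip.tensor E.flip := by
  ext1
  funext x
  obtain ⟨x, rfl⟩ := (tensorEquiv m n m' n').surjective x
  change ((D.tensor E).partner (Sum.swap _)).swap = _
  rw [swap_tensorEquiv]
  rcases x with x | x
  · rw [Sum.map_inl, tensor_partner_inl, tensor_partner_inl, swap_tensorEquiv]
    rfl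
  · rw [Sum.map_inr, tensor_partner_inr, tensor_partner_inr, swap_tensorEquiv]
    rfl

end Diagram

section Tensor
variable {R : Type*} [CommRing R]

theorem tensor_apply {n m n' m' : ℕ} (f : Mor R n m) (g : Mor R n' m') (D : Diagram n m)
    (E : Diagram n' m') : tensor f g (D.tensor E) = f D * g E := by
  unfold tensor
  rw [Finset.sum_eq_single D, Finset.sum_eq_single E, if_pos rfl]
  · intro E' _ h
    exact if_neg fun h' => h (Diagram.tensor_injective h').2
  · simp
  · intro D' _ h
    exact Finset.sum_eq_zero fun E' _ => if_neg fun h' => h (Diagram.tensor_injective h').1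
  · simp

theorem exists_of_tensor_ne_zero {n m n' m' : ℕ} {f : Mor R n m} {g : Mor R n' m'}
    {F : Diagram (n + n') (m + m')} (h : tensor f g F ≠ 0) :
    ∃ D E, D.tensor E = F ∧ f D ≠ 0 ∧ g E ≠ 0 := by
  obtain ⟨D, _, hD⟩ := Finset.exists_ne_zero_of_sum_ne_zero h
  obtain ⟨E, _, hE⟩ := Finset.exists_ne_zero_of_sum_ne_zero hD
  have h1 : D.tensor E = F := by
    by_contra hc
    exact hE (if_neg hc)
  rw [if_pos h1] at hE
  exact ⟨D, E, h1, left_ne_zero_of_mul hE, right_ne_zero_of_mul hE⟩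

theorem involution_tensor {n m n' m' : ℕ} (f : Mor R n m) (g : Mor R n' m') :
    involution (tensor f g) = tensor (involution f) (involution g) := by
  funext F
  unfold involution tensor
  refine ((flipEquiv m n).sum_comp _).symm.trans (Finset.sum_congr rfl fun D _ => ?_)
  refine ((flipEquiv m' n').sum_comp _).symm.trans ?_
  refine Finset.sum_congr rfl fun E _ => if_congr ?_ rfl rfl
  change D.flip.tensor E.flip = F.flip ↔ _
  rw [← Diagram.flip_tensor]
  exact (flipEquiv _ _).injective.eq_iff

theorem KillsCap.tensor_castAdd {δ : R} {n m n' m' : ℕ} {f : Mor R n m} {i j : Fin m}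
    (hf : KillsCap (quadUnit δ) (quadRep δ f) i j) (g : Mor R n' m') :
    KillsCap (quadUnit δ) (quadRep δ (tensor f g)) (Fin.castAdd m' i) (Fin.castAdd m' j) := by
  intro r s t hst hsi hsj hti htj
  have h1 : (fun k => s (Fin.natAdd m k)) = fun k : Fin m' => t (Fin.natAdd m k) :=
    funext fun k => hst _ (by simp [Fin.ext_iff]; omega) (by simp [Fin.ext_iff]; omega)
  have h2 := hf (fun k => r (Fin.castAdd n' k)) (fun k => s (Fin.castAdd m' k))
    (fun k => t (Fin.castAdd m' k))
    (fun k hi hj => hst _ (by simpa using hi) (by simpa using hj)) hsi hsj hti htj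
  rw [quadRep_tensor, quadRep_tensor, h1, ← mul_assoc, ← add_mul, h2, zero_mul]

theorem KillsCap.tensor_natAdd {δ : R} {n m n' m' : ℕ} {g : Mor R n' m'} {i j : Fin m'}
    (hg : KillsCap (quadUnit δ) (quadRep δ g) i j) (f : Mor R n m) :
    KillsCap (quadUnit δ) (quadRep δ (tensor f g)) (Fin.natAdd m i) (Fin.natAdd m j) := by
  intro r s t hst hsi hsj hti htj
  have h1 : (fun k => s (Fin.castAdd m' k)) = fun k : Fin m => t (Fin.castAdd m' k) :=
    funext fun k => hst _ (by simp [Fin.ext_iff]; omega) (by simp [Fin.ext_iff]; omega)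
  have h2 := hg (fun k => r (Fin.natAdd n k)) (fun k => s (Fin.natAdd m k))
    (fun k => t (Fin.natAdd m k))
    (fun k hi hj => hst _ (by simpa using hi) (by simpa using hj)) hsi hsj hti htj
  rw [quadRep_tensor, quadRep_tensor, h1, mul_left_comm, ← mul_add, h2, mul_zero]

end Tensor

/-! ### Projectors modulo links inside buckets -/

/-- The diagram links two left points in the relation `C`. -/
def Diagram.HasLink {n m : ℕ} (C : Fin n → Fin n → Prop) (D : Diagram n m) : Prop :=
  ∃ i j, C i j ∧ D.partner (Sum.inl i) = Sum.inl j

/-- `e` is congruent to the identity modulo the diagrams with a link in `C` and annihilates these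
diagrams from the left. -/
structure IsLinkProjector {R : Type*} [CommRing R] (δ : R) {n : ℕ} (C : Fin n → Fin n → Prop)
    (e : TL R n) : Prop where
  identity : e (Diagram.identity n) = 1
  support : ∀ D, e D ≠ 0 → D = Diagram.identity n ∨ D.HasLink C
  kills : ∀ {m : ℕ} (D : Diagram n m), D.HasLink C → comp δ e (single D) = 0

/-- `i` and `i'` are neighbours in the same bucket. -/
def BucketNeighbours (μ : List ℕ) (i i' : Fin μ.sum) : Prop :=
  (i' : ℕ) = i + 1 ∧ ∃ j < μ.length, (μ.take j).sum ≤ i ∧ (i' : ℕ) < (μ.take (j + 1)).sum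

theorem bucketNeighbours_castAdd {a : ℕ} {μ : List ℕ} (i i' : Fin a) (h : (i' : ℕ) = i + 1) :
    BucketNeighbours (a :: μ) (Fin.castAdd μ.sum i) (Fin.castAdd μ.sum i') :=
  ⟨h, 0, by simp, by simp, by simp⟩

theorem bucketNeighbours_natAdd {a : ℕ} {μ : List ℕ} {i i' : Fin μ.sum}
    (h : BucketNeighbours μ i i') :
    BucketNeighbours (a :: μ) (Fin.natAdd a i) (Fin.natAdd a i') := by
  obtain ⟨h, j, hj, h1, h2⟩ := h
  refine ⟨?_, j + 1, by simpa using hj, ?_, ?_⟩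
  · change a + (i' : ℕ) = a + i + 1
    omega
  · change a + (μ.take j).sum ≤ a + (i : ℕ)
    omega
  · change a + (i' : ℕ) < a + (μ.take (j + 1)).sum
    omega

theorem BucketNeighbours.cases {a : ℕ} {μ : List ℕ} {x y : Fin (a + μ.sum)}
    (h : BucketNeighbours (a :: μ) x y) :
    (∃ i i' : Fin a, (i' : ℕ) = i + 1 ∧ x = Fin.castAdd μ.sum i ∧ y = Fin.castAdd μ.sum i') ∨
    ∃ i i', BucketNeighbours μ i i' ∧ x = Fin.natAdd a i ∧ y = Fin.natAdd a i' := by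
  obtain ⟨h, j, hj, h1, h2⟩ := h
  cases j with
  | zero =>
    simp at h2
    exact Or.inl ⟨⟨x, by omega⟩, ⟨y, h2⟩, h, rfl, rfl⟩
  | succ j =>
    change a + (μ.take j).sum ≤ (x : ℕ) at h1
    change (y : ℕ) < a + (μ.take (j + 1)).sum at h2
    rw [List.length_cons] at hj
    have hx := x.isLt
    have hy := y.isLt
    refine Or.inr ⟨⟨x - a, by omega⟩, ⟨y - a, by omega⟩, ⟨?_, j, by omega, ?_, ?_⟩, ?_, ?_⟩
    · change (y : ℕ) - a = x - a + 1
      omega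
    · change _ ≤ (x : ℕ) - a
      omega
    · change (y : ℕ) - a < _
      omega
    · ext; simp; omega
    · ext; simp; omega

section
variable {R : Type*} [CommRing R] [IsDomain R] {δ : R}

theorem killsCap_tensorIdem {e : (a : ℕ) → TL R a} {μ : List ℕ}
    (he : ∀ a ∈ μ, IsJonesWenzl δ (e a)) {x y : Fin μ.sum} (h : BucketNeighbours μ x y) :
    KillsCap (quadUnit δ) (quadRep δ (tensorIdem e μ)) x y := by
  induction μ with
  | nil => exact x.elim0
  | cons a μ ih =>
    rcases BucketNeighbours.cases h with ⟨i, i', h1, rfl, rfl⟩ | ⟨i, i', h1, rfl, rfl⟩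
    · exact ((he a (by simp)).killsCap i i' h1).tensor_castAdd _
    · exact (ih (fun b hb => he b (by simp [hb])) h1).tensor_natAdd _

/-- A diagram in the support is a juxtaposition. Its first factor that is not an identity has a left
link, hence a simple cap, and that cap lies inside the bucket of the factor. Annihilation is checked
on states, where faithfulness turns `killsCap_tensorIdem` into an identity of morphisms. -/
theorem isLinkProjector_tensorIdem {e : (a : ℕ) → TL R a} {μ : List ℕ}
    (he : ∀ a ∈ μ, IsJonesWenzl δ (e a)) :
    IsLinkProjector δ (BucketNeighbours μ) (tensorIdem e μ) where
  identity := by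
    induction μ with
    | nil => exact Pi.single_eq_same (M := fun _ => R) (Diagram.identity 0) 1
    | cons a μ ih =>
      have h1 := ih fun b hb => he b (by simp [hb])
      change tensor (e a) (tensorIdem e μ) (Diagram.identity (a + μ.sum)) = 1
      rw [← Diagram.identity_tensor_identity, tensor_apply, h1, (he a (by simp)).identity, mul_one]
  support := by
    induction μ with
    | nil =>
      intro D h
      left
      by_contra hD
      exact h (Pi.single_eq_of_ne (M := fun _ => R) hD 1)
    | cons a μ ih =>
      intro F hF
      obtain ⟨D, E, rfl, -, hE⟩ := exists_of_tensor_ne_zero hF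
      by_cases hD : D = Diagram.identity a
      · rcases ih (fun b hb => he b (by simp [hb])) E hE with h1 | ⟨i, i', h1, h2⟩
        · left
          rw [hD, h1]
          exact Diagram.identity_tensor_identity a μ.sum
        · have h3 := D.tensor_partner_inr E (Sum.inl i)
          exact Or.inr ⟨_, _, bucketNeighbours_natAdd h1, h3.trans
            (congrArg (fun z => Diagram.tensorEquiv a a μ.sum μ.sum (Sum.inr z)) h2)⟩
      · have h1 : ∃ i i', D.partner (Sum.inl i) = Sum.inl i' := by
          by_contra hc
          push Not at hc
          exact hD (Diagram.eq_identity hc)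
        obtain ⟨i, i', h1⟩ := h1
        obtain ⟨k, k', h2, h3⟩ := D.exists_simple_cap h1
        have h4 := D.tensor_partner_inl E (Sum.inl k)
        rw [h3] at h4
        exact Or.inr ⟨_, _, bucketNeighbours_castAdd k k' h2, h4⟩
  kills := by
    rintro m D ⟨i, i', h1, h2⟩
    apply quadRep_injective δ
    rw [quadRep_comp, quadRep_single,
      (killsCap_tensorIdem he h1).mul_rep_single _ (Fin.lt_def.2 (by have := h1.1; omega)) h2]
    -- Scaling by 0 exhibits the zero matrix as the image of the zero morphism.
    have h3 : (fun _ => 0 * 0 : Mor R μ.sum m) = 0 := _root_.funext fun _ => mul_zero 0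
    have h4 := quadRep_smul δ 0 (0 : Mor R μ.sum m)
    rw [map_zero, zero_smul] at h4
    rw [← h3]
    exact h4.symm

theorem involution_tensorIdem {e : (a : ℕ) → TL R a} {μ : List ℕ}
    (he : ∀ a ∈ μ, IsJonesWenzl δ (e a)) : involution (tensorIdem e μ) = tensorIdem e μ := by
  induction μ with
  | nil =>
    funext D
    have h : ∀ D : Diagram [].sum [].sum, D = Diagram.identity 0 := fun D =>
      Diagram.eq_identity fun i => i.elim0
    change tensorIdem e [] D.flip = _
    rw [h D.flip, h D]
  | cons a μ ih =>
    change involution (tensor (e a) (tensorIdem e μ)) = tensor _ _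
    rw [involution_tensor, ih fun b hb => he b (by simp [hb]), (he a (by simp)).involution]

end

/-! ### Left links of composites -/

namespace Diagram
variable {n m k : ℕ}

theorem exists_isComposite (D : Diagram n m) (E : Diagram m k) : ∃ F : Diagram n k,
    (∀ x y, glueSetoid D E (outer m x) (outer m y) ↔ y = x ∨ y = F.partner x) ∧
    ∀ G, D.IsComposite E G ↔ G = F := by
  obtain ⟨F, hF, -⟩ := exists_composite (1 : ℤˣ) D E
  exact ⟨F, hF, isComposite_iff hF⟩

theorem IsComposite.partner_inl {D : Diagram n m} {E : Diagram m k} {F : Diagram n k}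
    (h : D.IsComposite E F) {i i' : Fin n} (hD : D.partner (Sum.inl i) = Sum.inl i') :
    F.partner (Sum.inl i) = Sum.inl i' := by
  obtain ⟨F', hF, hF'⟩ := exists_isComposite D E
  obtain rfl := (hF' F).1 h
  have h1 : glueSetoid D E (outer m (Sum.inl i)) (outer m (Sum.inl i')) :=
    Relation.EqvGen.rel _ _ (Or.inl ⟨Sum.inl i, rfl, by rw [hD]; rfl⟩)
  rcases (hF _ _).1 h1 with h2 | h2
  · exact (D.partner_ne _ (hD.trans (congrArg Sum.inl (Sum.inl_injective h2)))).elim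
  · exact h2.symm

theorem IsComposite.hasLink {C : Fin n → Fin n → Prop} {D : Diagram n m} {E : Diagram m k}
    {F : Diagram n k} (h : D.IsComposite E F) (hD : D.HasLink C) : F.HasLink C := by
  obtain ⟨i, i', h1, h2⟩ := hD
  exact ⟨i, i', h1, h.partner_inl h2⟩

/-- A left point of `S` on a through strand is continued by the reflection of the monic `T` to an
outer right point. So the left links of the composite are those of `S`. -/
theorem IsComposite.hasLink_of_isMonic {C : Fin n → Fin n → Prop} {S : Diagram n m}
    {T : Diagram k m} (hT : T.IsMonic) {F : Diagram n k} (h : S.IsComposite T.flip F)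
    (hF : F.HasLink C) : S.HasLink C := by
  obtain ⟨i, i', h1, h2⟩ := hF
  obtain ⟨F', hF, hF'⟩ := exists_isComposite S T.flip
  obtain rfl := (hF' F).1 h
  rcases hx : S.partner (Sum.inl i) with j | j
  · have h3 := h.partner_inl hx
    rw [h2] at h3
    exact ⟨i, i', h1, by rw [hx, Sum.inl_injective h3]⟩
  · obtain ⟨l, hl⟩ := Sum.isLeft_iff.1 (hT j)
    have h3 : T.flip.partner (Sum.inl j) = Sum.inr l := by
      change (T.partner (Sum.inr j)).swap = _
      rw [hl]
      rfl
    have h4 : glueSetoid S T.flip (outer m (Sum.inl i)) (outer m (Sum.inr l)) :=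
      Relation.EqvGen.trans _ (Sum.inr (Sum.inl j)) _
        (Relation.EqvGen.rel _ _ (Or.inl ⟨Sum.inl i, rfl, by rw [hx]; rfl⟩))
        (Relation.EqvGen.rel _ _ (Or.inr ⟨Sum.inl j, rfl, by rw [h3]; rfl⟩))
    rcases (hF _ _).1 h4 with h5 | h5
    · simp at h5
    · rw [h2] at h5
      simp at h5

/-- Each middle point is joined by the monic `S` to an outer left point. -/
theorem loops_eq_zero {S : Diagram n m} (hS : S.IsMonic) (E : Diagram m k) : S.loops E = 0 := by
  unfold loops
  rw [Nat.card_eq_zero]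
  left
  constructor
  rintro ⟨c, hc⟩
  induction c using Quotient.inductionOn with
  | h x =>
    rcases x with i | j | l
    · exact hc (Sum.inl i) rfl
    · obtain ⟨i, hi⟩ := Sum.isLeft_iff.1 (hS j)
      refine hc (Sum.inl i) (Quotient.sound (Relation.EqvGen.symm _ _
        (Relation.EqvGen.rel _ _ (Or.inl ⟨Sum.inr j, rfl, ?_⟩))))
      rw [hi]
      rfl
    · exact hc (Sum.inr l) rfl

theorem isMonic_identity (n : ℕ) : (identity n).IsMonic := fun _ => rfl

theorem not_hasLink_identity (C : Fin n → Fin n → Prop) : ¬ (identity n).HasLink C := by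
  rintro ⟨i, i', -, h⟩
  simp [identity] at h

end Diagram

/-! ### Cell modules of a link projector -/

section Action
variable {R : Type*} [CommRing R] {δ : R} {n m : ℕ} {e : TL R n}

theorem actOn_apply (S U : Tableau n m) : actOn δ e S U = comp δ e (single S.1) U.1 := by
  simp [actOn, cellAction]

theorem truncatedCell_eq_span : truncatedCell δ m e =
    Submodule.span R (Set.range fun S : Tableau n m => actOn δ e S) := by
  rw [truncatedCell, cellAction, Matrix.range_mulVecLin]
  congr 2
  funext S U
  rw [actOn_apply]
  rfl


variable {C : Fin n → Fin n → Prop}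

/-- A non-identity diagram in the support of `e` has a link in `C`, which survives in all its
composites. At `F` only the identity term of `e` contributes. -/
theorem IsLinkProjector.comp_apply (he : IsLinkProjector δ C e) (g : Mor R n m) {F : Diagram n m}
    (hF : ¬ F.HasLink C) : comp δ e g F = g F := by
  classical
  conv_rhs => rw [← identity_comp δ g]
  unfold comp
  refine Finset.sum_congr rfl fun D _ => Finset.sum_congr rfl fun E _ => ?_
  split_ifs with h
  · have h1 : e D = single (Diagram.identity n) D := by
      by_cases hD : D = Diagram.identity n
      · rw [hD, he.identity]
        exact (Pi.single_eq_same (M := fun _ => R) (Diagram.identity n) 1).symm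
      · rw [single, Pi.single_eq_of_ne hD]
        by_contra hc
        exact hF (h.hasLink ((he.support D hc).resolve_left hD))
    rw [h1]
  · rfl

/-- In the expansion of the second factor, the identity term gives `e` and all other terms are
annihilated. -/
theorem IsLinkProjector.comp_self (he : IsLinkProjector δ C e) : comp δ e e = e := by
  rw [comp_eq_sum, Finset.sum_eq_single (Diagram.identity n), he.identity, one_smul, comp_identity]
  · intro D _ hD
    by_cases h : e D = 0
    · rw [h, zero_smul]
    · rw [he.kills D ((he.support D h).resolve_left hD), smul_zero]
  · simp

theorem IsLinkProjector.actOn_eq_zero (he : IsLinkProjector δ C e) {S : Tableau n m}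
    (hS : S.1.HasLink C) : actOn δ e S = 0 := by
  funext U
  rw [actOn_apply, he.kills _ hS]
  rfl

theorem IsLinkProjector.actOn_apply (he : IsLinkProjector δ C e) (S : Tableau n m)
    {U : Tableau n m} (hU : ¬ U.1.HasLink C) : actOn δ e S U = if U = S then 1 else 0 := by
  rw [TemperleyLieb.actOn_apply, he.comp_apply _ hU, single, Pi.single_apply]
  exact if_congr Subtype.ext_iff.symm rfl rfl

theorem IsLinkProjector.actOn_ne_zero [Nontrivial R] (he : IsLinkProjector δ C e) {S : Tableau n m}
    (hS : ¬ S.1.HasLink C) : actOn δ e S ≠ 0 := by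
  intro h
  have := congrFun h S
  rw [he.actOn_apply S hS, if_pos rfl] at this
  exact one_ne_zero this

theorem IsLinkProjector.killedCell_eq [Nontrivial R] (he : IsLinkProjector δ C e) :
    killedCell δ m e = {S | S.1.HasLink C} :=
  Set.ext fun _ => ⟨fun h => by_contra fun hS => he.actOn_ne_zero hS h, he.actOn_eq_zero⟩

/-- The coordinates at tableaux without link in `C` form the unit matrix on this family, whence
independence; the omitted generators of e Δ(m) are zero. -/
theorem IsLinkProjector.isBasisOf (he : IsLinkProjector δ C e) {P : Tableau n m → Prop}
    (hP : ∀ S, P S ↔ ¬ S.1.HasLink C) :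
    IsBasisOf (fun S : {S : Tableau n m // P S} => actOn δ e S.1) (truncatedCell δ m e) := by
  classical
  constructor
  · rw [Fintype.linearIndependent_iff]
    intro g hg S
    have h1 := congrFun hg S.1
    rw [Finset.sum_apply, Finset.sum_eq_single S] at h1
    · rw [Pi.smul_apply, he.actOn_apply _ ((hP _).1 S.2), if_pos rfl] at h1
      simpa using h1
    · intro S' _ hS'
      rw [Pi.smul_apply, he.actOn_apply _ ((hP _).1 S.2),
        if_neg fun h => hS' (Subtype.ext h.symm), smul_zero]
    · simp
  · rw [truncatedCell_eq_span]
    apply le_antisymm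
    · apply Submodule.span_mono
      rintro _ ⟨S, rfl⟩
      exact ⟨S.1, rfl⟩
    · rw [Submodule.span_le]
      rintro _ ⟨S, rfl⟩
      by_cases hS : S.1.HasLink C
      · change actOn δ e S ∈ _
        rw [he.actOn_eq_zero hS]
        exact Submodule.zero_mem _
      · exact Submodule.subset_span ⟨⟨S, (hP S).2 hS⟩, rfl⟩

theorem IsLinkProjector.isGenerous [Nontrivial R] (he : IsLinkProjector δ C e) :
    IsGenerous δ e := fun m _ =>
  he.isBasisOf fun S => by rw [he.killedCell_eq]; rfl

/-- If `S` has no link in `C`, neither has its composite `F` with the reflection of `T`. As no loops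
arise, `F` has coefficient 1 in the cellular basis element, and `e` leaves this coefficient
unchanged. -/
theorem IsLinkProjector.isLavish [Nontrivial R] (he : IsLinkProjector δ C e) :
    IsLavish δ e := by
  classical
  intro m _ T
  rw [he.killedCell_eq]
  ext S
  constructor
  · intro h
    by_contra hS
    obtain ⟨F, hF, hF'⟩ := Diagram.exists_isComposite S.1 T.1.flip
    have h1 : ¬ F.HasLink C := fun h1 => hS (((hF' F).2 rfl).hasLink_of_isMonic T.2 h1)
    have h2 : cellBasis δ S T F = 1 := by
      unfold cellBasis comp
      rw [Finset.sum_eq_single S.1, Finset.sum_eq_single T.1.flip, if_pos ((hF' F).2 rfl),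
        Diagram.loops_eq_zero S.2]
      · simp [single]
      · intro E _ hE
        simp [single, hE]
      · simp
      · intro D _ hD
        simp [single, hD]
      · simp
    have h3 := congrFun (show comp δ e (cellBasis δ S T) = 0 from h) F
    rw [he.comp_apply _ h1, h2] at h3
    exact one_ne_zero h3
  · intro hS
    change comp δ e (comp δ _ _) = 0
    rw [← comp_assoc, he.kills _ hS]
    funext F
    simp [comp]

theorem IsLinkProjector.mem_truncatedIndices [Nontrivial R] (he : IsLinkProjector δ C e) :
    m ∈ truncatedIndices δ e ↔
      m ∈ cellIndices n ∧ ∃ S : Diagram n m, S.IsMonic ∧ ¬ S.HasLink C := by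
  refine and_congr_right fun _ => ?_
  rw [truncatedCell_eq_span, Ne, Submodule.span_eq_bot]
  constructor
  · intro h
    by_contra hc
    push Not at hc
    refine h ?_
    rintro _ ⟨S, rfl⟩
    exact he.actOn_eq_zero (hc S.1 S.2)
  · rintro ⟨S, h1, h2⟩ h
    exact he.actOn_ne_zero (S := ⟨S, h1⟩) h2 (h _ ⟨_, rfl⟩)

/-- An index is witnessed by a monic diagram without link in `C`. Cutting a left link creates no new
left link, so the witness for m < n yields one for m + 2; the identity is a witness for n. -/
theorem IsLinkProjector.truncatedIndices_eq [Nontrivial R] (he : IsLinkProjector δ C e) :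
    ∃ s ∈ cellIndices n, truncatedIndices δ e = {m | s ≤ m ∧ m ≤ n ∧ m ≡ n [MOD 2]} := by
  classical
  have h1 : ∃ m, m ∈ truncatedIndices δ e :=
    ⟨n, he.mem_truncatedIndices.2 ⟨⟨le_rfl, rfl⟩, _, Diagram.isMonic_identity n,
      Diagram.not_hasLink_identity C⟩⟩
  have h2 : ∀ m, m ∈ truncatedIndices δ e → m < n → m + 2 ∈ truncatedIndices δ e := by
    intro m hm hmn
    obtain ⟨⟨h3, h4⟩, S, h5, h6⟩ := he.mem_truncatedIndices.1 hm
    obtain ⟨S', h7, h8⟩ := S.exists_cut h5 hmn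
    unfold Nat.ModEq at h4
    refine he.mem_truncatedIndices.2 ⟨⟨by omega, show _ % _ = _ % _ by omega⟩, S', h7, ?_⟩
    rintro ⟨i, i', h9, h10⟩
    exact h6 ⟨i, i', h9, h8 _ _ h10⟩
  have hs := Nat.find_spec h1
  refine ⟨Nat.find h1, hs.1, ?_⟩
  have h3 : ∀ k, Nat.find h1 + 2 * k ≤ n → Nat.find h1 + 2 * k ∈ truncatedIndices δ e := by
    intro k
    induction k with
    | zero => exact fun _ => hs
    | succ k ih => exact fun h => h2 _ (ih (by omega)) (show Nat.find h1 + 2 * k < n by omega)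
  ext m
  constructor
  · exact fun h => ⟨Nat.find_min' h1 h, h.1⟩
  · rintro ⟨h4, h5, h6⟩
    have h7 := hs.1.2
    unfold Nat.ModEq at h6 h7
    obtain ⟨k, rfl⟩ : ∃ k, m = Nat.find h1 + 2 * k := ⟨(m - Nat.find h1) / 2, by omega⟩
    exact h3 k h5

end Action

/-! ### The q-binomial theorem at roots of unity -/

section GaussPoly

/-- The generating polynomial of the Gaussian binomial coefficients. -/
noncomputable def gaussPoly {S : Type*} [CommRing S] (Q : S) (n : ℕ) : S[X] :=
  ∏ i ∈ Finset.range n, (1 - C (Q ^ (i + 1)) * X)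

/-- The q-binomial theorem, by comparing coefficients in P_{n+1}(X) = P_n(QX) (1 - QX). -/
theorem coeff_gaussPoly {S : Type*} [CommRing S] (Q : S) (n k : ℕ) :
    (gaussPoly Q n).coeff k = (∏ i ∈ Finset.range k, -Q ^ (i + 1)) * gauss Q n k := by
  induction n generalizing k with
  | zero => cases k <;> simp [gaussPoly, gauss, coeff_one]
  | succ n ih =>
    have h1 : gaussPoly Q (n + 1) =
        (gaussPoly Q n).comp (C Q * X) - (gaussPoly Q n).comp (C Q * X) * X * C Q := by
      rw [gaussPoly, Finset.prod_range_succ', gaussPoly, prod_comp]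
      have h2 : ∀ i, (1 - C (Q ^ (i + 1)) * X : S[X]).comp (C Q * X) =
          1 - C (Q ^ (i + 1 + 1)) * X := fun i => by
        simp [pow_succ, mul_assoc]
      rw [Finset.prod_congr rfl fun i _ => h2 i, zero_add, pow_one]
      ring
    rw [h1]
    cases k with
    | zero => simp [ih, mul_coeff_zero]
    | succ k =>
      rw [coeff_sub, coeff_mul_C, coeff_mul_X, comp_C_mul_X_coeff, comp_C_mul_X_coeff, ih, ih,
        gauss_succ_succ, Finset.prod_range_succ]
      ring

/-- The factors are periodic in `i` with period `N`. -/
theorem gaussPoly_mul {S : Type*} [CommRing S] {Q : S} {N : ℕ} (hQ : Q ^ N = 1) (m : ℕ) :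
    gaussPoly Q (m * N) = gaussPoly Q N ^ m := by
  induction m with
  | zero => simp [gaussPoly]
  | succ m ih =>
    rw [pow_succ, ← ih, Nat.succ_mul, gaussPoly, Finset.prod_range_add]
    refine congrArg _ (Finset.prod_congr rfl fun i _ => ?_)
    rw [add_assoc, pow_add, mul_comm m, pow_mul, hQ, one_pow, one_mul]

variable {K : Type*} [Field K] {Q : K}

theorem pow_eq_one_of_qint_eq_zero {N : ℕ} (h : qint Q N = 0) : Q ^ N = 1 := by
  have h1 := geom_sum_mul Q N
  rw [show ∑ i ∈ Finset.range N, Q ^ i = 0 from h, zero_mul] at h1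
  exact (sub_eq_zero.1 h1.symm)

/-- The middle coefficients vanish because [k] · (L choose k) = [L] · (L-1 choose k-1) = 0 with [k]
≠ 0. The top coefficient follows from the root X = 1 of the last factor. The argument also covers Q
= 1. -/
theorem gaussPoly_eq_one_sub_pow {L : ℕ} (hL : 0 < L) (h0 : qint Q L = 0)
    (h : ∀ k, 0 < k → k < L → qint Q k ≠ 0) : gaussPoly Q L = 1 - X ^ L := by
  have h1 : ∃ c, gaussPoly Q L = 1 + C c * X ^ L := by
    refine ⟨(gaussPoly Q L).coeff L, ?_⟩
    ext k
    rw [coeff_add, coeff_C_mul_X_pow, coeff_one]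
    rcases Nat.eq_zero_or_pos k with rfl | hk
    · simp [coeff_gaussPoly, hL.ne]
    rw [if_neg hk.ne', zero_add]
    split_ifs with hkL
    · rw [hkL]
    rw [coeff_gaussPoly]
    rcases Nat.lt_or_ge L k with h1 | h1
    · rw [gauss_eq_zero Q h1, mul_zero]
    obtain ⟨k, rfl⟩ := Nat.exists_eq_succ_of_ne_zero hk.ne'
    obtain ⟨L, rfl⟩ := Nat.exists_eq_succ_of_ne_zero hL.ne'
    have h2 := qint_mul_gauss_succ Q L k
    rw [show qint Q (L + 1) = 0 from h0, zero_mul] at h2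
    rw [Nat.succ_eq_add_one, Nat.succ_eq_add_one,
      (mul_eq_zero.1 h2).resolve_left (h _ hk (lt_of_le_of_ne h1 hkL)), mul_zero]
  obtain ⟨c, hc⟩ := h1
  have h2 : eval 1 (gaussPoly Q L) = 0 := by
    rw [gaussPoly, eval_prod]
    refine Finset.prod_eq_zero (Finset.mem_range.2 (Nat.sub_lt hL one_pos)) ?_
    rw [show L - 1 + 1 = L from Nat.sub_add_cancel hL, pow_eq_one_of_qint_eq_zero h0]
    simp
  rw [hc] at h2
  simp only [eval_add, eval_one, eval_mul, eval_C, eval_pow, eval_X, one_pow, mul_one] at h2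
  rw [hc, eq_neg_of_add_eq_zero_right h2]
  simp [sub_eq_add_neg]

theorem cast_choose_ne_zero {m : ℕ} (h : ∀ i : ℕ, 0 < i → i ≤ m → (i : K) ≠ 0) {k : ℕ}
    (hk : k ≤ m) : ((m.choose k : ℕ) : K) ≠ 0 := by
  have h1 : ((m.factorial : ℕ) : K) ≠ 0 := by
    rw [← Finset.prod_range_add_one_eq_factorial, Nat.cast_prod, Finset.prod_ne_zero_iff]
    intro i hi
    exact h _ (Nat.succ_pos i) (Finset.mem_range.1 hi)
  rw [← Nat.choose_mul_factorial_mul_factorial hk, mul_assoc, Nat.cast_mul] at h1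
  exact left_ne_zero_of_mul h1

/-- By uniqueness of division with remainder, exactly one term of the geometric sum reaches the
exponent aN + b. -/
theorem coeff_geom_mul_expand {S : Type*} [CommRing S] {N : ℕ} (g : S[X]) (a : ℕ) {b : ℕ}
    (hb : b < N) :
    ((∑ i ∈ Finset.range N, X ^ i) * expand S N g).coeff (a * N + b) = g.coeff a := by
  rw [Finset.sum_mul, finsetSum_coeff, Finset.sum_eq_single b]
  · rw [coeff_X_pow_mul, coeff_expand_mul (by omega)]
  · intro i hi hib
    rw [coeff_X_pow_mul']
    split_ifs with h
    · rw [coeff_expand (by omega), if_neg]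
      rintro ⟨c, hc⟩
      have hi := Finset.mem_range.1 hi
      have h1 : (a * N + b) % N = (c * N + i) % N := by
        rw [mul_comm c]
        congr 1
        omega
      rw [Nat.mul_add_mod_of_lt hb, Nat.mul_add_mod_of_lt hi] at h1
      exact hib h1.symm
    · rfl
  · intro h
    exact (h (Finset.mem_range.2 hb)).elim

/-- The product over i ≤ n equals (1 + ⋯ + X^{N-1}) (1 - X^N)^{a-1}, whose coefficient at X^k is, up
to sign, the ordinary binomial (a-1 choose ⌊k/N⌋), a divisor of (a-1)!. -/
theorem gauss_ne_zero_of_gaussPoly {N a n k : ℕ} (hQ : Q ^ N = 1)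
    (hP : gaussPoly Q N = 1 - X ^ N) (ha : ∀ i : ℕ, 0 < i → i < a → (i : K) ≠ 0)
    (hn : n + 1 = a * N) (hk : k ≤ n) : gauss Q n k ≠ 0 := by
  have ha0 : 0 < a := Nat.pos_of_ne_zero fun h => by simp [h] at hn
  have hN : 0 < N := Nat.pos_of_ne_zero fun h => by simp [h] at hn
  -- The missing factor, of index n + 1 = aN, is 1 - Q^{aN} X = 1 - X.
  have h1 : gaussPoly Q n * (1 - X) = (1 - X ^ N) ^ a := by
    rw [← hP, ← gaussPoly_mul hQ, ← hn, gaussPoly, gaussPoly, Finset.prod_range_succ, hn,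
      mul_comm a, pow_mul, hQ, one_pow, map_one, one_mul]
  have h2 : gaussPoly Q n =
      (∑ i ∈ Finset.range N, X ^ i) * expand K N ((1 - X) ^ (a - 1)) := by
    have h3 : (1 - X : K[X]) ≠ 0 := fun h => by
      have := congrArg (eval 0) h
      simp at this
    apply mul_right_cancel₀ h3
    rw [h1, mul_right_comm, geom_sum_mul_neg, map_pow, map_sub, map_one, expand_X, ← pow_succ',
      Nat.sub_add_cancel ha0]
  have h3 := coeff_gaussPoly Q n k
  have h4 : k / N < a := Nat.div_lt_of_lt_mul (by rw [mul_comm, ← hn]; omega)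
  have h5 : (gaussPoly Q n).coeff k ≠ 0 := by
    rw [h2, ← Nat.div_add_mod' k N, coeff_geom_mul_expand _ _ (Nat.mod_lt _ hN),
      show (1 - X : K[X]) = -(X + C (-1)) by simp [sub_eq_add_neg], neg_pow, ← C_1, ← C_neg, ← C_pow, coeff_C_mul,
      coeff_X_add_C_pow]
    refine mul_ne_zero (pow_ne_zero _ (by simp)) (mul_ne_zero (pow_ne_zero _ (by simp)) ?_)
    exact cast_choose_ne_zero (fun i h5 h6 => ha i h5 (by omega)) (by omega)
  rw [h3] at h5
  exact right_ne_zero_of_mul h5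

/-- Periodicity makes the product a p^s-th power of 1 - X^L, to which Frobenius applies. -/
theorem gaussPoly_mul_pow {p : ℕ} [Fact p.Prime] [CharP K p] {L : ℕ} (hQ : Q ^ L = 1)
    (hP : gaussPoly Q L = 1 - X ^ L) (s : ℕ) :
    gaussPoly Q (L * p ^ s) = 1 - X ^ (L * p ^ s) := by
  rw [mul_comm, gaussPoly_mul hQ, hP, sub_pow_char_pow, one_pow, ← pow_mul, mul_comm]

end GaussPoly

theorem HasTorsion.map {R T : Type*} [CommRing R] [CommRing T] {δ : R} {ℓ p : ℕ∞}
    (h : HasTorsion δ ℓ p) {φ : R →+* T} (hφ : Function.Injective φ) :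
    HasTorsion (φ δ) ℓ p where
  ell_pos := h.ell_pos
  qnum_ne_zero k h1 h2 := by
    rw [← qnum_map]
    exact (map_ne_zero_iff φ hφ).2 (h.qnum_ne_zero k h1 h2)
  qnum_eq_zero k h1 := by rw [← qnum_map, h.qnum_eq_zero k h1, map_zero]
  p_pos := h.p_pos
  cast_ne_zero k h1 h2 := by
    rw [← map_natCast φ]
    exact (map_ne_zero_iff φ hφ).2 (h.cast_ne_zero k h1 h2)
  cast_eq_zero k h1 := by rw [← map_natCast φ, h.cast_eq_zero k h1, map_zero]

/-! ### Gaussian binomials at Eve numbers -/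

section Eve
variable {K : Type*} [Field K]

theorem HasTorsion.charP {δ : K} {ℓ : ℕ∞} {p : ℕ} (h : HasTorsion δ ℓ p) :
    p.Prime ∧ CharP K p := by
  obtain ⟨c, hc⟩ := CharP.exists K
  have h1 : c ∣ p := (CharP.cast_eq_zero_iff K c p).1 (h.cast_eq_zero p rfl)
  have hp : 0 < p := by exact_mod_cast h.p_pos
  have h2 : c = p := by
    refine (Nat.le_of_dvd hp h1).antisymm (not_lt.1 fun h2 => ?_)
    exact h.cast_ne_zero c (Nat.pos_of_dvd_of_pos h1 hp) (by exact_mod_cast h2)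
      (CharP.cast_eq_zero K c)
  subst h2
  exact ⟨(CharP.char_is_prime_or_zero K c).resolve_right hp.ne', hc⟩

/-- For r = 0 only quantum numbers below ℓ enter the absorption rule. For r ≥ 1 the period is N =
p^{(r)}, and the digit a < p keeps the ordinary binomials of a - 1 nonzero. -/
theorem gauss_ne_zero_of_isEve {ℓ p : ℕ∞} (q : Kˣ)
    (h : HasTorsion ((q : K) + ((q⁻¹ : Kˣ) : K)) ℓ p) {n k : ℕ} (hn : IsEve ℓ p n) (hk : k ≤ n) :
    gauss ((q : K) ^ 2) n k ≠ 0 := by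
  have hqint : ∀ m : ℕ, 0 < m → (m : ℕ∞) < ℓ → qint ((q : K) ^ 2) m ≠ 0 := by
    intro m hm hml
    obtain ⟨m, rfl⟩ := Nat.exists_eq_succ_of_ne_zero hm.ne'
    rw [Nat.succ_eq_add_one, qint_eq_qnum]
    exact mul_ne_zero (pow_ne_zero _ q.ne_zero) (h.qnum_ne_zero _ hm hml)
  obtain ⟨a, r, ha, har, hna⟩ := hn
  cases r with
  | zero =>
    rw [mixedPow, mul_one] at hna
    rw [if_pos rfl, ← hna] at har
    induction k with
    | zero => simp
    | succ k ih =>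
      have h1 := qint_mul_gauss ((q : K) ^ 2) n k
      have h2 : qint ((q : K) ^ 2) (n - k) * gauss ((q : K) ^ 2) n k ≠ 0 :=
        mul_ne_zero (hqint _ (by omega) (lt_of_le_of_lt (by exact_mod_cast by omega) har))
          (ih (by omega))
      rw [← h1] at h2
      exact right_ne_zero_of_mul h2
  | succ r =>
    rw [if_neg (Nat.succ_ne_zero r)] at har
    rw [mixedPow] at hna
    have ha' : (a : ℕ∞) ≠ 0 := by exact_mod_cast ha.ne'
    have hpr : p ^ r ≠ 0 := pow_ne_zero _ h.p_pos.ne'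
    -- For r ≥ 1 an infinite ℓ would make n + 1 infinite.
    obtain ⟨L, rfl⟩ : ∃ L : ℕ, ℓ = L := by
      refine ENat.ne_top_iff_exists.1 ?_ |>.imp fun _ => Eq.symm
      rintro rfl
      rw [ENat.top_mul hpr, ENat.mul_top ha'] at hna
      exact ENat.natCast_ne_top _ hna
    have hL : 0 < L := by exact_mod_cast h.ell_pos
    have h0 : qint ((q : K) ^ 2) L = 0 := by
      obtain ⟨L, rfl⟩ := Nat.exists_eq_succ_of_ne_zero hL.ne'
      rw [Nat.succ_eq_add_one, qint_eq_qnum, h.qnum_eq_zero _ rfl, mul_zero]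
    have hQ := pow_eq_one_of_qint_eq_zero h0
    have hP := gaussPoly_eq_one_sub_pow hL h0 fun k h1 h2 => hqint k h1 (by exact_mod_cast h2)
    have hac : ∀ i : ℕ, 0 < i → i < a → (i : K) ≠ 0 := fun i h1 h2 =>
      h.cast_ne_zero i h1 (lt_trans (by exact_mod_cast h2) har)
    cases r with
    | zero =>
      rw [pow_zero, mul_one] at hna
      exact gauss_ne_zero_of_gaussPoly hQ hP hac (by exact_mod_cast hna) hk
    | succ r =>
      -- Here p occurs with positive exponent and must be finite, hence is the prime characteristic
      -- of K.
      obtain ⟨P, rfl⟩ : ∃ P : ℕ, p = P := by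
        refine ENat.ne_top_iff_exists.1 ?_ |>.imp fun _ => Eq.symm
        rintro rfl
        rw [ENat.top_pow (Nat.succ_ne_zero r), ENat.mul_top (by exact_mod_cast hL.ne'),
          ENat.mul_top ha'] at hna
        exact ENat.natCast_ne_top _ hna
      obtain ⟨h1, h2⟩ := h.charP
      have := Fact.mk h1
      refine gauss_ne_zero_of_gaussPoly (N := L * P ^ (r + 1)) ?_ (gaussPoly_mul_pow hQ hP _) hac
        (by exact_mod_cast hna) hk
      rw [pow_mul, hQ, one_pow]

end Eve

/-! ### Denominators and existence over a field -/

section Denominator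

theorem norm_quadMap {R T : Type*} [CommRing R] [CommRing T] (φ : R →+* T) {δ : R} {δ' : T}
    (h : φ δ = δ') (z : Quad δ) : (quadMap φ h z).norm = φ z.norm := by
  simp [quadMap, QuadraticAlgebra.norm_def, ← h]

theorem star_quadUnit {R : Type*} [CommRing R] (δ : R) :
    star (quadUnit δ : Quad δ) = ((quadUnit δ)⁻¹ : (Quad δ)ˣ) := by
  change star (⟨0, 1⟩ : Quad δ) = ⟨δ, -1⟩
  ext <;> simp

theorem exists_eval_quadUnit {K : Type*} [CommRing K] {δ : K} (q : Kˣ)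
    (hq : (q : K) + ((q⁻¹ : Kˣ) : K) = δ) :
    ∃ ψ : Quad δ →ₐ[K] K, ψ (quadUnit δ : Quad δ) = q := by
  refine ⟨QuadraticAlgebra.lift ⟨(q : K), ?_⟩, ?_⟩
  · rw [← hq, smul_eq_mul, smul_eq_mul, add_mul, Units.inv_mul]
    ring
  · simp [quadUnit]

/-- The norm is the product with the conjugate, and conjugation exchanges the formal q with its
inverse. The formula results from evaluating the formal q at an actual one. -/
theorem norm_gauss {K : Type*} [CommRing K] {δ : K} (q : Kˣ)
    (hq : (q : K) + ((q⁻¹ : Kˣ) : K) = δ) (n k : ℕ) :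
    (gauss ((quadUnit δ : Quad δ) ^ 2) n k).norm =
      gauss ((q : K) ^ 2) n k * gauss (((q⁻¹ : Kˣ) : K) ^ 2) n k := by
  obtain ⟨ψ, hψ⟩ := exists_eval_quadUnit q hq
  have h1 : ψ ((quadUnit δ)⁻¹ : (Quad δ)ˣ) = ((q⁻¹ : Kˣ) : K) := by
    have h2 := congrArg ψ (Units.mul_inv (quadUnit δ))
    rw [map_mul, hψ, map_one] at h2
    rw [← Units.inv_mul_cancel_left q (ψ _), h2, mul_one]
  have h2 := congrArg ψ (QuadraticAlgebra.algebraMap_norm_eq_mul_star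
    (gauss ((quadUnit δ : Quad δ) ^ 2) n k))
  have h3 := gauss_map ((quadUnit δ : Quad δ) ^ 2) (starRingEnd (Quad δ)) n k
  have h4 := gauss_map ((quadUnit δ : Quad δ) ^ 2) (ψ : Quad δ →+* K) n k
  have h5 := gauss_map ((((quadUnit δ)⁻¹ : (Quad δ)ˣ) : Quad δ) ^ 2) (ψ : Quad δ →+* K) n k
  rw [starRingEnd_apply, starRingEnd_apply, star_pow, star_quadUnit] at h3
  simp only [RingHom.coe_coe, map_pow, hψ, h1] at h4 h5
  rwa [map_mul, h3, h4, h5, AlgHom.commutes] at h2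

/-- A common denominator of the coefficients of the generic Jones-Wenzl idempotent. -/
noncomputable def denominator (n : ℕ) : ℤ[X] :=
  ∏ k ∈ Finset.range (n + 1), (gauss ((quadUnit (X : ℤ[X]) : Quad (X : ℤ[X])) ^ 2) n k).norm

theorem symVec_map {S T : Type*} [CommRing S] [CommRing T] (φ : S →+* T) (q : S) {n : ℕ}
    (s : Fin n → Bool) : φ (symVec q s) = symVec (φ q) s := by
  induction n with
  | zero => exact map_one φ
  | succ n ih =>
    rw [symVec, symVec, map_mul, ih]
    split_ifs <;> simp

/-- A Gaussian binomial divides its norm, a factor of the denominator. So the denominator moves all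
entries of `symProj` into the subring generated over ℤ[X] by q; `mem_of_rep_mem` transfers this to
the coefficients, and the real part is the required polynomial. -/
theorem exists_numerator (n : ℕ) : ∃ h : TL ℤ[X] n, ∀ D,
    jonesWenzl n D * algebraMap ℤ[X] GenField (denominator n) = algebraMap ℤ[X] GenField (h D) := by
  have hg : algebraMap ℤ[X] GenField X = genDelta := rfl
  have hu : quadMap _ hg (quadUnit (X : ℤ[X])) = (quadUnit genDelta : Quad genDelta) :=
    congrArg Units.val (map_quadUnit (algebraMap ℤ[X] GenField) hg)
  let A := (quadMap _ hg).range
  have hq : (quadUnit genDelta : Quad genDelta) ∈ A := ⟨_, hu⟩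
  have hinv : ∀ k ≤ n, algebraMap GenField (Quad genDelta)
      (algebraMap ℤ[X] GenField (denominator n)) *
      Ring.inverse (gauss ((quadUnit genDelta : Quad genDelta) ^ 2) n k) ∈ A := by
    intro k hk
    by_cases h : IsUnit (gauss ((quadUnit genDelta : Quad genDelta) ^ 2) n k)
    · have h1 : gauss ((quadUnit (X : ℤ[X]) : Quad (X : ℤ[X])) ^ 2) n k ∣
          algebraMap ℤ[X] (Quad (X : ℤ[X])) (denominator n) :=
        (Dvd.intro _ (QuadraticAlgebra.algebraMap_norm_eq_mul_star _).symm).trans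
          (map_dvd _ (Finset.dvd_prod_of_mem _ (Finset.mem_range.2 (Nat.lt_succ_of_le hk))))
      obtain ⟨c, hc⟩ := h1
      refine ⟨c, ?_⟩
      rw [← quadMap_algebraMap _ hg, hc, map_mul, gauss_map, map_pow, hu, mul_right_comm,
        Ring.mul_inverse_cancel _ h, one_mul]
    · rw [Ring.inverse_non_unit _ h, mul_zero]
      exact A.zero_mem
  have hmem : ∀ D, algebraMap GenField (Quad genDelta) (jonesWenzl n D *
      algebraMap ℤ[X] GenField (denominator n)) ∈ A.toAddSubgroup := by
    refine mem_of_rep_mem (quadUnit genDelta) A.toAddSubgroup (fun x hx => A.mul_mem hx hq) _ ?_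
    intro s t
    change quadRep genDelta (fun D => jonesWenzl n D * _) s t ∈ A
    rw [quadRep_smul, quadRep_jonesWenzl, Matrix.smul_apply, Algebra.smul_def, symProj]
    split_ifs
    · rw [mul_left_comm]
      refine A.mul_mem (A.mul_mem ?_ ?_) (hinv _ (ones_le s))
      · exact ⟨_, (symVec_map _ _ s).trans (by rw [hu])⟩
      · exact ⟨_, (symVec_map _ _ t).trans (by rw [hu])⟩
    · rw [mul_zero]
      exact A.zero_mem
  choose z hz using hmem
  exact ⟨fun D => (z D).re, fun D => (congrArg QuadraticAlgebra.re (hz D)).symm⟩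

variable {R : Type*} [CommRing R] [IsDomain R] {δ : R}

/-- q is a root of X² - δX + 1. -/
theorem exists_unit_add_inv {K : Type*} [Field K] [IsAlgClosed K] (δ : K) :
    ∃ q : Kˣ, (q : K) + ((q⁻¹ : Kˣ) : K) = δ := by
  obtain ⟨x, hx⟩ := IsAlgClosed.exists_root (C 1 * X ^ 2 + C (-δ) * X + C 1 : K[X])
    (by rw [degree_quadratic one_ne_zero]; decide)
  have h : x * (δ - x) = 1 := by
    simp [IsRoot] at hx
    linear_combination -hx
  exact ⟨⟨x, δ - x, h, by rw [mul_comm, h]⟩, add_sub_cancel x δ⟩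

/-- Over an algebraic closure of the fraction field there is an actual q, and each norm splits into
Gaussian binomials at q² and q⁻². Both are nonzero, because q and q⁻¹ give the same δ. -/
theorem aeval_denominator_ne_zero {ℓ p : ℕ∞} (h : HasTorsion δ ℓ p) {n : ℕ} (hn : IsEve ℓ p n) :
    aeval δ (denominator n) ≠ 0 := by
  let K := AlgebraicClosure (FractionRing R)
  let φ : R →+* K := (algebraMap (FractionRing R) K).comp (algebraMap R (FractionRing R))
  have hφ : Function.Injective φ :=
    (algebraMap (FractionRing R) K).injective.comp (IsFractionRing.injective R (FractionRing R))
  obtain ⟨q, hq⟩ := exists_unit_add_inv (φ δ)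
  let θ : ℤ[X] →+* K := φ.comp (aeval δ : ℤ[X] →ₐ[ℤ] R).toRingHom
  have hθ : θ X = φ δ := congrArg φ (aeval_X δ)
  have h1 := h.map hφ
  intro h0
  have h2 : θ (denominator n) = 0 := (congrArg φ h0).trans (map_zero φ)
  rw [denominator, map_prod, Finset.prod_eq_zero_iff] at h2
  obtain ⟨k, hk, h3⟩ := h2
  have hu : quadMap θ hθ (quadUnit (X : ℤ[X])) = (quadUnit (φ δ) : Quad (φ δ)) :=
    congrArg Units.val (map_quadUnit θ hθ)
  rw [← norm_quadMap θ hθ, gauss_map, map_pow, hu, norm_gauss q hq] at h3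
  have hk' := Nat.lt_succ_iff.1 (Finset.mem_range.1 hk)
  rcases mul_eq_zero.1 h3 with h4 | h4
  · exact gauss_ne_zero_of_isEve q (by rwa [hq]) hn hk' h4
  · exact gauss_ne_zero_of_isEve q⁻¹ (by rwa [inv_inv, add_comm, hq]) hn hk' h4

/-- The field hypothesis serves to divide the specialised numerators by the nonzero value of the
common denominator. -/
theorem existsUnique_isJonesWenzl (hR : IsField R) {ℓ p : ℕ∞} (h : HasTorsion δ ℓ p) {n : ℕ}
    (hn : IsEve ℓ p n) : ∃! e : TL R n, IsJonesWenzl δ e := by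
  obtain ⟨g, hg⟩ := exists_numerator n
  have h0 := aeval_denominator_ne_zero h hn
  obtain ⟨c, hc⟩ := hR.mul_inv_cancel h0
  have h1 : IsJonesWenzl δ fun D => aeval δ (g D) * c := fun D =>
    ⟨g D, denominator n, h0, hg D, by rw [mul_assoc, mul_comm c, hc, mul_one]⟩
  exact ⟨_, h1, fun e he => funext fun D => he.eq_of_eq h1 rfl⟩

end Denominator

end TemperleyLieb

/-! ### The proposition -/

open TemperleyLieb in
theorem mainTheorem11 {R : Type*} [CommRing R] [IsDomain R] (δ : R) (ℓ p : ℕ∞)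
    (hR : HasTorsion δ ℓ p) (μ : List ℕ) (hμ : ∀ a ∈ μ, IsEve ℓ p a) :
    -- over a field the Jones-Wenzl idempotents of the Eve parts exist
    (IsField R → ∀ a ∈ μ, ∃! e : TL R a, IsJonesWenzl δ e) ∧
    -- whenever they exist over `R`, the element `E = e^μ` has the asserted properties
    ∀ e : (a : ℕ) → TL R a, (∀ a ∈ μ, IsJonesWenzl δ (e a)) →
      ∀ E : TL R μ.sum, E = tensorIdem e μ →
        (comp δ E E = E ∧ involution E = E) ∧
        IsGenerous δ E ∧
        IsLavish δ E ∧
        (∀ m ∈ cellIndices μ.sum,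
          killedCell δ m E = {S | HasBucketCap μ S} ∧
          IsBasisOf (fun S : {S : Tableau μ.sum m // ¬ HasBucketCap μ S} => actOn δ E S.1)
            (truncatedCell δ m E)) ∧
        ∃ s ∈ cellIndices μ.sum,
          truncatedIndices δ E = {m | s ≤ m ∧ m ≤ μ.sum ∧ m ≡ μ.sum [MOD 2]} := by
  refine ⟨fun hF a ha => ?_, ?_⟩
  · exact existsUnique_isJonesWenzl hF hR (hμ a ha)
  · rintro e he E rfl
    have hE := isLinkProjector_tensorIdem he
    have hC : ∀ {m : ℕ} (S : Tableau μ.sum m),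
        HasBucketCap μ S ↔ S.1.HasLink (BucketNeighbours μ) := fun S =>
      ⟨fun ⟨i, i', h1, h2, h3⟩ => ⟨i, i', ⟨h1, h3⟩, h2⟩, fun ⟨i, i', ⟨h1, h3⟩, h2⟩ =>
        ⟨i, i', h1, h2, h3⟩⟩
    refine ⟨⟨hE.comp_self, involution_tensorIdem he⟩, hE.isGenerous, hE.isLavish,
      fun m _ => ⟨?_, hE.isBasisOf fun S => not_congr (hC S)⟩, hE.truncatedIndices_eq⟩
    rw [hE.killedCell_eq]
    exact Set.ext fun S => (hC S).symm
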